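/- Let $S$ be a scheme, let $s\in S$ be a point with local ring $\mathcal O_{S,s}$, maximal ideal $\mathfrak m_s$ and residue field $F=k(s)$, and let $E$ be an extension field of $F$. Let $L_{E/S}$ denote the cotangent complex of the morphism $\operatorname{Spec}E\to\operatorname{Spec}F\to S$. Since $\operatorname{Spec}E$ is a single point, $L_{E/S}$ is the complex of $E$-vector spaces $L_{E/\mathcal O_{S,s}}$ attached to the simplicial $E$-vector space $n\mapsto E\otimes_{P_n}\Omega^1_{P_n/\mathcal O_{S,s}}$, where $P_\bullet\to E$ is the standard simplicial resolution of the $\mathcal O_{S,s}$-algebra $E$ by polynomial algebras. Let $L_{F/S}$ and $L_{E/F}$ be defined in the same way. Write $\Omega^1_F=\Omega^1_{F/\mathbf Z}$ and $\Omega^1_E=\Omega^1_{E/\mathbf Z}$ for the absolute differentials, and $H_i$ for the homology in cohomological degree $-i$. 1. The canonical map $H_0(L_{E/S})\to H_0(L_{E/F})\to\Omega^1_{E/F}$ is an isomorphism. The canonical map $H_1(L_{F/S})\to\mathfrak m_s/\mathfrak m_s^2$ is an isomorphism. Let $\alpha\colon \mathfrak m_s/\mathfrak m_s^2\otimes_FE\to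 H_1(L_{E/S})$ be the map obtained, through this isomorphism, from the canonical map $H_1(L_{F/S})\otimes_FE\to H_1(L_{E/S})$. Let $-\partial\colon H_1(L_{E/S})\to\Omega^1_F\otimes_FE$ be the composite of the canonical map $H_1(L_{E/S})\to H_1(L_{E/F})$ and of minus the boundary map $H_1(L_{E/F})\to\Omega^1_F\otimes_FE$ of the distinguished triangle $L_{F/\mathbf Z}\otimes^L_FE\to L_{E/\mathbf Z}\to L_{E/F}\to$. Then the sequence of $E$-vector spaces $$0\to\mathfrak m_s/\mathfrak m_s^2\otimes_FE\xrightarrow{\ \alpha\ }H_1(L_{E/S})\xrightarrow{-\partial}\operatorname{Ker}\bigl(\Omega^1_F\otimes_FE\to\Omega^1_E\bigr)\to0$$ is exact. 2. If $F$ has characteristic $p>0$ and $E$ is an extension of $F^{1/p}$ (that is, every element of $F$ is a $p$-th power in $E$), then the sequence $$0\to\mathfrak m_s/\mathfrak m_s^2\otimes_FE\xrightarrow{\ \alpha\ }H_1(L_{E/S})\xrightarrow{-\partial}\Omega^1_F\otimes_FE\to0$$ is exact. 3. Let $E'$ be an extension field of $E$. Then the canonical map $H_1(L_{E/S})\otimes_EE'\to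 H_1(L_{E'/S})$ is injective. It is an isomorphism if $F$ has characteristic $0$, and also if $F$ has characteristic $p>0$ and $E$ is an extension of $F^{1/p}$. 4. If $S$ is regular at $s$ (that is, $\mathcal O_{S,s}$ is a regular local ring), then $H_n(L_{E/S})=0$ for all $n\ne 0,1$. If moreover $\Omega^1_{E/F}=0$, then $H_n(L_{E/S})=0$ for all $n\neq 1$. -/

import Mathlib

open Algebra TensorProduct CategoryTheory

universe u

namespace CotangentComplex

noncomputable section

attribute [local instance] SMulCommClass.of_commMonoid

/-- The free cover of an extension `P → B` of `A`-algebras: the polynomial `A`-algebra `A[P]` on the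
underlying set of `P`, with the composite `A[P] → P → B`. -/
def free {A B : Type u} [CommRing A] [CommRing B] [Algebra A B] (P : Extension.{u} A B) :
    Extension.{u} A B where
  Ring := MvPolynomial P.Ring A
  algebra₂ := (MvPolynomial.aeval (R := A) (algebraMap P.Ring B)).toAlgebra
  isScalarTower := by
    let := (MvPolynomial.aeval (R := A) (algebraMap P.Ring B)).toAlgebra
    exact IsScalarTower.of_algebraMap_eq'
      (MvPolynomial.aeval (R := A) (algebraMap P.Ring B)).comp_algebraMap.symm
  σ b := MvPolynomial.X (P.σ b)
  algebraMap_σ b := by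
    change MvPolynomial.aeval (R := A) (algebraMap P.Ring B) (MvPolynomial.X (P.σ b)) = b
    simp

/-- The variable `[p]` of `A[P]`. -/
def free.X {A B : Type u} [CommRing A] [CommRing B] [Algebra A B] (P : Extension.{u} A B)
    (p : P.Ring) : (free P).Ring :=
  (MvPolynomial.X p : MvPolynomial P.Ring A)

/-- The evaluation `A[P] → P`, sending the variable `[p]` to `p`. -/
def free.counit {A B : Type u} [CommRing A] [CommRing B] [Algebra A B] (P : Extension.{u} A B) :
    (free P).Hom P where
  toRingHom := (MvPolynomial.aeval (R := A) (fun p : P.Ring => p)).toRingHom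
  toRingHom_algebraMap a := by
    change MvPolynomial.aeval (R := A) (fun p : P.Ring => p) (MvPolynomial.C a) = _
    simp
  algebraMap_toRingHom x := by
    change algebraMap P.Ring B (MvPolynomial.aeval (R := A) (fun p : P.Ring => p) x) =
      MvPolynomial.aeval (R := A) (algebraMap P.Ring B) x
    induction x using MvPolynomial.induction_on with
    | C a => simp [← IsScalarTower.algebraMap_apply]
    | add p q hp hq => simp only [map_add, hp, hq]
    | mul_X p i hp => simp only [map_mul, hp, MvPolynomial.aeval_X]

/-- The map `A[P] → A'[P']`, sending the variable `[p]` to `[f p]`, induced by a map of extensions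
`f : P → P'` over a commutative square from `A → B` to `A' → B'`. -/
def free.map {A B A' B' : Type u} [CommRing A] [CommRing B] [Algebra A B]
    [CommRing A'] [CommRing B'] [Algebra A' B'] [Algebra A A'] [Algebra B B'] [Algebra A B']
    [IsScalarTower A A' B'] [IsScalarTower A B B']
    {P : Extension.{u} A B} {P' : Extension.{u} A' B'} (f : P.Hom P') :
    (free P).Hom (free P') where
  toRingHom := MvPolynomial.eval₂Hom ((MvPolynomial.C (σ := P'.Ring)).comp (algebraMap A A'))
    (fun p : P.Ring => MvPolynomial.X (f.toRingHom p))
  toRingHom_algebraMap a := by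
    change MvPolynomial.eval₂Hom _ _ (MvPolynomial.C a) = MvPolynomial.C _
    simp
  algebraMap_toRingHom x := by
    change MvPolynomial.aeval (R := A') (algebraMap P'.Ring B') (MvPolynomial.eval₂Hom _ _ x) =
      algebraMap B B' (MvPolynomial.aeval (R := A) (algebraMap P.Ring B) x)
    induction x using MvPolynomial.induction_on with
    | C a => simp [← IsScalarTower.algebraMap_apply]
    | add p q hp hq => simp only [map_add, hp, hq]
    | mul_X p i hp =>
      rw [map_mul, map_mul, map_mul, map_mul, hp]
      simp

/-- The iterated polynomial algebras of the standard simplicial resolution of the `A`-algebra `B`,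
augmented to `B`: `tower A B 0 = B` and `tower A B (n + 1) = A[tower A B n]`, so that the
degree `n` term `P_n` of the resolution is `tower A B (n + 1)`. -/
def tower (A B : Type u) [CommRing A] [CommRing B] [Algebra A B] : ℕ → Extension.{u} A B
  | 0 => Extension.self A B
  | n + 1 => free (tower A B n)

/-- The faces of the standard simplicial resolution: writing `T = A[-]` and `ε : T X → X` for the
evaluation, `face A B n i : T^(n+1) B → T^n B` is `T^i ε T^(n-i)`. -/
def face (A B : Type u) [CommRing A] [CommRing B] [Algebra A B] :
    (n : ℕ) → Fin (n + 1) → (tower A B (n + 1)).Hom (tower A B n)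
  | 0, _ => free.counit (tower A B 0)
  | n + 1, i => Fin.cases (motive := fun _ => (tower A B (n + 2)).Hom (tower A B (n + 1)))
      (free.counit (tower A B (n + 1))) (fun j => free.map (face A B n j)) i

theorem free.hom_ext {A B A' B' : Type u} [CommRing A] [CommRing B] [Algebra A B]
    [CommRing A'] [CommRing B'] [Algebra A' B'] [Algebra A A'] [Algebra B B']
    {P : Extension.{u} A B} {P' : Extension.{u} A' B'} {f g : (free P).Hom P'}
    (h : ∀ p : P.Ring, f.toRingHom (free.X P p) =
      g.toRingHom (free.X P p)) : f = g := by
  refine Extension.Hom.ext (MvPolynomial.ringHom_ext (fun a => ?_) h)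
  exact (f.toRingHom_algebraMap a).trans (g.toRingHom_algebraMap a).symm

theorem free.map_X {A B A' B' : Type u} [CommRing A] [CommRing B] [Algebra A B]
    [CommRing A'] [CommRing B'] [Algebra A' B'] [Algebra A A'] [Algebra B B'] [Algebra A B']
    [IsScalarTower A A' B'] [IsScalarTower A B B']
    {P : Extension.{u} A B} {P' : Extension.{u} A' B'} (f : P.Hom P') (p : P.Ring) :
    (free.map f).toRingHom (free.X P p) =
      free.X P' (f.toRingHom p) :=
  MvPolynomial.eval₂Hom_X' _ _ _

theorem free.counit_X {A B : Type u} [CommRing A] [CommRing B] [Algebra A B]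
    (P : Extension.{u} A B) (p : P.Ring) :
    (free.counit P).toRingHom (free.X P p) = p :=
  MvPolynomial.aeval_X _ _

theorem face_zero (A B : Type u) [CommRing A] [CommRing B] [Algebra A B] (n : ℕ) :
    face A B n 0 = free.counit (tower A B n) := by
  cases n <;> rfl

theorem face_succ (A B : Type u) [CommRing A] [CommRing B] [Algebra A B] (n : ℕ)
    (i : Fin (n + 1)) : face A B (n + 1) i.succ = free.map (face A B n i) := rfl

theorem free.map_comp_map {A B A' B' A'' B'' : Type u} [CommRing A] [CommRing B] [Algebra A B]
    [CommRing A'] [CommRing B'] [Algebra A' B'] [Algebra A A'] [Algebra B B'] [Algebra A B']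
    [IsScalarTower A A' B'] [IsScalarTower A B B']
    [CommRing A''] [CommRing B''] [Algebra A'' B''] [Algebra A' A''] [Algebra B' B'']
    [Algebra A' B''] [IsScalarTower A' A'' B''] [IsScalarTower A' B' B'']
    [Algebra A A''] [Algebra B B''] [Algebra A B''] [IsScalarTower A A'' B'']
    [IsScalarTower A B B''] [IsScalarTower A A' A''] [IsScalarTower B B' B'']
    {P : Extension.{u} A B} {Q : Extension.{u} A' B'} {R : Extension.{u} A'' B''}
    (f : Q.Hom R) (g : P.Hom Q) :
    (free.map f).comp (free.map g) = free.map (f.comp g) := by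
  refine free.hom_ext fun p => ?_
  rw [free.map_X, Extension.Hom.comp_toRingHom, RingHom.comp_apply, free.map_X, free.map_X]
  rfl

theorem free.counit_comp_map {A B A' B' : Type u} [CommRing A] [CommRing B] [Algebra A B]
    [CommRing A'] [CommRing B'] [Algebra A' B'] [Algebra A A'] [Algebra B B'] [Algebra A B']
    [IsScalarTower A A' B'] [IsScalarTower A B B']
    {P : Extension.{u} A B} {Q : Extension.{u} A' B'} (f : P.Hom Q) :
    (free.counit Q).comp (free.map f) = f.comp (free.counit P) := by
  refine free.hom_ext fun p => ?_
  rw [Extension.Hom.comp_toRingHom, RingHom.comp_apply, free.map_X, free.counit_X,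
    Extension.Hom.comp_toRingHom, RingHom.comp_apply, free.counit_X]

/-- The simplicial identities between faces. -/
theorem face_comp_face (A B : Type u) [CommRing A] [CommRing B] [Algebra A B] (n : ℕ)
    (i j : Fin (n + 1)) (hij : i ≤ j) :
    (face A B n i).comp (face A B (n + 1) j.succ) =
      (face A B n j).comp (face A B (n + 1) i.castSucc) := by
  induction n with
  | zero =>
    obtain rfl : i = 0 := Subsingleton.elim (α := Fin 1) _ _
    obtain rfl : j = 0 := Subsingleton.elim (α := Fin 1) _ _
    exact free.counit_comp_map _
  | succ n ih =>
    induction i using Fin.cases with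
    | zero => exact free.counit_comp_map _
    | succ i =>
      induction j using Fin.cases with
      | zero => exact absurd hij (by simp)
      | succ j =>
        refine (free.map_comp_map (face A B n i) (face A B (n + 1) j.succ)).trans ?_
        rw [ih i j (by simpa using hij)]
        exact (free.map_comp_map (face A B n j) (face A B (n + 1) i.castSucc)).symm

/-- The differential `B ⊗ Ω_{P_{n+1}/A} → B ⊗ Ω_{P_n/A}`, the alternating sum of the maps induced by
the faces. -/
def differential (A B : Type u) [CommRing A] [CommRing B] [Algebra A B] (n : ℕ) :
    (tower A B (n + 2)).CotangentSpace →ₗ[B] (tower A B (n + 1)).CotangentSpace :=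
  ∑ i : Fin (n + 2), (-1 : ℤ) ^ (i : ℕ) • Extension.CotangentSpace.map (face A B (n + 1) i)

/-- Alternating sums of maps satisfying the simplicial identities compose to zero. -/
theorem alternating_comp {B L M N : Type u} [CommRing B] [AddCommGroup L] [AddCommGroup M]
    [AddCommGroup N] [Module B L] [Module B M] [Module B N] (n : ℕ)
    (f : Fin (n + 2) → M →ₗ[B] N) (g : Fin (n + 3) → L →ₗ[B] M)
    (key : ∀ i j : Fin (n + 2), i ≤ j → f i ∘ₗ g j.succ = f j ∘ₗ g i.castSucc) :
    (∑ i : Fin (n + 2), (-1 : ℤ) ^ (i : ℕ) • f i) ∘ₗ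
      (∑ j : Fin (n + 3), (-1 : ℤ) ^ (j : ℕ) • g j) = 0 := by
  have hsum : (∑ i : Fin (n + 2), (-1 : ℤ) ^ (i : ℕ) • f i) ∘ₗ
      (∑ j : Fin (n + 3), (-1 : ℤ) ^ (j : ℕ) • g j) =
      ∑ x : Fin (n + 2) × Fin (n + 3),
        ((-1 : ℤ) ^ (x.1 : ℕ) • f x.1) ∘ₗ ((-1 : ℤ) ^ (x.2 : ℕ) • g x.2) := by
    ext x
    simp only [LinearMap.comp_apply, LinearMap.sum_apply, map_sum, Fintype.sum_prod_type]
    exact Finset.sum_comm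
  rw [hsum]
  let P := Fin (n + 2) × Fin (n + 3)
  let T : Finset P := {ij : P | (ij.2 : ℕ) ≤ (ij.1 : ℕ)}
  rw [← Finset.sum_add_sum_compl T, ← eq_neg_iff_add_eq_zero,
    ← Finset.sum_neg_distrib]
  let φ : ∀ ij : P, ij ∈ T → P := fun ij hij =>
    (Fin.castLT ij.2 (lt_of_le_of_lt (Finset.mem_filter.mp hij).right (Fin.is_lt ij.1)),
      ij.1.succ)
  apply Finset.sum_bij φ
  · intro ij hij
    simp_rw [T, φ, Finset.compl_filter, Finset.mem_filter_univ, Fin.val_succ,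
      Fin.val_castLT] at hij ⊢
    lia
  · rintro ⟨i, j⟩ hij ⟨i', j'⟩ hij' h
    rw [Prod.mk_inj]
    exact ⟨by simpa [φ] using! congr_arg Prod.snd h,
      by simpa [φ, Fin.castSucc_castLT] using! congr_arg Fin.castSucc (congr_arg Prod.fst h)⟩
  · rintro ⟨i', j'⟩ hij'
    simp_rw [T, Finset.compl_filter, Finset.mem_filter_univ, not_le] at hij'
    refine ⟨(j'.pred <| ?_, Fin.castSucc i'), ?_, ?_⟩
    · rintro rfl
      simp only [Fin.val_zero, not_lt_zero] at hij'
    · simpa [T] using! Nat.le_sub_one_of_lt hij'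
    · simp only [φ, Fin.castLT_castSucc, Fin.succ_pred]
  · rintro ⟨i, j⟩ hij
    have hij' : (j : ℕ) ≤ (i : ℕ) := by simpa [T] using! hij
    have h := key (Fin.castLT j (lt_of_le_of_lt hij' i.is_lt)) i
      (by simpa [Fin.le_def] using hij')
    rw [Fin.castSucc_castLT] at h
    dsimp only [φ]
    simp only [LinearMap.smul_comp, LinearMap.comp_smul]
    rw [h, smul_smul, smul_smul, ← neg_smul]
    congr 1
    simp only [Fin.val_succ, Fin.val_castLT]
    ring

theorem differential_comp (A B : Type u) [CommRing A] [CommRing B] [Algebra A B] (n : ℕ) :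
    differential A B n ∘ₗ differential A B (n + 1) = 0 := by
  refine alternating_comp n _ _ fun i j hij => ?_
  have h := congrArg Extension.CotangentSpace.map (face_comp_face A B (n + 1) i j hij)
  rw [Extension.CotangentSpace.map_comp, Extension.CotangentSpace.map_comp] at h
  exact h

/-- The cotangent complex `L_{B/A}`: the chain complex of `B`-modules associated with the simplicial
`B`-module `n ↦ B ⊗_{P_n} Ω_{P_n/A}`, where `P` is the standard simplicial resolution of `B`. -/
def cotangentComplex (A B : Type u) [CommRing A] [CommRing B] [Algebra A B] :
    ChainComplex (ModuleCat.{u} B) ℕ :=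
  ChainComplex.of (fun n => ModuleCat.of B (tower A B (n + 1)).CotangentSpace)
    (fun n => ModuleCat.ofHom (differential A B n))
    (fun n => by
      rw [← ModuleCat.ofHom_comp, differential_comp]
      rfl)

/-- The homology module `H_n(L_{B/A})`. -/
abbrev H (n : ℕ) (A B : Type u) [CommRing A] [CommRing B] [Algebra A B] : ModuleCat.{u} B :=
  (cotangentComplex A B).homology n

/-- The maps `P_n → P'_n` of standard resolutions induced by a commutative square from `A → B` to
`A' → B'`. -/
def tower.map (A B A' B' : Type u) [CommRing A] [CommRing B] [Algebra A B]
    [CommRing A'] [CommRing B'] [Algebra A' B'] [Algebra A A'] [Algebra B B'] [Algebra A B']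
    [IsScalarTower A A' B'] [IsScalarTower A B B'] :
    (n : ℕ) → (tower A B n).Hom (tower A' B' n)
  | 0 =>
    { toRingHom := algebraMap B B'
      toRingHom_algebraMap := fun a => by
        change algebraMap B B' (algebraMap A B a) = algebraMap A' B' (algebraMap A A' a)
        rw [← IsScalarTower.algebraMap_apply, ← IsScalarTower.algebraMap_apply]
      algebraMap_toRingHom := fun _ => rfl }
  | n + 1 => free.map (tower.map A B A' B' n)

theorem tower.map_comp_face (A B A' B' : Type u) [CommRing A] [CommRing B] [Algebra A B]
    [CommRing A'] [CommRing B'] [Algebra A' B'] [Algebra A A'] [Algebra B B'] [Algebra A B']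
    [IsScalarTower A A' B'] [IsScalarTower A B B'] (n : ℕ) (i : Fin (n + 1)) :
    (tower.map A B A' B' n).comp (face A B n i) =
      (face A' B' n i).comp (tower.map A B A' B' (n + 1)) := by
  induction n with
  | zero => exact (free.counit_comp_map _).symm
  | succ n ih =>
    induction i using Fin.cases with
    | zero => exact (free.counit_comp_map _).symm
    | succ i =>
      refine (free.map_comp_map (tower.map A B A' B' n) (face A B n i)).trans ?_
      rw [ih i]
      exact (free.map_comp_map (face A' B' n i) (tower.map A B A' B' (n + 1))).symm

/-- The map `B ⊗ Ω_{P_n/A} → B' ⊗ Ω_{P'_n/A'}`, `b ⊗ dp ↦ b ⊗ dp'` with `p'` the image of `p`. -/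
def termMap (A B A' B' : Type u) [CommRing A] [CommRing B] [Algebra A B]
    [CommRing A'] [CommRing B'] [Algebra A' B'] [Algebra A A'] [Algebra B B'] [Algebra A B']
    [IsScalarTower A A' B'] [IsScalarTower A B B'] (n : ℕ) :
    (tower A B (n + 1)).CotangentSpace →ₛₗ[algebraMap B B'] (tower A' B' (n + 1)).CotangentSpace where
  toFun := Extension.CotangentSpace.map (tower.map A B A' B' (n + 1))
  map_add' := map_add _
  map_smul' b x := by
    rw [LinearMap.map_smul, algebraMap_smul]

theorem termMap_differential (A B A' B' : Type u) [CommRing A] [CommRing B] [Algebra A B]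
    [CommRing A'] [CommRing B'] [Algebra A' B'] [Algebra A A'] [Algebra B B'] [Algebra A B']
    [IsScalarTower A A' B'] [IsScalarTower A B B'] (n : ℕ)
    (x : (tower A B (n + 2)).CotangentSpace) :
    termMap A B A' B' n (differential A B n x) =
      differential A' B' n (termMap A B A' B' (n + 1) x) := by
  have h (i : Fin (n + 2)) := congrArg (fun f => Extension.CotangentSpace.map f x)
    (tower.map_comp_face A B A' B' (n + 1) i)
  simp only [Extension.CotangentSpace.map_comp_apply] at h
  change Extension.CotangentSpace.map (tower.map A B A' B' (n + 1)) (differential A B n x) =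
    differential A' B' n (Extension.CotangentSpace.map (tower.map A B A' B' (n + 2)) x)
  simp only [differential, LinearMap.sum_apply, LinearMap.smul_apply, map_sum, map_zsmul, h]

/-- The canonical map `L_{B/A} → L_{B'/A'}` of complexes of `B`-modules, for a commutative square
from `A → B` to `A' → B'`. -/
def cotangentComplex.map (A B A' B' : Type u) [CommRing A] [CommRing B] [Algebra A B]
    [CommRing A'] [CommRing B'] [Algebra A' B'] [Algebra A A'] [Algebra B B'] [Algebra A B']
    [IsScalarTower A A' B'] [IsScalarTower A B B'] :
    cotangentComplex A B ⟶ ((ModuleCat.restrictScalars (algebraMap B B')).mapHomologicalComplex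
      (ComplexShape.down ℕ)).obj (cotangentComplex A' B') where
  f n := ModuleCat.semilinearMapAddEquiv (algebraMap B B')
    (ModuleCat.of B (tower A B (n + 1)).CotangentSpace)
    (ModuleCat.of B' (tower A' B' (n + 1)).CotangentSpace) (termMap A B A' B' n)
  comm' i j hij := by
    obtain rfl : j + 1 = i := hij
    ext x
    change ((ModuleCat.restrictScalars (algebraMap B B')).map
      ((cotangentComplex A' B').d (j + 1) j)).hom (termMap A B A' B' (j + 1) x) =
        termMap A B A' B' j (((cotangentComplex A B).d (j + 1) j).hom x)
    simp only [cotangentComplex, ChainComplex.of_d]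
    exact (termMap_differential A B A' B' j x).symm

/-- The canonical map `H_n(L_{B/A}) → H_n(L_{B'/A'})`, semilinear along `B → B'`. -/
def Hmap (n : ℕ) (A B A' B' : Type u) [CommRing A] [CommRing B] [Algebra A B]
    [CommRing A'] [CommRing B'] [Algebra A' B'] [Algebra A A'] [Algebra B B'] [Algebra A B']
    [IsScalarTower A A' B'] [IsScalarTower A B B'] :
    H n A B →ₛₗ[algebraMap B B'] H n A' B' :=
  (ModuleCat.semilinearMapAddEquiv (algebraMap B B') (H n A B) (H n A' B')).symm
    (HomologicalComplex.homologyMap (cotangentComplex.map A B A' B') n ≫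
      (((cotangentComplex A' B').sc n).mapHomologyIso
        (ModuleCat.restrictScalars (algebraMap B B'))).hom)

/-- The canonical `B`-linear map `H_n(L_{B/A}) → H_n(L_{B/A'})`, for `A → A' → B`. -/
def changeBase (n : ℕ) (A A' B : Type u) [CommRing A] [CommRing A'] [CommRing B] [Algebra A A']
    [Algebra A' B] [Algebra A B] [IsScalarTower A A' B] : H n A B →ₗ[B] H n A' B where
  toFun := Hmap n A B A' B
  map_add' := map_add _
  map_smul' b x := by
    rw [LinearMap.map_smulₛₗ]
    rfl

/-- The canonical `B'`-linear map `B' ⊗_B H_n(L_{B/A}) → H_n(L_{B'/A})`, for `A → B → B'`. -/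
def extendMap (n : ℕ) (A B B' : Type u) [CommRing A] [CommRing B] [CommRing B'] [Algebra A B]
    [Algebra B B'] [Algebra A B'] [IsScalarTower A B B'] :
    B' ⊗[B] (H n A B : Type u) →ₗ[B'] H n A B' :=
  letI : Module B (H n A B') := Module.compHom _ (algebraMap B B')
  haveI : IsScalarTower B B' (H n A B') := IsScalarTower.of_algebraMap_smul fun _ _ => rfl
  LinearMap.liftBaseChange B'
    { toFun := Hmap n A B A B'
      map_add' := map_add _
      map_smul' := fun b x => LinearMap.map_smulₛₗ (Hmap n A B A B') b x }

theorem cotangentComplex_d (A B : Type u) [CommRing A] [CommRing B] [Algebra A B] (n : ℕ) :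
    (cotangentComplex A B).d (n + 1) n = ModuleCat.ofHom (differential A B n) := by
  simp [cotangentComplex]

theorem cotangentComplex_d_comp (A B : Type u) [CommRing A] [CommRing B] [Algebra A B] (n : ℕ)
    {N : Type u} [AddCommGroup N] [Module B N] (f : (tower A B (n + 1)).CotangentSpace →ₗ[B] N)
    (hf : f ∘ₗ differential A B n = 0) :
    (cotangentComplex A B).d (n + 1) n ≫
      (ModuleCat.ofHom f : (cotangentComplex A B).X n ⟶ ModuleCat.of B N) = 0 := by
  rw [cotangentComplex_d]
  exact (ModuleCat.ofHom_comp _ _).symm.trans (congrArg ModuleCat.ofHom hf)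

theorem differential_zero (A B : Type u) [CommRing A] [CommRing B] [Algebra A B] :
    differential A B 0 =
      (tower A B 1).cotangentComplex ∘ₗ (face A B 1 0).sub (face A B 1 1) := by
  have h := Extension.CotangentSpace.map_sub_map (face A B 1 0) (face A B 1 1)
  refine Eq.trans ?_ h
  refine (Fin.sum_univ_two (fun i : Fin 2 =>
    (-1 : ℤ) ^ (i : ℕ) • Extension.CotangentSpace.map (face A B 1 i))).trans ?_
  simp
  exact (sub_eq_add_neg _ _).symm

theorem differential_one_D (A B : Type u) [CommRing A] [CommRing B] [Algebra A B]
    (p : (tower A B 3).Ring) :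
    differential A B 1 (1 ⊗ₜ KaehlerDifferential.D A (tower A B 3).Ring p) =
      1 ⊗ₜ KaehlerDifferential.D A (tower A B 2).Ring ((face A B 2 0).toRingHom p) -
      1 ⊗ₜ KaehlerDifferential.D A (tower A B 2).Ring ((face A B 2 1).toRingHom p) +
      1 ⊗ₜ KaehlerDifferential.D A (tower A B 2).Ring ((face A B 2 2).toRingHom p) := by
  have h : differential A B 1 = Extension.CotangentSpace.map (face A B 2 0) -
      Extension.CotangentSpace.map (face A B 2 1) +
      Extension.CotangentSpace.map (face A B 2 2) := by
    refine (Fin.sum_univ_three (fun i : Fin 3 =>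
      (-1 : ℤ) ^ (i : ℕ) • Extension.CotangentSpace.map (face A B 2 i))).trans ?_
    simp
    exact congrArg (· + _) (sub_eq_add_neg _ _).symm
  rw [h, LinearMap.add_apply, LinearMap.sub_apply, Extension.CotangentSpace.map_tmul,
    Extension.CotangentSpace.map_tmul, Extension.CotangentSpace.map_tmul, map_one]
  rfl

theorem sub_differential_one (A B : Type u) [CommRing A] [CommRing B] [Algebra A B] :
    (face A B 1 0).sub (face A B 1 1) ∘ₗ differential A B 1 = 0 := by
  have hD (p : (tower A B 3).Ring) : (face A B 1 0).sub (face A B 1 1)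
      (differential A B 1 (1 ⊗ₜ KaehlerDifferential.D A (tower A B 3).Ring p)) = 0 := by
    have h (i j : Fin 2) (hij : i ≤ j) := congrArg (fun f => f.toRingHom p)
      (face_comp_face A B 1 i j hij)
    have h00 : (face A B 1 0).toRingHom ((face A B 2 1).toRingHom p) =
      (face A B 1 0).toRingHom ((face A B 2 0).toRingHom p) := h 0 0 (le_refl _)
    have h01 : (face A B 1 0).toRingHom ((face A B 2 2).toRingHom p) =
      (face A B 1 1).toRingHom ((face A B 2 0).toRingHom p) := h 0 1 (by simp)
    have h11 : (face A B 1 1).toRingHom ((face A B 2 2).toRingHom p) =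
      (face A B 1 1).toRingHom ((face A B 2 1).toRingHom p) := h 1 1 (le_refl _)
    rw [differential_one_D, map_add, map_sub, Extension.Hom.sub_one_tmul,
      Extension.Hom.sub_one_tmul, Extension.Hom.sub_one_tmul, ← map_sub, ← map_add]
    refine (congrArg _ (Subtype.ext ?_)).trans (map_zero Extension.Cotangent.mk)
    simp only [Submodule.coe_add, Submodule.coe_sub, Extension.Hom.subToKer_apply_coe,
      Submodule.coe_zero, h00, h01, h11]
    ring
  ext x
  exact hD x

/-- The canonical map `H_0(L_{B/A}) → Ω_{B/A}`, induced by `b ⊗ dp ↦ b dp` on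
`B ⊗ Ω_{P_0/A}`. -/
def toKaehler (A B : Type u) [CommRing A] [CommRing B] [Algebra A B] :
    H 0 A B →ₗ[B] Ω[B⁄A] :=
  ((cotangentComplex A B).homologyι 0 ≫ (cotangentComplex A B).descOpcycles
    (A := ModuleCat.of B Ω[B⁄A]) (ModuleCat.ofHom (tower A B 1).toKaehler) 1 (by simp)
    (cotangentComplex_d_comp A B 0 _ (by
      rw [differential_zero, ← LinearMap.comp_assoc,
        (tower A B 1).exact_cotangentComplex_toKaehler.linearMap_comp_eq_zero,
        LinearMap.zero_comp]))).hom

/-- The identity of `A[B]`, as a map from the degree `0` term of the standard resolution to the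
standard presentation of `B`. -/
def towerOneToSelf (A B : Type u) [CommRing A] [CommRing B] [Algebra A B] :
    (tower A B 1).Hom (Generators.self A B).toExtension where
  toRingHom := RingHom.id (MvPolynomial B A)
  toRingHom_algebraMap _ := rfl
  algebraMap_toRingHom _ := rfl

/-- The map `H_1(L_{B/A}) → J/J²`, where `J` is the kernel of `P_0 = A[B] → B`, induced by
`b ⊗ dp ↦ b (d_0 p - d_1 p)` on `B ⊗ Ω_{P_1/A}`. -/
def toCotangent (A B : Type u) [CommRing A] [CommRing B] [Algebra A B] :
    H 1 A B →ₗ[B] (tower A B 1).Cotangent :=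
  ((cotangentComplex A B).homologyι 1 ≫ (cotangentComplex A B).descOpcycles
    (A := ModuleCat.of B (tower A B 1).Cotangent)
    (ModuleCat.ofHom ((face A B 1 0).sub (face A B 1 1))) 2 (by simp)
    (cotangentComplex_d_comp A B 1 _ (sub_differential_one A B))).hom

theorem homologyι_desc_comp {B : Type u} [CommRing B] (K : ChainComplex (ModuleCat.{u} B) ℕ)
    {N : ModuleCat.{u} B} (f : K.X 1 ⟶ N) (hf : K.d 2 1 ≫ f = 0) (g : N ⟶ K.X 0)
    (h : f ≫ g = K.d 1 0) : (K.homologyι 1 ≫ K.descOpcycles f 2 (by simp) hf) ≫ g = 0 := by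
  rw [Category.assoc, HomologicalComplex.descOpcycles_comp]
  exact K.homologyι_descOpcycles_eq_zero_of_boundary _ _ _ (𝟙 _) (by simp [h])

theorem cotangentComplex_toCotangent (A B : Type u) [CommRing A] [CommRing B] [Algebra A B]
    (x : H 1 A B) : (tower A B 1).cotangentComplex (toCotangent A B x) = 0 := by
  have h := homologyι_desc_comp (cotangentComplex A B)
    (N := ModuleCat.of B (tower A B 1).Cotangent)
    (ModuleCat.ofHom ((face A B 1 0).sub (face A B 1 1)))
    (cotangentComplex_d_comp A B 1 _ (sub_differential_one A B))
    (ModuleCat.ofHom (tower A B 1).cotangentComplex)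
    ((ModuleCat.ofHom_comp _ _).symm.trans
      ((congrArg ModuleCat.ofHom (differential_zero A B)).symm.trans
        (cotangentComplex_d A B 0).symm))
  exact congrArg (fun f => f.hom x) h

/-- The canonical map from `H_1(L_{B/A})` to the first homology `Ker(J/J² → B ⊗ Ω_{P_0/A})` of the
truncated cotangent complex. -/
def toH1Cotangent (A B : Type u) [CommRing A] [CommRing B] [Algebra A B] :
    H 1 A B →ₗ[B] H1Cotangent A B :=
  Extension.H1Cotangent.map (towerOneToSelf A B) ∘ₗ
    LinearMap.codRestrict (LinearMap.ker (tower A B 1).cotangentComplex) (toCotangent A B)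
      (cotangentComplex_toCotangent A B)

/-- For a local ring `A` with residue field `F`, the surjection `A → F` as an extension of the
`A`-algebra `F` with kernel the maximal ideal. -/
def residueExtension (A : Type u) [CommRing A] [IsLocalRing A] :
    Extension.{u} A (IsLocalRing.ResidueField A) where
  Ring := A
  σ := Function.surjInv IsLocalRing.residue_surjective
  algebraMap_σ := Function.surjInv_eq IsLocalRing.residue_surjective

theorem residueExtension_ker (A : Type u) [CommRing A] [IsLocalRing A] :
    RingHom.ker (algebraMap A (IsLocalRing.ResidueField A)) = IsLocalRing.maximalIdeal A :=
  IsLocalRing.ker_residue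

/-- The identification of the conormal module of `A → F` with `𝔪/𝔪²`. -/
def residueCotangent (A : Type u) [CommRing A] [IsLocalRing A] :
    (residueExtension A).Cotangent →ₗ[IsLocalRing.ResidueField A] IsLocalRing.CotangentSpace A where
  toFun x := Ideal.mapCotangent (RingHom.ker (algebraMap A (IsLocalRing.ResidueField A)))
    (IsLocalRing.maximalIdeal A) (AlgHom.id A A) (residueExtension_ker A).le x.val
  map_add' x y := by
    rw [Extension.Cotangent.val_add]
    exact map_add _ _ _
  map_smul' b x := by
    obtain ⟨a, rfl⟩ := IsLocalRing.residue_surjective b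
    have h : (IsLocalRing.residue A a • x).val = a • x.val :=
      Extension.Cotangent.val_smul'' (P := residueExtension A) a x
    rw [h]
    refine (map_smul (Ideal.mapCotangent _ _ _ _) a x.val).trans ?_
    exact (algebraMap_smul (IsLocalRing.ResidueField A) a _).symm

/-- For a local ring `A` with residue field `F`, the canonical map `H_1(L_{F/A}) → 𝔪/𝔪²` (the
conormal module of the closed immersion `Spec F → Spec A`). It sends the class of a cycle
`∑ b_i ⊗ dp_i` to the class of `∑ b_i (σ(d_0 p_i) - σ(d_1 p_i))`, for any `A`-algebra map
`σ : A[F] → A` over `F`. -/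
def toConormal (A : Type u) [CommRing A] [IsLocalRing A] :
    H 1 A (IsLocalRing.ResidueField A) →ₗ[IsLocalRing.ResidueField A]
      IsLocalRing.CotangentSpace A :=
  residueCotangent A ∘ₗ Extension.h1Cotangentι ∘ₗ
    Extension.H1Cotangent.map (residueExtension A).defaultHom ∘ₗ
    toH1Cotangent A (IsLocalRing.ResidueField A)

/-- For `A → F → E`, the map `H_0(L_{E/A}) → H_0(L_{E/F}) → Ω_{E/F}`. -/
def zerothMap (A F E : Type u) [CommRing A] [CommRing F] [CommRing E] [Algebra A F]
    [Algebra F E] [Algebra A E] [IsScalarTower A F E] : H 0 A E →ₗ[E] Ω[E⁄F] :=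
  toKaehler F E ∘ₗ changeBase 0 A F E

/-- For `A → F → E`, the composite `H_1(L_{E/A}) → H_1(L_{E/F}) → E ⊗_F Ω_{F/ℤ}`, where the second
map is the connecting map of the homology sequence of `ℤ → F → E`, with the sign that makes it
send the class of an element `a` of the kernel of `F → E` to `da` if `F → E` is surjective (this is
the opposite of the boundary map of the distinguished triangle of cotangent complexes). -/
def minusBoundary (A F E : Type u) [CommRing A] [CommRing F] [CommRing E] [Algebra A F]
    [Algebra F E] [Algebra A E] [IsScalarTower A F E] : H 1 A E →ₗ[E] E ⊗[F] Ω[F⁄ℤ] :=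
  H1Cotangent.δ ℤ F E ∘ₗ toH1Cotangent F E ∘ₗ changeBase 1 A F E

/-- The canonical map `E ⊗_F Ω_F → Ω_E` of absolute differentials, `Ω_F = Ω_{F/ℤ}`. -/
def differentialsMap (F E : Type u) [CommRing F] [CommRing E] [Algebra F E] :
    E ⊗[F] Ω[F⁄ℤ] →ₗ[E] Ω[E⁄ℤ] :=
  KaehlerDifferential.mapBaseChange ℤ F E

/-- The local ring `𝒪_{S,s}`. -/
abbrev Stalk (S : AlgebraicGeometry.Scheme.{u}) (s : S) : Type u := S.presheaf.stalk s

/-- The residue field `k(s)`. -/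
abbrev Res (S : AlgebraicGeometry.Scheme.{u}) (s : S) : Type u :=
  IsLocalRing.ResidueField (S.presheaf.stalk s)

/-- `L_{E/S}` for the morphism `f : Spec E → S` given by a point `s` of `S` and an extension `E` of
its residue field. As `Spec E` has one point, `f⁻¹ 𝒪_S` is the local ring `𝒪_{S,s}`, so that
`L_{E/S}`, the cotangent complex of the algebra `𝒪_{Spec E}` over `f⁻¹ 𝒪_S`, is that of the
`𝒪_{S,s}`-algebra `E`. -/
abbrev pointComplex (S : AlgebraicGeometry.Scheme.{u}) (s : S) (E : Type u) [Field E]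
    [Algebra (Stalk S s) E] : ChainComplex (ModuleCat.{u} E) ℕ :=
  cotangentComplex (Stalk S s) E

end

end CotangentComplex

open CotangentComplex

/-! Write `A` for the local ring, `F` for its residue field. The proof has a low-degree half and a
vanishing half.

Low degrees. `H_0(L_{B/A})` is `Ω[B⁄A]`, and `H_1(L_{B/A})` is the kernel of `J/J² → B ⊗ Ω` for the
standard presentation (`toKaehler_bijective`, `toH1Cotangent_bijective`), so the Jacobi–Zariski
sequences of `H1Cotangent` apply. As `A → F` is surjective, `Ω[F⁄A] = 0`; this gives `H_0` and the
image of the boundary map. The boundary `H_1(L_{E/F}) → E ⊗ Ω_F` is injective (`δ_int_injective`):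
the map `H_1(L_{E/ℤ}) → H_1(L_{E/F})` factors through `H_1` of `E` over its prime field, which is
zero because prime fields are perfect. If `E` contains `F^{1/p}`, the map `E ⊗ Ω_F → Ω_E` vanishes
because `d(y^p) = 0`, and then so does `H_1(L_{E'/F}) → H_1(L_{E'/E})`
(`h1Cotangent_map_eq_zero_of_pow`).

Vanishing. Injectivity of `E ⊗ H_1(L_{F/A}) → H_1(L_{E/A})` and the regular case need relative
homology to vanish in degrees `≥ 2`, for field extensions and for a regular local ring over its
residue field. The property `Hom.Lci` records the consequences for absolute homology. It holds for
`R → R[σ]` and for `R → R/a` with `a` a nonzerodivisor, and is stable under composition and directed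
unions. From `R[1/q] = R[X]/(qX - 1)` one reaches fraction fields, then simple extensions, then all
field extensions (`field_lci`); a regular local ring reaches its residue field by killing parameters
one at a time (`regular_lci`).

The two basic cases are proved by resolving algebras. With coefficients in `E`, the complex
computing `E ⊗_R L_{R/A}` has as terms the free `E`-modules on the sets `T^n R`, where `T = A[-]`.
These depend only on the underlying set of `R`, so a semi-simplicial algebra that is contractible as
a semi-simplicial set over its augmentation yields a bicomplex with exact columns, and a statement
about its terms passes to the augmentation (`SSA.Map.cone_exact`). For `R[σ]` the standard
resolution reduces to free `R`, where an explicit homotopy exists (`polyMap_cone_exact`). For `R/a`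
the bar construction `R[X_1, …, X_q]` reduces to polynomial algebras and to a small complex of
modules `E^q`, exact in degrees `≥ 2` (`quotient_cone_exact`). -/

namespace CotangentComplex

/-! ### Chain complexes and mapping cones -/

/-- A chain complex of abelian groups in degrees `≥ 0`. -/
structure Cx where
  (X : ℕ → Type u)
  [grp : ∀ n, AddCommGroup (X n)]
  d : ∀ n, X (n + 1) →+ X n
  dd : ∀ n x, d n (d (n + 1) x) = 0

attribute [instance] Cx.grp

namespace Cx

/-- Exactness of a complex in degree `n`. -/
def Ex (K : Cx.{u}) : ℕ → Prop
  | 0 => Function.Surjective (K.d 0)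
  | n + 1 => ∀ x, K.d n x = 0 → ∃ y, K.d (n + 1) y = x

/-- Chain maps. -/
structure Map (J K : Cx.{u}) where
  f : ∀ n, J.X n →+ K.X n
  comm : ∀ n x, f n (J.d n x) = K.d n (f (n + 1) x)

/-- The terms of the mapping cone. -/
def ConeX (J K : Cx.{u}) : ℕ → Type u
  | 0 => K.X 0
  | n + 1 => K.X (n + 1) × J.X n

instance (J K : Cx.{u}) : ∀ n, AddCommGroup (ConeX J K n)
  | 0 => inferInstanceAs (AddCommGroup (K.X 0))
  | n + 1 => inferInstanceAs (AddCommGroup (K.X (n + 1) × J.X n))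

/-- The differential of the mapping cone. -/
def coneD {J K : Cx.{u}} (f : ∀ n, J.X n →+ K.X n) : ∀ n, ConeX J K (n + 1) →+ ConeX J K n
  | 0 => (K.d 0).coprod (f 0)
  | n + 1 => ((K.d (n + 1)).coprod (f (n + 1))).prod
      (-((J.d n).comp (AddMonoidHom.snd (K.X (n + 2)) (J.X (n + 1)))))

/-- The mapping cone. -/
def cone {J K : Cx.{u}} (f : Map J K) : Cx.{u} where
  X := ConeX J K
  d := coneD f.f
  dd n x := by
    obtain ⟨k, j⟩ := x
    cases n with
    | zero =>
      change K.d 0 (K.d 1 k + f.f 1 j) + f.f 0 (-(J.d 0 j)) = 0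
      rw [map_add, K.dd, map_neg, f.comm]; simp
    | succ n =>
      refine Prod.ext ?_ ?_
      · change K.d (n + 1) (K.d (n + 2) k + f.f (n + 2) j) + f.f (n + 1) (-(J.d (n + 1) j)) = 0
        rw [map_add, K.dd, map_neg, f.comm]; simp
      · change -(J.d n (-(J.d (n + 1) j))) = 0
        rw [map_neg, J.dd]; simp

/-- Injectivity of a chain map on homology in degree `n + 1`. -/
def Map.InjOn {J K : Cx.{u}} (f : Map J K) (n : ℕ) : Prop :=
  ∀ x : J.X (n + 1), J.d n x = 0 → (∃ y, K.d (n + 1) y = f.f (n + 1) x) → ∃ y, J.d (n + 1) y = x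

/-- Surjectivity of a chain map on homology in degree `n + 1`. -/
def Map.SurjOn {J K : Cx.{u}} (f : Map J K) (n : ℕ) : Prop :=
  ∀ y : K.X (n + 1), K.d n y = 0 → ∃ x, J.d n x = 0 ∧ ∃ z, K.d (n + 1) z = y - f.f (n + 1) x

/-- The piece `H_{n+2}(cone) → H_{n+1}(J) → H_{n+1}(K)` of the long exact sequence: if `f x` bounds
`k`, then `(-k, x)` is a cycle of the cone, and the second component of a chain bounding it bounds
`x` up to sign. -/
theorem injOn_of_cone {J K : Cx.{u}} (f : Map J K) (n : ℕ) (h : (cone f).Ex (n + 2)) :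
    f.InjOn n := by
  rintro x hx ⟨k, hk⟩
  obtain ⟨⟨a, b⟩, hy⟩ := h (show ConeX J K (n + 2) from ((-k, x) : K.X (n + 2) × J.X (n + 1)))
    (Prod.ext (by
      change K.d (n + 1) (-k) + f.f (n + 1) x = 0
      rw [map_neg, hk]; simp) (by
      change -(J.d n x) = 0
      rw [hx, neg_zero]))
  refine ⟨-b, ?_⟩
  have := congrArg Prod.snd hy
  rw [map_neg]
  exact this

theorem surjOn_of_cone {J K : Cx.{u}} (f : Map J K) (n : ℕ) (h : (cone f).Ex (n + 1)) :
    f.SurjOn n := by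
  intro y hy
  cases n with
  | zero =>
    obtain ⟨⟨a, b⟩, hz⟩ := h (show ConeX J K 1 from ((y, 0) : K.X 1 × J.X 0)) (by
      change K.d 0 y + f.f 0 0 = 0
      rw [hy]; simp)
    have h1 : K.d 1 a + f.f 1 b = y := congrArg Prod.fst hz
    have h2 : -(J.d 0 b) = 0 := congrArg Prod.snd hz
    exact ⟨b, by simpa using h2, a, by rw [← h1]; simp⟩
  | succ n =>
    obtain ⟨⟨a, b⟩, hz⟩ := h (show ConeX J K (n + 2) from ((y, 0) : K.X (n + 2) × J.X (n + 1)))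
      (Prod.ext (by
        change K.d (n + 1) y + f.f (n + 1) 0 = 0
        rw [hy]; simp) (by
        change -(J.d n 0) = 0
        simp))
    have h1 : K.d (n + 2) a + f.f (n + 2) b = y := congrArg Prod.fst hz
    have h2 : -(J.d (n + 1) b) = 0 := congrArg Prod.snd hz
    exact ⟨b, by simpa using h2, a, by rw [← h1]; simp⟩

end Cx

/-! ### Bicomplexes and the transfer of exactness to the first row -/

/-- A bicomplex of abelian groups with commuting differentials in degrees `≥ 0`. -/
structure BiCx where
  (X : ℕ → ℕ → Type u)
  [grp : ∀ p q, AddCommGroup (X p q)]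
  d : ∀ p q, X (p + 1) q →+ X p q
  v : ∀ p q, X p (q + 1) →+ X p q
  dd : ∀ p q x, d p q (d (p + 1) q x) = 0
  vv : ∀ p q x, v p q (v p (q + 1) x) = 0
  dv : ∀ p q x, d p q (v (p + 1) q x) = v p q (d p (q + 1) x)

attribute [instance] BiCx.grp

namespace BiCx

/-- The rows of a bicomplex. -/
def row (K : BiCx.{u}) (q : ℕ) : Cx.{u} := ⟨fun p => K.X p q, fun p => K.d p q, fun p => K.dd p q⟩

/-- The columns of a bicomplex. -/
def col (K : BiCx.{u}) (p : ℕ) : Cx.{u} := ⟨fun q => K.X p q, fun q => K.v p q, fun q => K.vv p q⟩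

/-- Diagram chase towards the first column. Lift `x` vertically to `y`; then `d y` is killed by both
differentials, hence by induction equals `d z` with `z` a vertical cycle. The row cycle `y - z` is
some `d t`, and `v t` is the required element. The sum `p + q` is constant during the induction, so
the first column is used in a single degree. The last hypothesis means `d x = 0` and is empty when
`p = 0`. -/
theorem zigzag (K : BiCx.{u}) (hr : ∀ q n, (K.row (q + 1)).Ex n)
    (hc : ∀ p n, (K.col (p + 1)).Ex n) (p : ℕ) :
    ∀ q, (K.col 0).Ex (p + q + 1) → ∀ x : K.X p (q + 1), K.v p q x = 0 →
      (∀ p' (e : p = p' + 1), K.d p' (q + 1) (e ▸ x) = 0) →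
      ∃ w : K.X (p + 1) (q + 1), K.v (p + 1) q w = 0 ∧ K.d p (q + 1) w = x := by
  induction p with
  | zero =>
    intro q h0 x hx _
    rw [Nat.zero_add] at h0
    obtain ⟨t, ht⟩ := h0 x hx
    obtain ⟨s, hs⟩ := hr (q + 1) 0 t
    refine ⟨K.v 1 (q + 1) s, K.vv _ _ _, ?_⟩
    exact (K.dv 0 (q + 1) s).trans ((congrArg _ hs).trans ht)
  | succ p ih =>
    intro q h0 x hx hdx
    obtain ⟨y, hy⟩ : ∃ y : K.X (p + 1) (q + 2), K.v (p + 1) (q + 1) y = x := hc p (q + 1) x hx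
    have h1 : K.v p (q + 1) (K.d p (q + 2) y) = 0 := by
      rw [← K.dv, hy]; exact hdx p rfl
    obtain ⟨z, hz, hz'⟩ := ih (q + 1) (by rw [show p + (q + 1) + 1 = p + 1 + q + 1 by ring]; exact h0)
      (K.d p (q + 2) y) h1 (by rintro p' rfl; exact K.dd _ _ _)
    obtain ⟨t, ht⟩ : ∃ t : K.X (p + 2) (q + 2), K.d (p + 1) (q + 2) t = y - z :=
      hr (q + 1) (p + 1) (y - z) (by
        change K.d p (q + 2) (y - z) = 0
        rw [map_sub, hz', sub_self])
    refine ⟨K.v _ _ t, K.vv _ _ _, ?_⟩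
    rw [K.dv, ht, map_sub, hz, hy, sub_zero]

/-- If all columns but the first and all rows but the first are exact, exactness of the first column
in some degree implies exactness of the first row in this degree. -/
theorem row_exact (K : BiCx.{u}) (hr : ∀ q n, (K.row (q + 1)).Ex n)
    (hc : ∀ p n, (K.col (p + 1)).Ex n) (n : ℕ) (h0 : (K.col 0).Ex n) : (K.row 0).Ex n := by
  cases n with
  | zero =>
    intro x
    obtain ⟨t, ht⟩ := h0 x
    obtain ⟨s, hs⟩ := hr 0 0 t
    exact ⟨K.v 1 0 s, (K.dv 0 0 s).trans ((congrArg _ hs).trans ht)⟩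
  | succ n =>
    intro (x : K.X (n + 1) 0) hx
    obtain ⟨y, hy⟩ : ∃ y : K.X (n + 1) 1, K.v (n + 1) 0 y = x := hc n 0 x
    obtain ⟨z, hz, hz'⟩ := K.zigzag hr hc n 0 h0 (K.d n 1 y)
      (by rw [← K.dv, hy]; exact hx) (by rintro p' rfl; exact K.dd _ _ _)
    obtain ⟨t, ht⟩ : ∃ t : K.X (n + 2) 1, K.d (n + 1) 1 t = y - z := hr 0 (n + 1) (y - z) (by
      change K.d n 1 (y - z) = 0
      rw [map_sub, hz', sub_self])
    refine ⟨K.v _ _ t, ?_⟩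
    change K.d (n + 1) 0 (K.v (n + 1 + 1) 0 t) = x
    rw [K.dv, ht, map_sub, hz, hy, sub_zero]

/-- Maps of bicomplexes. -/
structure Map (J K : BiCx.{u}) where
  f : ∀ p q, J.X p q →+ K.X p q
  comm_d : ∀ p q x, f p q (J.d p q x) = K.d p q (f (p + 1) q x)
  comm_v : ∀ p q x, f p q (J.v p q x) = K.v p q (f p (q + 1) x)

/-- The map induced on rows by a map of bicomplexes. -/
def Map.row {J K : BiCx.{u}} (f : Map J K) (q : ℕ) : Cx.Map (J.row q) (K.row q) :=
  ⟨fun p => f.f p q, fun p => f.comm_d p q⟩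

/-- The vertical differential of the rowwise mapping cone. -/
def coneV {J K : BiCx.{u}} : ∀ p q,
    Cx.ConeX (J.row (q + 1)) (K.row (q + 1)) p →+ Cx.ConeX (J.row q) (K.row q) p
  | 0, q => K.v 0 q
  | p + 1, q => (K.v (p + 1) q).prodMap (J.v p q)

/-- The rowwise mapping cone. -/
def cone {J K : BiCx.{u}} (f : Map J K) : BiCx.{u} where
  X p q := Cx.ConeX (J.row q) (K.row q) p
  d p q := (Cx.cone (f.row q)).d p
  v := coneV
  dd p q := (Cx.cone (f.row q)).dd p
  vv p q x := by
    cases p with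
    | zero => exact K.vv _ _ _
    | succ p => exact Prod.ext (K.vv _ _ _) (J.vv _ _ _)
  dv p q x := by
    cases p with
    | zero =>
      obtain ⟨k, j⟩ : K.X 1 (q + 1) × J.X 0 (q + 1) := x
      change K.d 0 q (K.v 1 q k) + f.f 0 q (J.v 0 q j) = K.v 0 q (K.d 0 (q + 1) k + f.f 0 (q + 1) j)
      rw [map_add, K.dv, f.comm_v]
    | succ p =>
      obtain ⟨k, j⟩ : K.X (p + 2) (q + 1) × J.X (p + 1) (q + 1) := x
      refine Prod.ext ?_ ?_
      · change K.d _ q (K.v _ q k) + f.f _ q (J.v _ q j) =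
          K.v _ q (K.d _ (q + 1) k + f.f _ (q + 1) j)
        rw [map_add, K.dv, f.comm_v]
      · change -(J.d p q (J.v _ q j)) = J.v p q (-(J.d p (q + 1) j))
        rw [map_neg, J.dv]

/-- The vertical differential of the cone does not involve `f`: its columns of positive index are
direct sums of a column of `K` and one of `J`, and column `0` is that of `K`. -/
theorem cone_col_exact {J K : BiCx.{u}} (f : Map J K) (p : ℕ) (n : ℕ) (hK : (K.col (p + 1)).Ex n)
    (hJ : (J.col p).Ex n) : ((cone f).col (p + 1)).Ex n := by
  cases n with
  | zero =>
    rintro ⟨k, j⟩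
    obtain ⟨a, ha⟩ := hK k
    obtain ⟨b, hb⟩ := hJ j
    exact ⟨(a, b), Prod.ext ha hb⟩
  | succ n =>
    rintro ⟨k, j⟩ h
    obtain ⟨a, ha⟩ := hK k (congrArg Prod.fst h)
    obtain ⟨b, hb⟩ := hJ j (congrArg Prod.snd h)
    exact ⟨(a, b), Prod.ext ha hb⟩

theorem cone_row_exact {J K : BiCx.{u}} (f : Map J K)
    (hr : ∀ q n, (Cx.cone (f.row (q + 1))).Ex n) (hK : ∀ p n, (K.col (p + 1)).Ex n)
    (hJ : ∀ p n, (J.col p).Ex n) (n : ℕ) (h0 : (K.col 0).Ex n) : (Cx.cone (f.row 0)).Ex n :=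
  (cone f).row_exact hr (fun p n => cone_col_exact f p n (hK p n) (hJ p n)) n h0

end BiCx

end CotangentComplex

/-! ### Algebras over `E`, iterated free algebras and derivations -/

namespace CotangentComplex

noncomputable section

/-- An `A`-algebra with an `A`-algebra map to `E`. -/
structure OverAlg (A E : Type u) [CommRing A] [CommRing E] [Algebra A E] where
  (C : Type u)
  [ring : CommRing C]
  [alg : Algebra A C]
  (π : C →ₐ[A] E)

attribute [instance] OverAlg.ring OverAlg.alg

variable {A E : Type u} [CommRing A] [CommRing E] [Algebra A E]

namespace OverAlg

/-- Maps of `A`-algebras over `E`. -/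
structure Hom (R S : OverAlg A E) where
  f : R.C →ₐ[A] S.C
  π_f : ∀ x, S.π (f x) = R.π x

/-- Composition of maps of `A`-algebras over `E`. -/
def Hom.comp {R S T : OverAlg A E} (g : Hom S T) (f : Hom R S) : Hom R T :=
  ⟨g.f.comp f.f, fun x => (g.π_f _).trans (f.π_f x)⟩

/-- The identity. -/
def Hom.id (R : OverAlg A E) : Hom R R := ⟨AlgHom.id A _, fun _ => rfl⟩

theorem Hom.ext {R S : OverAlg A E} {f g : Hom R S} (h : ∀ x, f.f x = g.f x) : f = g := by
  obtain ⟨f, _⟩ := f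
  obtain ⟨g, _⟩ := g
  obtain rfl : f = g := AlgHom.ext h
  rfl

/-- The `A`-derivations of `R` in an `E`-module. -/
structure Der (R : OverAlg A E) (G : Type u) [AddCommGroup G] [Module E G] where
  D : R.C →+ G
  leibniz : ∀ x y, D (x * y) = R.π x • D y + R.π y • D x
  D_algebraMap : ∀ a, D (algebraMap A R.C a) = 0

/-- The free `A`-algebra on the set `R`. -/
def T (R : OverAlg A E) : OverAlg A E := ⟨MvPolynomial R.C A, MvPolynomial.aeval R.π⟩

/-- Iterated free algebras. -/
def tw (R : OverAlg A E) : ℕ → OverAlg A E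
  | 0 => R
  | n + 1 => (tw R n).T

/-- Evaluation `A[R] → R`. -/
def counit (R : OverAlg A E) : Hom R.T R where
  f := (MvPolynomial.aeval (R := A) (fun x : R.C => x) : MvPolynomial R.C A →ₐ[A] R.C)
  π_f x := by
    change R.π (MvPolynomial.aeval (R := A) (fun x : R.C => x) x) = MvPolynomial.aeval R.π x
    induction x using MvPolynomial.induction_on with
    | C a => simp
    | add p q hp hq => simp only [map_add, hp, hq]
    | mul_X p i hp => simp only [map_mul, hp, MvPolynomial.aeval_X]

/-- The variable `[x]`. -/
def X (R : OverAlg A E) (x : R.C) : R.T.C := (MvPolynomial.X x : MvPolynomial R.C A)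

/-- `A[R] → A[S]` induced by a map of sets. -/
def Tmap {R S : OverAlg A E} (f : R.C → S.C) : R.T.C →ₐ[A] S.T.C :=
  (MvPolynomial.rename f : MvPolynomial R.C A →ₐ[A] MvPolynomial S.C A)

/-- `A[R] → A[S]` induced by a map of sets over `E`. -/
def Thom {R S : OverAlg A E} (f : R.C → S.C) (hf : ∀ x, S.π (f x) = R.π x) : Hom R.T S.T where
  f := Tmap f
  π_f x := by
    refine (MvPolynomial.aeval_rename f S.π (show MvPolynomial R.C A from x)).trans ?_
    exact congrArg (fun h => MvPolynomial.aeval (R := A) h (show MvPolynomial R.C A from x))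
      (funext hf)

theorem T_hom_ext {R : OverAlg A E} {S : Type u} [CommRing S] [Algebra A S] {f g : R.T.C →ₐ[A] S}
    (h : ∀ x, f (R.X x) = g (R.X x)) : f = g :=
  MvPolynomial.algHom_ext (R := A) (σ := R.C) h

@[simp] theorem counit_X (R : OverAlg A E) (x : R.C) : R.counit.f (R.X x) = x :=
  MvPolynomial.aeval_X _ _

@[simp] theorem Tmap_X {R S : OverAlg A E} (f : R.C → S.C) (x : R.C) :
    Tmap f (R.X x) = S.X (f x) := MvPolynomial.rename_X _ _

@[simp] theorem π_X (R : OverAlg A E) (x : R.C) : R.T.π (R.X x) = R.π x :=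
  MvPolynomial.aeval_X _ _

theorem Tmap_comp {R S U : OverAlg A E} (g : S.C → U.C) (f : R.C → S.C) (x : R.T.C) :
    Tmap g (Tmap f x) = Tmap (fun y => g (f y)) x :=
  MvPolynomial.rename_rename _ _ _

theorem Tmap_id {R : OverAlg A E} (x : R.T.C) : Tmap (fun y : R.C => y) x = x :=
  MvPolynomial.rename_id_apply _

theorem counit_Tmap {R S : OverAlg A E} (f : R.C →ₐ[A] S.C) (x : R.T.C) :
    S.counit.f (Tmap f x) = f (R.counit.f x) := by
  have : S.counit.f.comp (Tmap f) = f.comp R.counit.f := T_hom_ext fun y => by simp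
  exact congrArg (fun g => g x) this

/-- Iterated functoriality for maps of sets. -/
def twmap {R S : OverAlg A E} (f : R.C → S.C) : ∀ n, (tw R n).C → (tw S n).C
  | 0 => f
  | n + 1 => Tmap (R := tw R n) (S := tw S n) (twmap f n)

/-- Functoriality of `T^n` for arbitrary maps of sets is what later allows contractions that are not
ring homomorphisms. -/
theorem twmap_comp {R S U : OverAlg A E} (g : S.C → U.C) (f : R.C → S.C) (n : ℕ) :
    ∀ x : (tw R n).C, twmap g n (twmap f n x) = twmap (fun y => g (f y)) n x := by
  induction n with
  | zero => intro x; rfl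
  | succ n ih =>
    intro x
    refine (Tmap_comp (R := tw R n) (S := tw S n) (U := tw U n) _ _ x).trans ?_
    exact congrArg (fun h => Tmap h x) (funext ih)

theorem twmap_id {R : OverAlg A E} (n : ℕ) :
    ∀ x : (tw R n).C, twmap (fun y : R.C => y) n x = x := by
  induction n with
  | zero => intro x; rfl
  | succ n ih =>
    intro x
    refine Eq.trans ?_ (Tmap_id (R := tw R n) x)
    exact congrArg (fun h => Tmap h x) (funext ih)

theorem twmap_injective {R S : OverAlg A E} {f : R.C → S.C} (hf : Function.Injective f) (n : ℕ) :
    Function.Injective (twmap f n) := by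
  induction n with
  | zero => exact hf
  | succ n ih => exact MvPolynomial.rename_injective _ ih

/-- Iterated functoriality. -/
def twhom {R S : OverAlg A E} (f : Hom R S) : ∀ n, Hom (tw R n) (tw S n)
  | 0 => f
  | n + 1 => Thom (twhom f n).f (twhom f n).π_f

theorem twhom_f {R S : OverAlg A E} (f : Hom R S) (n : ℕ) :
    ∀ x, (twhom f n).f x = twmap f.f n x := by
  induction n with
  | zero => intro x; rfl
  | succ n ih =>
    intro x
    exact congrArg (fun h => Tmap h x) (funext ih)

/-- The faces of the standard resolution. -/
def face (R : OverAlg A E) : ∀ n, Fin (n + 1) → Hom (tw R (n + 1)) (tw R n)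
  | 0, _ => counit R
  | n + 1, i => Fin.cases (motive := fun _ => Hom (tw R (n + 2)) (tw R (n + 1)))
      (counit (tw R (n + 1))) (fun j => Thom (face R n j).f (face R n j).π_f) i

theorem face_zero (R : OverAlg A E) (n : ℕ) : face R n 0 = counit (tw R n) := by
  cases n <;> rfl

theorem face_face (R : OverAlg A E) (n : ℕ) (i j : Fin (n + 1)) (hij : i ≤ j) :
    ∀ x, (face R n i).f ((face R (n + 1) j.succ).f x) =
      (face R n j).f ((face R (n + 1) i.castSucc).f x) := by
  induction n with
  | zero =>
    obtain rfl : i = 0 := Subsingleton.elim (α := Fin 1) _ _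
    obtain rfl : j = 0 := Subsingleton.elim (α := Fin 1) _ _
    exact counit_Tmap (R := tw R 1) (S := tw R 0) _
  | succ n ih =>
    induction i using Fin.cases with
    | zero => exact counit_Tmap (R := tw R (n + 2)) (S := tw R (n + 1)) _
    | succ i =>
      induction j using Fin.cases with
      | zero => exact absurd hij (by simp)
      | succ j =>
        intro x
        refine (Tmap_comp (R := tw R (n + 2)) (S := tw R (n + 1)) (U := tw R n) _ _ x).trans ?_
        refine Eq.trans ?_
          (Tmap_comp (R := tw R (n + 2)) (S := tw R (n + 1)) (U := tw R n) _ _ x).symm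
        exact congrArg (fun h => Tmap h x) (funext (ih i j (by simpa using hij)))

theorem twhom_face {R S : OverAlg A E} (f : Hom R S) (n : ℕ) (i : Fin (n + 1)) :
    ∀ x, (twhom f n).f ((face R n i).f x) = (face S n i).f ((twhom f (n + 1)).f x) := by
  induction n with
  | zero =>
    intro x
    exact (counit_Tmap (R := tw R 0) (S := tw S 0) f.f x).symm
  | succ n ih =>
    induction i using Fin.cases with
    | zero =>
      intro x
      exact (counit_Tmap (R := tw R (n + 1)) (S := tw S (n + 1)) (twhom f (n + 1)).f x).symm
    | succ i =>
      intro x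
      refine (Tmap_comp (R := tw R (n + 1)) (S := tw R n) (U := tw S n) _ _ x).trans ?_
      refine Eq.trans ?_
        (Tmap_comp (R := tw R (n + 1)) (S := tw S (n + 1)) (U := tw S n) _ _ x).symm
      exact congrArg (fun h => Tmap h x) (funext (ih i))

/-- The universal derivation of a polynomial algebra, with values in an `E`-module. -/
def dpoly {σ : Type u} (π : MvPolynomial σ A →ₐ[A] E) :
    Der (⟨MvPolynomial σ A, π⟩ : OverAlg A E) (σ →₀ E) :=
  letI : Module (MvPolynomial σ A) (σ →₀ E) := Module.compHom _ π.toRingHom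
  haveI : IsScalarTower A (MvPolynomial σ A) (σ →₀ E) := ⟨fun a p x => by
    change π (a • p) • x = a • (π p • x)
    rw [map_smul, smul_assoc]⟩
  let δ : Derivation A (MvPolynomial σ A) (σ →₀ E) :=
    MvPolynomial.mkDerivation A (fun s : σ => Finsupp.single s (1 : E))
  { D := AddMonoidHom.mk' (fun p : MvPolynomial σ A => δ p) (fun x y => map_add δ x y)
    leibniz := fun x y => Derivation.leibniz δ x y
    D_algebraMap := fun a => Derivation.map_algebraMap δ a }

theorem dpoly_X {σ : Type u} (π : MvPolynomial σ A →ₐ[A] E) (s : σ) :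
    (dpoly π).D (MvPolynomial.X s : MvPolynomial σ A) = Finsupp.single s (1 : E) := by
  let : Module (MvPolynomial σ A) (σ →₀ E) := Module.compHom _ π.toRingHom
  have : IsScalarTower A (MvPolynomial σ A) (σ →₀ E) := ⟨fun a p x => by
    change π (a • p) • x = a • (π p • x)
    rw [map_smul, smul_assoc]⟩
  exact MvPolynomial.mkDerivation_X (A := σ →₀ E) A (fun s : σ => Finsupp.single s (1 : E)) s

/-- The chain rule. -/
theorem Der.chain {σ : Type u} (π : MvPolynomial σ A →ₐ[A] E) {S : OverAlg A E} {G : Type u}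
    [AddCommGroup G] [Module E G] (D : Der S G) (g : MvPolynomial σ A →ₐ[A] S.C)
    (hg : ∀ x, S.π (g x) = π x) (p : MvPolynomial σ A) :
    D.D (g p) = Finsupp.linearCombination E (fun s => D.D (g (MvPolynomial.X s)))
      ((dpoly π).D p) := by
  induction p using MvPolynomial.induction_on with
  | C a =>
    rw [← MvPolynomial.algebraMap_eq, AlgHom.commutes, D.D_algebraMap]
    exact ((congrArg _ ((dpoly π).D_algebraMap a)).trans (map_zero _)).symm
  | add p q hp hq =>
    rw [map_add, map_add, hp, hq, ← map_add]
    exact congrArg _ ((dpoly π).D.map_add p q).symm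
  | mul_X p s hp =>
    rw [map_mul, D.leibniz, hp]
    have h := (dpoly π).leibniz p (MvPolynomial.X s)
    refine Eq.trans ?_ (congrArg _ h.symm)
    rw [map_add, map_smul, map_smul, hg, hg]
    congr 2
    refine Eq.trans ?_ (congrArg _ (dpoly_X π s).symm)
    simp

/-- The derivation `A[R] → E^{(R)}`. -/
def dl (R : OverAlg A E) : Der R.T (R.C →₀ E) := dpoly (MvPolynomial.aeval R.π)

theorem dl_X (R : OverAlg A E) (x : R.C) : (dl R).D (R.X x) = Finsupp.single x 1 :=
  dpoly_X _ _

theorem dl_chain (R : OverAlg A E) {S : OverAlg A E} {G : Type u} [AddCommGroup G] [Module E G]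
    (D : Der S G) (g : Hom R.T S) (p : R.T.C) :
    D.D (g.f p) = Finsupp.linearCombination E (fun x => D.D (g.f (R.X x))) ((dl R).D p) :=
  Der.chain (MvPolynomial.aeval R.π) D g.f g.π_f p

/-- The linear extension of a derivation. -/
def Der.lin {R : OverAlg A E} {G : Type u} [AddCommGroup G] [Module E G]
    (D : Der R G) : (R.C →₀ E) →ₗ[E] G := Finsupp.linearCombination E D.D

theorem Der.lin_dl {R : OverAlg A E} {G : Type u} [AddCommGroup G] [Module E G]
    (D : Der R G) (p : R.T.C) : D.lin ((dl R).D p) = D.D (R.counit.f p) := by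
  rw [dl_chain R D R.counit]
  simp only [counit_X]
  rfl

theorem dl_Tmap {R S : OverAlg A E} (f : R.C → S.C) (hf : ∀ x, S.π (f x) = R.π x) (p : R.T.C) :
    (dl S).D (Tmap f p) = Finsupp.lmapDomain E E f ((dl R).D p) := by
  refine (dl_chain R (dl S) (Thom f hf) p).trans ?_
  rw [Finsupp.lmapDomain_apply, Finsupp.mapDomain, Finsupp.linearCombination_apply]
  refine Finsupp.sum_congr fun x _ => ?_
  change _ • (dl S).D (Tmap f (R.X x)) = _
  rw [Tmap_X, dl_X]
  simp

end OverAlg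

end

end CotangentComplex

/-! ### The standard complex with coefficients in `E` -/

namespace CotangentComplex

noncomputable section

variable {A E : Type u} [CommRing A] [CommRing E] [Algebra A E]

namespace OverAlg

/-- The terms of the standard complex of `R` with coefficients in `E`, augmented by `G`. -/
def bX (R : OverAlg A E) (G : Type u) : ℕ → Type u
  | 0 => G
  | n + 1 => (tw R n).C →₀ E

instance (R : OverAlg A E) (G : Type u) [AddCommGroup G] : ∀ n, AddCommGroup (bX R G n)
  | 0 => inferInstanceAs (AddCommGroup G)
  | n + 1 => inferInstanceAs (AddCommGroup ((tw R n).C →₀ E))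

/-- The faces of the standard complex. -/
def bface (R : OverAlg A E) (n : ℕ) :
    Fin (n + 2) → ((tw R (n + 1)).C →₀ E) →ₗ[E] ((tw R n).C →₀ E) :=
  Fin.cases (dl (tw R n)).lin (fun i => Finsupp.lmapDomain E E (face R n i).f)

/-- The differentials of the standard complex. -/
def bdiff (R : OverAlg A E) (n : ℕ) : ((tw R (n + 1)).C →₀ E) →ₗ[E] ((tw R n).C →₀ E) :=
  ∑ i : Fin (n + 2), (-1 : ℤ) ^ (i : ℕ) • bface R n i

theorem lin_single {R : OverAlg A E} {G : Type u} [AddCommGroup G] [Module E G] (D : Der R G)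
    (x : R.C) (e : E) : D.lin (Finsupp.single x e) = e • D.D x :=
  Finsupp.linearCombination_single _ _ _

theorem lmap_single {σ τ : Type u} (f : σ → τ) (x : σ) (e : E) :
    Finsupp.lmapDomain E E f (Finsupp.single x e) = Finsupp.single (f x) e :=
  Finsupp.mapDomain_single

theorem bface_zero_single (R : OverAlg A E) (n : ℕ) (x : (tw R (n + 1)).C) (e : E) :
    bface R n 0 (Finsupp.single x e) = e • (dl (tw R n)).D x := lin_single _ _ _

theorem bface_succ_single (R : OverAlg A E) (n : ℕ) (i : Fin (n + 1)) (x : (tw R (n + 1)).C)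
    (e : E) : bface R n i.succ (Finsupp.single x e) = Finsupp.single ((face R n i).f x) e :=
  lmap_single _ _ _

/-- Only face `0` is not induced by a map of bases. With `i = 0` the identity is the chain rule for
the evaluation (`j = 0`) or the naturality of `dl` (`j > 0`); otherwise it is the simplicial
identity of the algebras. -/
theorem bface_bface (R : OverAlg A E) (n : ℕ) (i j : Fin (n + 2)) (hij : i ≤ j) :
    bface R n i ∘ₗ bface R (n + 1) j.succ = bface R n j ∘ₗ bface R (n + 1) i.castSucc := by
  refine Finsupp.lhom_ext fun x e => ?_
  rw [LinearMap.comp_apply, LinearMap.comp_apply, bface_succ_single]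
  induction i using Fin.cases with
  | zero =>
    rw [Fin.castSucc_zero, bface_zero_single, bface_zero_single, map_smul]
    congr 1
    induction j using Fin.cases with
    | zero =>
      refine Eq.trans ?_ (Der.lin_dl (R := tw R (n + 1)) (dl (tw R n)) x).symm
      rw [face_zero]
      rfl
    | succ j =>
      exact dl_Tmap (R := tw R (n + 1)) (S := tw R n) (face R n j).f (face R n j).π_f x
  | succ i =>
    induction j using Fin.cases with
    | zero => exact absurd hij (by simp)
    | succ j =>
      rw [← Fin.succ_castSucc, bface_succ_single, bface_succ_single, bface_succ_single,
        face_face R n i j (by simpa using hij)]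

theorem bdiff_bdiff (R : OverAlg A E) (n : ℕ) (x) : bdiff R n (bdiff R (n + 1) x) = 0 :=
  congrArg (fun f => f x) (alternating_comp n (bface R n) (bface R (n + 1)) (bface_bface R n))

theorem bdiff_zero_single (R : OverAlg A E) (x : (tw R 1).C) (e : E) :
    bdiff R 0 (Finsupp.single x e) = e • (dl R).D x - Finsupp.single (R.counit.f x) e := by
  rw [bdiff, Fin.sum_univ_two, LinearMap.add_apply, sub_eq_add_neg]
  congr 1
  · rw [Fin.val_zero, pow_zero, one_smul]
    exact bface_zero_single R 0 x e
  · rw [Fin.val_one, pow_one, neg_one_smul, LinearMap.neg_apply]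
    exact congrArg _ (bface_succ_single R 0 0 x e)

theorem lin_bdiff {R : OverAlg A E} {G : Type u} [AddCommGroup G] [Module E G] (D : Der R G) (x) :
    D.lin (bdiff R 0 x) = 0 := by
  have : D.lin ∘ₗ (show (R.T.C →₀ E) →ₗ[E] (R.C →₀ E) from bdiff R 0) = 0 := by
    refine Finsupp.lhom_ext fun x e => ?_
    refine (congrArg D.lin (bdiff_zero_single R x e)).trans ?_
    rw [map_sub, map_smul, D.lin_dl, lin_single, sub_self, LinearMap.zero_apply]
  exact congrArg (fun f => f x) this

/-- The differentials of the augmented standard complex. -/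
def bd {R : OverAlg A E} {G : Type u} [AddCommGroup G] [Module E G] (D : Der R G) :
    ∀ n, bX R G (n + 1) →+ bX R G n
  | 0 => D.lin.toAddMonoidHom
  | n + 1 => (bdiff R n).toAddMonoidHom

theorem bd_bd {R : OverAlg A E} {G : Type u} [AddCommGroup G] [Module E G] (D : Der R G) :
    ∀ n x, bd D n (bd D (n + 1) x) = 0
  | 0, x => lin_bdiff D x
  | n + 1, x => bdiff_bdiff R n x

/-- The standard complex of `R` with coefficients in `E`, augmented by a derivation. -/
def beta {R : OverAlg A E} {G : Type u} [AddCommGroup G] [Module E G] (D : Der R G) : Cx.{u} where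
  X := bX R G
  d := bd D
  dd := bd_bd D

/-- The maps induced on standard complexes by a map of algebras. -/
def bmap {R S : OverAlg A E} (f : Hom R S) (n : ℕ) :
    ((tw R n).C →₀ E) →ₗ[E] ((tw S n).C →₀ E) :=
  Finsupp.lmapDomain E E (twhom f n).f

theorem bmap_bface {R S : OverAlg A E} (f : Hom R S) (n : ℕ) (i : Fin (n + 2)) (x) :
    bmap f n (bface R n i x) = bface S n i (bmap f (n + 1) x) := by
  have : bmap f n ∘ₗ bface R n i = bface S n i ∘ₗ bmap f (n + 1) := by
    refine Finsupp.lhom_ext fun x e => ?_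
    rw [LinearMap.comp_apply, LinearMap.comp_apply]
    refine Eq.trans ?_ (congrArg (bface S n i) (lmap_single (twhom f (n + 1)).f x e)).symm
    induction i using Fin.cases with
    | zero =>
      rw [bface_zero_single, bface_zero_single, map_smul]
      exact congrArg _ (dl_Tmap (R := tw R n) (S := tw S n) (twhom f n).f (twhom f n).π_f x).symm
    | succ i =>
      rw [bface_succ_single, bface_succ_single, ← twhom_face]
      exact lmap_single _ _ _
  exact congrArg (fun f => f x) this

theorem bmap_bdiff {R S : OverAlg A E} (f : Hom R S) (n : ℕ) (x) :
    bmap f n (bdiff R n x) = bdiff S n (bmap f (n + 1) x) := by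
  simp only [bdiff, LinearMap.sum_apply, LinearMap.smul_apply, map_sum, map_zsmul, bmap_bface]

theorem lin_bmap {R S : OverAlg A E} (f : Hom R S) {G : Type u} [AddCommGroup G] [Module E G]
    (D : Der S G) (x : R.C →₀ E) :
    D.lin (bmap f 0 x) = Finsupp.linearCombination E (fun y => D.D (f.f y)) x :=
  Finsupp.linearCombination_mapDomain E f.f x

/-- The terms of a map of augmented standard complexes. -/
def bmapA {R S : OverAlg A E} (f : Hom R S) {G H : Type u} [AddCommGroup G] [Module E G]
    [AddCommGroup H] [Module E H] (g : G →ₗ[E] H) : ∀ n, bX R G n →+ bX S H n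
  | 0 => g.toAddMonoidHom
  | n + 1 => (bmap f n).toAddMonoidHom

/-- A map of augmented standard complexes. -/
def betaMap {R S : OverAlg A E} (f : Hom R S) {G H : Type u} [AddCommGroup G] [Module E G]
    [AddCommGroup H] [Module E H] (D : Der R G) (D' : Der S H) (g : G →ₗ[E] H)
    (hg : ∀ x, g (D.D x) = D'.D (f.f x)) : Cx.Map (beta D) (beta D') where
  f := bmapA f g
  comm
    | 0, x => by
      refine (Finsupp.apply_linearCombination E g D.D (show R.C →₀ E from x)).trans ?_
      refine Eq.trans ?_ (lin_bmap f D' x).symm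
      exact congrArg (fun h => Finsupp.linearCombination E h (show R.C →₀ E from x)) (funext hg)
    | n + 1, x => bmap_bdiff f n x

/-- The zero derivation in the zero module. -/
def Der.zero (R : OverAlg A E) : Der R PUnit.{u + 1} := ⟨0, fun _ _ => rfl, fun _ => rfl⟩

/-- A map of standard complexes. -/
def betaHom {R S : OverAlg A E} (f : Hom R S) : Cx.Map (beta (Der.zero R)) (beta (Der.zero S)) :=
  betaMap f _ _ 0 fun _ => rfl

/-- A contraction of the faces of an augmented semi-simplicial module gives exactness. -/
theorem alternating_contraction {M N P : Type u} [AddCommGroup M] [AddCommGroup N] [AddCommGroup P]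
    [Module E M] [Module E N] [Module E P] (n : ℕ) (f : Fin (n + 1) → M →ₗ[E] N)
    (g : Fin (n + 2) → P →ₗ[E] M) (h : N →ₗ[E] M) (k : M →ₗ[E] P) (h0 : ∀ x, g 0 (k x) = x)
    (hs : ∀ i x, g (Fin.succ i) (k x) = h (f i x)) (x : M) :
    (∑ i : Fin (n + 2), (-1 : ℤ) ^ (i : ℕ) • g i) (k x) =
      x - h ((∑ i : Fin (n + 1), (-1 : ℤ) ^ (i : ℕ) • f i) x) := by
  simp only [LinearMap.sum_apply, LinearMap.smul_apply, map_sum, map_zsmul]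
  rw [Fin.sum_univ_succ]
  simp only [h0, hs, Fin.val_zero, pow_zero, one_smul, Fin.val_succ, pow_succ, mul_neg, mul_one,
    neg_smul, Finset.sum_neg_distrib, sub_eq_add_neg]

theorem alternating_contraction_last {M N P : Type u} [AddCommGroup M] [AddCommGroup N]
    [AddCommGroup P] [Module E M] [Module E N] [Module E P] (n : ℕ) (f : Fin (n + 1) → M →ₗ[E] N)
    (g : Fin (n + 2) → P →ₗ[E] M) (h : N →ₗ[E] M) (k : M →ₗ[E] P)
    (h0 : ∀ x, g (Fin.last _) (k x) = x)
    (hs : ∀ i x, g (Fin.castSucc i) (k x) = h (f i x)) (x : M) :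
    (∑ i : Fin (n + 2), (-1 : ℤ) ^ (i : ℕ) • g i) (k x) =
      h ((∑ i : Fin (n + 1), (-1 : ℤ) ^ (i : ℕ) • f i) x) + (-1 : ℤ) ^ (n + 1) • x := by
  simp only [LinearMap.sum_apply, LinearMap.smul_apply, map_sum, map_zsmul]
  rw [Fin.sum_univ_castSucc]
  simp only [h0, hs, Fin.val_last, Fin.val_castSucc]

/-- The maps `T^n s` for a section `s` of `T R → R`. -/
def secTw {R : OverAlg A E} (s : Hom R R.T) : ∀ n, Hom (tw R n) (tw R (n + 1))
  | 0 => s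
  | n + 1 => Thom (secTw s n).f (secTw s n).π_f

theorem face_last_secTw {R : OverAlg A E} (s : Hom R R.T) (hs : ∀ x, R.counit.f (s.f x) = x)
    (n : ℕ) : ∀ x, (face R n (Fin.last n)).f ((secTw s n).f x) = x := by
  induction n with
  | zero => exact hs
  | succ n ih =>
    intro x
    rw [← Fin.succ_last]
    refine (Tmap_comp (R := tw R n) (S := tw R (n + 1)) (U := tw R n) _ _ x).trans ?_
    refine Eq.trans ?_ (Tmap_id (R := tw R n) x)
    exact congrArg (fun h => Tmap h x) (funext ih)

theorem face_castSucc_secTw {R : OverAlg A E} (s : Hom R R.T)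
    (n : ℕ) (i : Fin (n + 1)) : ∀ x, (face R (n + 1) i.castSucc).f ((secTw s (n + 1)).f x) =
      (secTw s n).f ((face R n i).f x) := by
  induction n with
  | zero =>
    obtain rfl : i = 0 := Subsingleton.elim (α := Fin 1) _ _
    exact counit_Tmap (R := R) (S := R.T) s.f
  | succ n ih =>
    induction i using Fin.cases with
    | zero =>
      exact counit_Tmap (R := tw R (n + 1)) (S := tw R (n + 2)) (secTw s (n + 1)).f
    | succ i =>
      intro x
      refine (Tmap_comp (R := tw R (n + 1)) (S := tw R (n + 2)) (U := tw R (n + 1)) _ _ x).trans ?_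
      refine Eq.trans ?_
        (Tmap_comp (R := tw R (n + 1)) (S := tw R n) (U := tw R (n + 1)) _ _ x).symm
      exact congrArg (fun h => Tmap h x) (funext (ih i))

/-- The contraction of the standard complex defined by a section of `T R → R`. -/
def bsec {R : OverAlg A E} (s : Hom R R.T) (n : ℕ) :
    ((tw R n).C →₀ E) →ₗ[E] ((tw R (n + 1)).C →₀ E) := Finsupp.lmapDomain E E (secTw s n).f

/-- The maps `T^n s` form an extra degeneracy on the side of the last face: they are sections of it
and commute with the other faces. Commutation with face `0` uses that `s` is a map of algebras over
`E`. -/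
theorem bdiff_bsec {R : OverAlg A E} (s : Hom R R.T) (hs : ∀ x, R.counit.f (s.f x) = x) (n : ℕ)
    (x : (tw R (n + 1)).C →₀ E) :
    bdiff R (n + 1) (bsec s (n + 1) x) = bsec s n (bdiff R n x) + (-1 : ℤ) ^ (n + 2) • x := by
  refine alternating_contraction_last (n + 1) (bface R n) (bface R (n + 1)) (bsec s n)
    (bsec s (n + 1)) (fun x => ?_) (fun i x => ?_) x
  · have : bface R (n + 1) (Fin.last _) ∘ₗ bsec s (n + 1) = LinearMap.id := by
      refine Finsupp.lhom_ext fun x e => ?_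
      rw [LinearMap.comp_apply, bsec, lmap_single, ← Fin.succ_last, bface_succ_single,
        face_last_secTw s hs, LinearMap.id_apply]
    exact congrArg (fun f => f x) this
  · have : bface R (n + 1) i.castSucc ∘ₗ bsec s (n + 1) = bsec s n ∘ₗ bface R n i := by
      refine Finsupp.lhom_ext fun x e => ?_
      rw [LinearMap.comp_apply, LinearMap.comp_apply, bsec, lmap_single]
      induction i using Fin.cases with
      | zero =>
        rw [Fin.castSucc_zero, bface_zero_single, bface_zero_single, map_smul]
        exact congrArg _
          (dl_Tmap (R := tw R n) (S := tw R (n + 1)) (secTw s n).f (secTw s n).π_f x)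
      | succ i =>
        rw [← Fin.succ_castSucc, bface_succ_single, bface_succ_single, face_castSucc_secTw, bsec,
          lmap_single]
    exact congrArg (fun f => f x) this

/-- An algebra with such a section is a retract of a free one, so its cotangent complex has homology
in degree `0` only. -/
theorem bdiff_exact_of_section {R : OverAlg A E} (s : Hom R R.T)
    (hs : ∀ x, R.counit.f (s.f x) = x) (n : ℕ) (x : (tw R (n + 1)).C →₀ E)
    (hx : bdiff R n x = 0) : ∃ y, bdiff R (n + 1) y = x := by
  refine ⟨(-1 : ℤ) ^ n • bsec s (n + 1) x, ?_⟩
  rw [map_zsmul, bdiff_bsec s hs, hx, map_zero, zero_add, smul_smul, ← pow_add,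
    Even.neg_one_pow ⟨n + 1, by ring⟩, one_smul]

/-- The endomorphism `[x] ↦ d(s x)` of `E^{(R)}`, for a section `s` of `T R → R`. -/
def secEnd {R : OverAlg A E} (s : Hom R R.T) : (R.C →₀ E) →ₗ[E] (R.C →₀ E) :=
  Finsupp.linearCombination E (fun x => (dl R).D (s.f x))

theorem secEnd_single {R : OverAlg A E} (s : Hom R R.T) (x : R.C) (e : E) :
    secEnd s (Finsupp.single x e) = e • (dl R).D (s.f x) :=
  Finsupp.linearCombination_single _ _ _

/-- In degree `0` there is no lower term to contract through: face `0` contributes `[x] ↦ d(s x)`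
instead. Thus `secEnd s` is homotopic to the identity, and it kills boundaries because `d ∘ s` is a
derivation of `R`. -/
theorem bdiff_bsec_zero {R : OverAlg A E} (s : Hom R R.T) (hs : ∀ x, R.counit.f (s.f x) = x)
    (x : R.C →₀ E) : bdiff R 0 (bsec s 0 x) = secEnd s x - x := by
  have h (x : R.C) (e : E) : bdiff R 0 (bsec s 0 (Finsupp.single x e)) =
      secEnd s (Finsupp.single x e) - Finsupp.single x e := by
    refine (congrArg (bdiff R 0) (lmap_single (secTw s 0).f x e)).trans ?_
    refine (bdiff_zero_single R (s.f x) e).trans ?_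
    rw [secEnd_single, hs]
  have key : (show (R.C →₀ E) →ₗ[E] (R.C →₀ E) from bdiff R 0 ∘ₗ bsec s 0) =
    secEnd s - LinearMap.id := Finsupp.lhom_ext h
  exact congrArg (fun f => f x) key

/-- The composite of a derivation with a map of algebras. -/
def Der.compHom {R S : OverAlg A E} {G : Type u} [AddCommGroup G] [Module E G] (D : Der S G)
    (f : Hom R S) : Der R G where
  D := D.D.comp f.f.toAddMonoidHom
  leibniz x y := by
    change D.D (f.f (x * y)) = R.π x • D.D (f.f y) + R.π y • D.D (f.f x)
    rw [map_mul, D.leibniz, f.π_f, f.π_f]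
  D_algebraMap a := by
    change D.D (f.f (algebraMap A R.C a)) = 0
    rw [f.f.commutes, D.D_algebraMap]

theorem secEnd_bdiff {R : OverAlg A E} (s : Hom R R.T) (x) : secEnd s (bdiff R 0 x) = 0 :=
  lin_bdiff ((dl R).compHom s) x

end OverAlg

end

end CotangentComplex

/-! ### Semi-simplicial resolutions and their bicomplexes -/

namespace CotangentComplex

noncomputable section

variable {A E : Type u} [CommRing A] [CommRing E] [Algebra A E]

namespace OverAlg

/-- Augmented semi-simplicial `A`-algebras over `E`; the augmentation is the object of index `0`. -/
structure SSA (A E : Type u) [CommRing A] [CommRing E] [Algebra A E] where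
  obj : ℕ → OverAlg A E
  face : ∀ n, Fin (n + 1) → Hom (obj (n + 1)) (obj n)
  face_face : ∀ n (i j : Fin (n + 1)), i ≤ j → ∀ x,
    (face n i).f ((face (n + 1) j.succ).f x) = (face n j).f ((face (n + 1) i.castSucc).f x)

/-- Contractions of the underlying augmented semi-simplicial set. -/
structure SSA.Contr (Q : SSA A E) where
  h : ∀ n, (Q.obj n).C → (Q.obj (n + 1)).C
  face_zero : ∀ n x, (Q.face n 0).f (h n x) = x
  face_succ : ∀ n i x, (Q.face (n + 1) (Fin.succ i)).f (h (n + 1) x) = h n ((Q.face n i).f x)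

/-- Alternating sums of maps satisfying the simplicial identities compose to zero. -/
theorem alternating_comp' {L M N : Type u} [AddCommGroup L] [AddCommGroup M]
    [AddCommGroup N] [Module E L] [Module E M] [Module E N] (n : ℕ)
    (f : Fin (n + 1) → M →ₗ[E] N) (g : Fin (n + 2) → L →ₗ[E] M)
    (key : ∀ i j : Fin (n + 1), i ≤ j → f i ∘ₗ g j.succ = f j ∘ₗ g i.castSucc) :
    (∑ i : Fin (n + 1), (-1 : ℤ) ^ (i : ℕ) • f i) ∘ₗ
      (∑ j : Fin (n + 2), (-1 : ℤ) ^ (j : ℕ) • g j) = 0 := by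
  cases n with
  | zero =>
    have h : f 0 ∘ₗ g 1 = f 0 ∘ₗ g 0 := key 0 0 le_rfl
    rw [Fin.sum_univ_one, Fin.sum_univ_two]
    simp [LinearMap.comp_add, h]
  | succ n => exact alternating_comp n f g key

/-- The maps on the terms of standard complexes induced by the faces. -/
def SSA.vdiff (Q : SSA A E) (p q : ℕ) :
    ((tw (Q.obj (q + 1)) p).C →₀ E) →ₗ[E] ((tw (Q.obj q) p).C →₀ E) :=
  ∑ i : Fin (q + 1), (-1 : ℤ) ^ (i : ℕ) • bmap (Q.face q i) p

theorem bmap_single {R S : OverAlg A E} (f : Hom R S) (n : ℕ) (x : (tw R n).C) (e : E) :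
    bmap f n (Finsupp.single x e) = Finsupp.single (twmap f.f n x) e :=
  (lmap_single _ _ _).trans (by rw [twhom_f])

theorem SSA.vdiff_vdiff (Q : SSA A E) (p q : ℕ) (x) : Q.vdiff p q (Q.vdiff p (q + 1) x) = 0 := by
  refine congrArg (fun f => f x) (alternating_comp' q (fun i => bmap (Q.face q i) p)
    (fun i => bmap (Q.face (q + 1) i) p) fun i j hij => ?_)
  refine Finsupp.lhom_ext fun x e => ?_
  rw [LinearMap.comp_apply, LinearMap.comp_apply, bmap_single, bmap_single, bmap_single,
    bmap_single, twmap_comp, twmap_comp]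
  exact congrArg (fun f => Finsupp.single (twmap f p x) e) (funext (Q.face_face q i j hij))

theorem SSA.bdiff_vdiff (Q : SSA A E) (p q : ℕ) (x) :
    bdiff (Q.obj q) p (Q.vdiff (p + 1) q x) = Q.vdiff p q (bdiff (Q.obj (q + 1)) p x) := by
  simp only [vdiff, LinearMap.sum_apply, LinearMap.smul_apply, map_sum, map_zsmul, bmap_bdiff]

/-- Augmentations of the standard complexes of the terms of an augmented semi-simplicial algebra. -/
structure SSA.Aug (Q : SSA A E) where
  (W : ℕ → Type u)
  [grp : ∀ n, AddCommGroup (W n)]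
  [mod : ∀ n, Module E (W n)]
  w : ∀ n, W (n + 1) →ₗ[E] W n
  ww : ∀ n x, w n (w (n + 1) x) = 0
  D : ∀ n, Der (Q.obj n) (W n)
  D_face : ∀ n x, w n ((D (n + 1)).D x) =
    ∑ i : Fin (n + 1), (-1 : ℤ) ^ (i : ℕ) • (D n).D ((Q.face n i).f x)

attribute [instance] SSA.Aug.grp SSA.Aug.mod

theorem SSA.Aug.lin_vdiff {Q : SSA A E} (V : Q.Aug) (q : ℕ) (x : (Q.obj (q + 1)).C →₀ E) :
    (V.D q).lin (Q.vdiff 0 q x) = V.w q ((V.D (q + 1)).lin x) := by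
  have h (x : (Q.obj (q + 1)).C) (e : E) : (V.D q).lin (Q.vdiff 0 q (Finsupp.single x e)) =
      V.w q ((V.D (q + 1)).lin (Finsupp.single x e)) := by
    rw [lin_single, map_smul, V.D_face, Finset.smul_sum]
    refine (congrArg (V.D q).lin (LinearMap.sum_apply _ _ _)).trans ?_
    refine (map_sum (V.D q).lin _ _).trans (Finset.sum_congr rfl fun i _ => ?_)
    refine (map_zsmul (V.D q).lin _ _).trans ?_
    rw [smul_comm e]
    refine congrArg _ ?_
    exact (congrArg (V.D q).lin (bmap_single (Q.face q i) 0 x e)).trans (lin_single _ _ _)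
  exact congrArg (fun f => f x) (Finsupp.lhom_ext (φ := (V.D q).lin ∘ₗ
    (show ((Q.obj (q + 1)).C →₀ E) →ₗ[E] ((Q.obj q).C →₀ E) from Q.vdiff 0 q))
    (ψ := V.w q ∘ₗ (V.D (q + 1)).lin) h)

/-- The vertical differentials of the bicomplex of an augmented semi-simplicial algebra. -/
def SSA.Aug.v {Q : SSA A E} (V : Q.Aug) :
    ∀ p q, bX (Q.obj (q + 1)) (V.W (q + 1)) p →+ bX (Q.obj q) (V.W q) p
  | 0, q => (V.w q).toAddMonoidHom
  | p + 1, q => (Q.vdiff p q).toAddMonoidHom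

/-- The bicomplex of standard complexes of an augmented semi-simplicial algebra. -/
def SSA.Aug.bicx {Q : SSA A E} (V : Q.Aug) : BiCx.{u} where
  X p q := bX (Q.obj q) (V.W q) p
  d p q := bd (V.D q) p
  v := V.v
  dd p q := bd_bd (V.D q) p
  vv
    | 0, q, x => V.ww q x
    | p + 1, q, x => Q.vdiff_vdiff p q x
  dv
    | 0, q, x => V.lin_vdiff q x
    | p + 1, q, x => Q.bdiff_vdiff p q x

/-- Column `p + 1` consists of the free modules on the sets `T^p (Q_q)`, so the contraction `H` of
sets linearizes to a contraction of the column. It need not commute with the horizontal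
differentials. -/
theorem SSA.Aug.col_exact {Q : SSA A E} (V : Q.Aug) (H : Q.Contr) (p n : ℕ) :
    (V.bicx.col (p + 1)).Ex n := by
  let k (q : ℕ) : ((tw (Q.obj q) p).C →₀ E) →ₗ[E] ((tw (Q.obj (q + 1)) p).C →₀ E) :=
    Finsupp.lmapDomain E E (twmap (H.h q) p)
  have h0 (q : ℕ) (x) : bmap (Q.face q 0) p (k q x) = x := by
    have : bmap (Q.face q 0) p ∘ₗ k q = LinearMap.id := by
      refine Finsupp.lhom_ext fun x e => ?_
      rw [LinearMap.comp_apply, lmap_single, bmap_single, twmap_comp, LinearMap.id_apply]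
      refine congrArg (fun y => Finsupp.single y e) (Eq.trans ?_ (twmap_id p x))
      exact congrArg (fun f => twmap f p x) (funext (H.face_zero q))
    exact congrArg (fun f => f x) this
  have hs (q : ℕ) (i : Fin (q + 1)) (x) :
      bmap (Q.face (q + 1) i.succ) p (k (q + 1) x) = k q (bmap (Q.face q i) p x) := by
    have : bmap (Q.face (q + 1) i.succ) p ∘ₗ k (q + 1) = k q ∘ₗ bmap (Q.face q i) p := by
      refine Finsupp.lhom_ext fun x e => ?_
      rw [LinearMap.comp_apply, LinearMap.comp_apply, lmap_single, bmap_single, twmap_comp,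
        bmap_single, lmap_single, twmap_comp]
      exact congrArg (fun f => Finsupp.single (twmap f p x) e) (funext (H.face_succ q i))
    exact congrArg (fun f => f x) this
  cases n with
  | zero =>
    intro (x : (tw (Q.obj 0) p).C →₀ E)
    refine ⟨k 0 x, ?_⟩
    change Q.vdiff p 0 (k 0 x) = x
    rw [vdiff, Fin.sum_univ_one, Fin.val_zero, pow_zero, one_smul, h0]
  | succ n =>
    intro (x : (tw (Q.obj (n + 1)) p).C →₀ E) (hx : Q.vdiff p n x = 0)
    refine ⟨k (n + 1) x, ?_⟩
    change Q.vdiff p (n + 1) (k (n + 1) x) = x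
    refine (alternating_contraction n (fun i => bmap (Q.face n i) p)
      (fun i => bmap (Q.face (n + 1) i) p) (k n) (k (n + 1)) (h0 (n + 1)) (hs n) x).trans ?_
    refine (congrArg (fun y => x - k n y) hx).trans ?_
    rw [map_zero, sub_zero]

/-- The zero augmentation. -/
def SSA.zeroAug (Q : SSA A E) : Q.Aug where
  W _ := PUnit
  w _ := 0
  ww _ _ := rfl
  D _ := Der.zero _
  D_face _ _ := rfl

/-- Maps of augmented semi-simplicial algebras. -/
structure SSA.Map (P Q : SSA A E) where
  f : ∀ n, Hom (P.obj n) (Q.obj n)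
  f_face : ∀ n i x, (f n).f ((P.face n i).f x) = (Q.face n i).f ((f (n + 1)).f x)

theorem SSA.Map.bmap_vdiff {P Q : SSA A E} (f : P.Map Q) (p q : ℕ)
    (x : (tw (P.obj (q + 1)) p).C →₀ E) :
    bmap (f.f q) p (P.vdiff p q x) = Q.vdiff p q (bmap (f.f (q + 1)) p x) := by
  have h (i : Fin (q + 1)) (y) : bmap (f.f q) p (bmap (P.face q i) p y) =
      bmap (Q.face q i) p (bmap (f.f (q + 1)) p y) := by
    have : bmap (f.f q) p ∘ₗ bmap (P.face q i) p =
        bmap (Q.face q i) p ∘ₗ bmap (f.f (q + 1)) p := by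
      refine Finsupp.lhom_ext fun x e => ?_
      rw [LinearMap.comp_apply, LinearMap.comp_apply, bmap_single, bmap_single, bmap_single,
        bmap_single, twmap_comp, twmap_comp]
      exact congrArg (fun g => Finsupp.single (twmap g p x) e) (funext (f.f_face q i))
    exact congrArg (fun f => f y) this
  simp only [vdiff, LinearMap.sum_apply, LinearMap.smul_apply, map_sum, map_zsmul, h]

/-- The map of bicomplexes induced by a map of semi-simplicial algebras. -/
def SSA.Map.bimap {P Q : SSA A E} (f : P.Map Q) (V : Q.Aug)
    (hf : ∀ q x, (V.D q).D ((f.f q).f x) = 0) : BiCx.Map P.zeroAug.bicx V.bicx where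
  f p q := bmapA (f.f q) (0 : PUnit.{u + 1} →ₗ[E] V.W q) p
  comm_d p q x := (betaMap (f.f q) (Der.zero _) (V.D q) 0 (fun x => (hf q x).symm)).comm p x
  comm_v
    | 0, q, _ => ((V.w q).map_zero).symm
    | p + 1, q, x => f.bmap_vdiff p q x

/-- The comparison of the mapping cones of standard complexes. -/
theorem SSA.Map.cone_exact {P Q : SSA A E} (f : P.Map Q) (V : Q.Aug)
    (hf : ∀ q x, (V.D q).D ((f.f q).f x) = 0) (hP : P.Contr) (hQ : Q.Contr)
    (hr : ∀ q n, (Cx.cone (betaMap (f.f (q + 1)) (Der.zero _) (V.D (q + 1)) 0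
      (fun x => (hf (q + 1) x).symm))).Ex n) (n : ℕ)
    (h0 : (V.bicx.col 0).Ex n) :
    (Cx.cone (betaMap (f.f 0) (Der.zero _) (V.D 0) 0 (fun x => (hf 0 x).symm))).Ex n := by
  refine BiCx.cone_row_exact (f.bimap V hf) hr (V.col_exact hQ) (fun p n => ?_) n h0
  cases p with
  | zero =>
    cases n with
    | zero => exact fun x => ⟨PUnit.unit, rfl⟩
    | succ n => exact fun x _ => ⟨PUnit.unit, rfl⟩
  | succ p => exact P.zeroAug.col_exact hP p n

end OverAlg

end

end CotangentComplex

/-! ### Polynomial algebras: the relative complex of `R → R[σ]` -/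

namespace CotangentComplex

noncomputable section

variable {A E : Type u} [CommRing A] [CommRing E] [Algebra A E]

namespace OverAlg

/-- The polynomial algebra `R[σ]`. -/
def poly (R : OverAlg A E) {σ : Type u} (ξ : σ → E) : OverAlg A E :=
  ⟨MvPolynomial σ R.C, MvPolynomial.aevalTower R.π ξ⟩

/-- The inclusion `R → R[σ]`. -/
def polyC (R : OverAlg A E) {σ : Type u} (ξ : σ → E) : Hom R (poly R ξ) where
  f := (Algebra.ofId R.C (MvPolynomial σ R.C)).restrictScalars A
  π_f := MvPolynomial.aevalTower_C _ _

/-- The variables of a polynomial algebra. -/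
def polyX (R : OverAlg A E) {σ : Type u} (ξ : σ → E) (s : σ) : (poly R ξ).C :=
  (MvPolynomial.X s : MvPolynomial σ R.C)

theorem poly_π_X (R : OverAlg A E) {σ : Type u} (ξ : σ → E) (s : σ) :
    (poly R ξ).π (polyX R ξ s) = ξ s := MvPolynomial.aevalTower_X _ _ _

/-- The `R`-derivation `R[σ] → E^{(σ)}`. -/
def polyD (R : OverAlg A E) {σ : Type u} (ξ : σ → E) : Der (poly R ξ) (σ →₀ E) :=
  letI : Algebra R.C E := R.π.toRingHom.toAlgebra
  let δ := dpoly (A := R.C) (MvPolynomial.aeval ξ)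
  { D := δ.D
    leibniz := δ.leibniz
    D_algebraMap := fun a => δ.D_algebraMap (algebraMap A R.C a) }

theorem polyD_C (R : OverAlg A E) {σ : Type u} (ξ : σ → E) (r : R.C) :
    (polyD R ξ).D ((polyC R ξ).f r) = 0 :=
  let : Algebra R.C E := R.π.toRingHom.toAlgebra
  (dpoly (A := R.C) (MvPolynomial.aeval ξ)).D_algebraMap r

theorem polyD_X (R : OverAlg A E) {σ : Type u} (ξ : σ → E) (s : σ) :
    (polyD R ξ).D (polyX R ξ s) = Finsupp.single s 1 :=
  let : Algebra R.C E := R.π.toRingHom.toAlgebra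
  dpoly_X (A := R.C) (MvPolynomial.aeval ξ) s

/-- Induction principle for polynomial algebras. -/
theorem poly_induction {R : OverAlg A E} {σ : Type u} {ξ : σ → E} {P : (poly R ξ).C → Prop}
    (C : ∀ r, P ((polyC R ξ).f r)) (add : ∀ p q, P p → P q → P (p + q))
    (mul : ∀ p s, P p → P (p * polyX R ξ s)) (p : (poly R ξ).C) : P p :=
  MvPolynomial.induction_on (show MvPolynomial σ R.C from p) C add mul

theorem poly_hom_ext {R : OverAlg A E} {σ : Type u} {ξ : σ → E} {S : Type u} [CommRing S]
    [Algebra A S] {f g : (poly R ξ).C →ₐ[A] S} (hC : ∀ r, f ((polyC R ξ).f r) = g ((polyC R ξ).f r))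
    (hX : ∀ s, f (polyX R ξ s) = g (polyX R ξ s)) (p) : f p = g p := by
  induction p using poly_induction with
  | C r => exact hC r
  | add p q hp hq => rw [map_add, map_add, hp, hq]
  | mul p s hp => rw [map_mul, map_mul, hp, hX]

/-- The chain rule for maps of polynomial algebras. -/
theorem poly_chain {R : OverAlg A E} {σ : Type u} {ξ : σ → E} {S : OverAlg A E} {G : Type u}
    [AddCommGroup G] [Module E G] (D : Der S G) (g : Hom (poly R ξ) S)
    (hg : ∀ r, D.D (g.f ((polyC R ξ).f r)) = 0) (p) :
    D.D (g.f p) = Finsupp.linearCombination E (fun s => D.D (g.f (polyX R ξ s)))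
      ((polyD R ξ).D p) := by
  induction p using poly_induction with
  | C r => rw [hg, polyD_C, map_zero]
  | add p q hp hq => rw [map_add, map_add, map_add, map_add, hp, hq]
  | mul p s hp =>
    rw [map_mul, D.leibniz, hp, (polyD R ξ).leibniz, map_add, map_smul, map_smul, g.π_f, g.π_f,
      polyD_X, Finsupp.linearCombination_single, one_smul]

/-- Maps out of a polynomial algebra. -/
def polyLift {R : OverAlg A E} {σ : Type u} {ξ : σ → E} {S : OverAlg A E} (f : Hom R S)
    (x : σ → S.C) (hx : ∀ s, S.π (x s) = ξ s) : Hom (poly R ξ) S where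
  f := (MvPolynomial.aevalTower f.f x : MvPolynomial σ R.C →ₐ[A] S.C)
  π_f := poly_hom_ext
    (f := S.π.comp (MvPolynomial.aevalTower f.f x : MvPolynomial σ R.C →ₐ[A] S.C))
    (g := (poly R ξ).π)
    (fun r => ((congrArg S.π (MvPolynomial.aevalTower_C f.f x r)).trans (f.π_f r)).trans
      ((polyC R ξ).π_f r).symm)
    (fun s => ((congrArg S.π (MvPolynomial.aevalTower_X f.f x s)).trans (hx s)).trans
      (poly_π_X R ξ s).symm)

theorem polyLift_C {R : OverAlg A E} {σ : Type u} {ξ : σ → E} {S : OverAlg A E} (f : Hom R S)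
    (x : σ → S.C) (hx : ∀ s, S.π (x s) = ξ s) (r) :
    (polyLift f x hx).f ((polyC R ξ).f r) = f.f r := MvPolynomial.aevalTower_C _ _ _

theorem polyLift_X {R : OverAlg A E} {σ : Type u} {ξ : σ → E} {S : OverAlg A E} (f : Hom R S)
    (x : σ → S.C) (hx : ∀ s, S.π (x s) = ξ s) (s) :
    (polyLift f x hx).f (polyX R ξ s) = x s := MvPolynomial.aevalTower_X _ _ _

section Section

variable {R : OverAlg A E} {σ : Type u} (ξ : σ → E) (s : Hom R R.T)
  (hs : ∀ x, R.counit.f (s.f x) = x)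

/-- The section of `T (R[σ]) → R[σ]` extending a section of `T R → R`. -/
def polySec : Hom (poly R ξ) (poly R ξ).T :=
  polyLift ((Thom (polyC R ξ).f (polyC R ξ).π_f).comp s) (fun x => (poly R ξ).X (polyX R ξ x))
    (fun x => (π_X _ _).trans (poly_π_X R ξ x))

theorem polySec_C (r) : (polySec ξ s).f ((polyC R ξ).f r) = Tmap (polyC R ξ).f (s.f r) :=
  polyLift_C _ _ _ _

theorem polySec_X (x) : (polySec ξ s).f (polyX R ξ x) = (poly R ξ).X (polyX R ξ x) :=
  polyLift_X _ _ _ _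

include hs in
theorem counit_polySec (p) : (poly R ξ).counit.f ((polySec ξ s).f p) = p := by
  refine poly_hom_ext (f := (poly R ξ).counit.f.comp (polySec ξ s).f) (g := AlgHom.id A _)
    (fun r => ?_) (fun x => ?_) p
  · refine (congrArg (poly R ξ).counit.f (polySec_C ξ s r)).trans ?_
    rw [counit_Tmap, hs]
    rfl
  · refine (congrArg (poly R ξ).counit.f (polySec_X ξ s x)).trans ?_
    rw [counit_X]
    rfl

/-- Modulo the submodule `E^{(R)}`, both terms are derivations of `R[σ]` that vanish on `R` and send
a variable `X` to the basis vector `[X]`. -/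
theorem dl_polySec (p) : (dl (poly R ξ)).D ((polySec ξ s).f p) -
    Finsupp.lmapDomain E E (polyX R ξ) ((polyD R ξ).D p) ∈
      LinearMap.range (Finsupp.lmapDomain E E (polyC R ξ).f) := by
  induction p using poly_induction with
  | C r =>
    rw [polySec_C, dl_Tmap _ (polyC R ξ).π_f, polyD_C, map_zero, sub_zero]
    exact ⟨_, rfl⟩
  | add p q hp hq =>
    rw [map_add, map_add, map_add, map_add, add_sub_add_comm]
    exact add_mem hp hq
  | mul p x hp =>
    rw [map_mul, (dl (poly R ξ)).leibniz, (polyD R ξ).leibniz, map_add, map_smul, map_smul,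
      polyD_X, lmap_single, (polySec ξ s).π_f, (polySec ξ s).π_f, polySec_X, dl_X,
      Finsupp.smul_single_one, add_sub_add_left_eq_sub, ← smul_sub]
    exact Submodule.smul_mem _ _ hp

theorem secEnd_polySec (k : (poly R ξ).C →₀ E) : secEnd (polySec ξ s) k -
    Finsupp.lmapDomain E E (polyX R ξ) ((polyD R ξ).lin k) ∈
      LinearMap.range (Finsupp.lmapDomain E E (polyC R ξ).f) := by
  induction k using Finsupp.induction_linear with
  | zero => simp
  | add k l hk hl =>
    rw [map_add, map_add, map_add, add_sub_add_comm]
    exact add_mem hk hl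
  | single p e =>
    rw [secEnd_single, lin_single, map_smul, ← smul_sub]
    exact Submodule.smul_mem _ _ (dl_polySec ξ s p)

theorem bmap_secEnd (j : R.C →₀ E) :
    bmap (polyC R ξ) 0 (secEnd s j) = secEnd (polySec ξ s) (bmap (polyC R ξ) 0 j) := by
  have h (r : R.C) (e : E) : bmap (polyC R ξ) 0 (secEnd s (Finsupp.single r e)) =
      secEnd (polySec ξ s) (bmap (polyC R ξ) 0 (Finsupp.single r e)) := by
    refine Eq.trans ?_ (congrArg (secEnd (polySec ξ s)) (bmap_single (polyC R ξ) 0 r e)).symm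
    refine Eq.trans ?_ (secEnd_single (polySec ξ s) ((polyC R ξ).f r) e).symm
    rw [polySec_C, dl_Tmap _ (polyC R ξ).π_f, secEnd_single]
    exact map_smul (bmap (polyC R ξ) 0) e _
  exact congrArg (fun f => f j) (Finsupp.lhom_ext
    (φ := (show (R.C →₀ E) →ₗ[E] ((poly R ξ).C →₀ E) from bmap (polyC R ξ) 0) ∘ₗ secEnd s)
    (ψ := secEnd (polySec ξ s) ∘ₗ
      (show (R.C →₀ E) →ₗ[E] ((poly R ξ).C →₀ E) from bmap (polyC R ξ) 0)) h)

/-- The map from the standard complex of `R` to that of `R[σ]`, augmented by `E^{(σ)}`. -/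
def polyMap (R : OverAlg A E) {σ : Type u} (ξ : σ → E) :
    Cx.Map (beta (Der.zero R)) (beta (polyD R ξ)) :=
  betaMap (polyC R ξ) (Der.zero R) (polyD R ξ) 0 (fun r => (polyD_C R ξ r).symm)

theorem polyMap_cone_surj : Function.Surjective ((Cx.cone (polyMap R ξ)).d 0) := by
  intro (y : σ →₀ E)
  let x : (poly R ξ).C →₀ E := Finsupp.lmapDomain E E (polyX R ξ) y
  refine ⟨show bX (poly R ξ) (σ →₀ E) 1 × PUnit.{u + 1} from (x, PUnit.unit), ?_⟩
  change (polyD R ξ).lin x + 0 = y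
  rw [add_zero]
  have : (polyD R ξ).lin ∘ₗ Finsupp.lmapDomain E E (polyX R ξ) = LinearMap.id := by
    refine Finsupp.lhom_ext fun s e => ?_
    rw [LinearMap.comp_apply, lmap_single, lin_single, polyD_X, LinearMap.id_apply]
    simp
  exact congrArg (fun f => f y) this

-- The section of `T R → R` extends to one for `R[σ]`, so both standard complexes are contracted
-- above degree `0`; what remains is to compare their degree `0` homology, by means of the
-- endomorphisms `secEnd`.
include hs in
theorem polyMap_cone_exact_of_section (n : ℕ) : (Cx.cone (polyMap R ξ)).Ex n := by
  have hs' := counit_polySec ξ s hs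
  match n with
  | 0 => exact polyMap_cone_surj ξ
  -- The homotopy replaces `k` by `secEnd k`, which lies in the image of `E^{(R)}` once the
  -- derivation of `R[σ]` kills `k`.
  | 1 =>
    rintro ⟨(k : (poly R ξ).C →₀ E), j⟩ h
    have hk : (polyD R ξ).lin k = 0 := (add_zero _).symm.trans h
    have h1 := bdiff_bsec_zero (polySec ξ s) hs' k
    obtain ⟨j', hj'⟩ := secEnd_polySec ξ s k
    rw [hk, map_zero, sub_zero] at hj'
    refine ⟨show bX (poly R ξ) (σ →₀ E) 2 × bX R PUnit.{u + 1} 1 from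
      (-(bsec (polySec ξ s) 0 k), j'), Prod.ext ?_ rfl⟩
    change bdiff (poly R ξ) 0 (-(bsec (polySec ξ s) 0 k)) + bmap (polyC R ξ) 0 j' = k
    rw [map_neg, h1]
    refine (congrArg (fun y => -(secEnd (polySec ξ s) k - k) + y) hj').trans ?_
    abel
  -- Here `j` bounds in `R[σ]`. Applying `secEnd`, which kills boundaries, and using that `E^{(R)} →
  -- E^{(R[σ])}` is injective gives `secEnd j = 0`, so `j` already bounds in `R`.
  | 2 =>
    rintro ⟨(k : (tw (poly R ξ) 1).C →₀ E), (j : R.C →₀ E)⟩ h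
    have hk : bdiff (poly R ξ) 0 k + bmap (polyC R ξ) 0 j = 0 := congrArg Prod.fst h
    have h1 : bmap (polyC R ξ) 0 (secEnd s j) = 0 := by
      rw [bmap_secEnd, eq_neg_of_add_eq_zero_right hk]
      refine (map_neg (secEnd (polySec ξ s)) _).trans ?_
      exact (congrArg Neg.neg (secEnd_bdiff (polySec ξ s) k)).trans neg_zero
    have hinj : Function.Injective (bmap (polyC R ξ) 0) :=
      Finsupp.mapDomain_injective (MvPolynomial.C_injective σ R.C)
    have h2 : secEnd s j = 0 := hinj (h1.trans (map_zero _).symm)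
    have h3 : bdiff R 0 (bsec s 0 j) = -j := by
      refine (bdiff_bsec_zero s hs j).trans ?_
      rw [h2]
      exact zero_sub _
    obtain ⟨k', hk'⟩ := bdiff_exact_of_section (polySec ξ s) hs' 0
      (k - bmap (polyC R ξ) 1 (bsec s 0 j)) (by
        rw [map_sub, ← bmap_bdiff, h3]
        refine (congrArg (bdiff (poly R ξ) 0 k - ·) (map_neg (bmap (polyC R ξ) 0) j)).trans ?_
        exact (sub_neg_eq_add _ _).trans hk)
    refine ⟨show bX (poly R ξ) (σ →₀ E) 3 × bX R PUnit.{u + 1} 2 from (k', bsec s 0 j),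
      Prod.ext ?_ ?_⟩
    · change bdiff (poly R ξ) 1 k' + bmap (polyC R ξ) 1 (bsec s 0 j) = k
      rw [hk', sub_add_cancel]
    · exact (congrArg Neg.neg h3).trans (neg_neg j)
  | n + 3 =>
    rintro ⟨(k : (tw (poly R ξ) (n + 2)).C →₀ E), (j : (tw R (n + 1)).C →₀ E)⟩ h
    have hk : bdiff (poly R ξ) (n + 1) k + bmap (polyC R ξ) (n + 1) j = 0 := congrArg Prod.fst h
    have hj : -(bdiff R n j) = 0 := congrArg Prod.snd h
    obtain ⟨j', hj'⟩ := bdiff_exact_of_section s hs n (-j) ((map_neg _ _).trans hj)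
    obtain ⟨k', hk'⟩ := bdiff_exact_of_section (polySec ξ s) hs' (n + 1)
      (k - bmap (polyC R ξ) (n + 2) j') (by
        rw [map_sub, ← bmap_bdiff, hj', map_neg, sub_neg_eq_add]
        exact hk)
    refine ⟨show bX (poly R ξ) (σ →₀ E) (n + 4) × bX R PUnit.{u + 1} (n + 3) from (k', j'),
      Prod.ext ?_ ?_⟩
    · change bdiff (poly R ξ) (n + 2) k' + bmap (polyC R ξ) (n + 2) j' = k
      rw [hk', sub_add_cancel]
    · change -(bdiff R (n + 1) j') = j
      rw [hj', neg_neg]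

end Section

/-- The section of `T (T R) → T R`. -/
def secT (R : OverAlg A E) : Hom R.T R.T.T := Thom R.X (fun _ => π_X _ _)

theorem counit_secT (R : OverAlg A E) (x) : R.T.counit.f ((secT R).f x) = x := by
  have : R.T.counit.f.comp (secT R).f = AlgHom.id A _ := T_hom_ext fun y => by
    refine (congrArg R.T.counit.f (Tmap_X (R := R) (S := R.T) R.X y)).trans ?_
    exact counit_X _ _
  exact congrArg (fun f => f x) this

/-- Functoriality of polynomial algebras in the coefficients. -/
def polyHom {R S : OverAlg A E} (f : Hom R S) {σ : Type u} (ξ : σ → E) :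
    Hom (poly R ξ) (poly S ξ) :=
  polyLift ((polyC S ξ).comp f) (polyX S ξ) (poly_π_X S ξ)

theorem polyHom_C {R S : OverAlg A E} (f : Hom R S) {σ : Type u} (ξ : σ → E) (r) :
    (polyHom f ξ).f ((polyC R ξ).f r) = (polyC S ξ).f (f.f r) := polyLift_C _ _ _ _

theorem polyHom_X {R S : OverAlg A E} (f : Hom R S) {σ : Type u} (ξ : σ → E) (s) :
    (polyHom f ξ).f (polyX R ξ s) = polyX S ξ s := polyLift_X _ _ _ _

theorem polyHom_apply {R S : OverAlg A E} (f : Hom R S) {σ : Type u} (ξ : σ → E) (p) :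
    (polyHom f ξ).f p = MvPolynomial.map f.f.toRingHom (show MvPolynomial σ R.C from p) := by
  refine poly_hom_ext (f := (polyHom f ξ).f)
    (g := (MvPolynomial.mapAlgHom f.f : MvPolynomial σ R.C →ₐ[A] (poly S ξ).C)) (fun r => ?_) (fun s => ?_) p
  · rw [polyHom_C]
    exact (MvPolynomial.map_C _ _).symm
  · rw [polyHom_X]
    exact (MvPolynomial.map_X _ _).symm

theorem polyD_polyHom {R S : OverAlg A E} (f : Hom R S) {σ : Type u} (ξ : σ → E) (p) :
    (polyD S ξ).D ((polyHom f ξ).f p) = (polyD R ξ).D p := by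
  rw [poly_chain (polyD S ξ) (polyHom f ξ) (fun r => by rw [polyHom_C]; exact polyD_C S ξ _)]
  have : (fun s => (polyD S ξ).D ((polyHom f ξ).f (polyX R ξ s))) = fun s => Finsupp.single s 1 :=
    funext fun s => by rw [polyHom_X]; exact polyD_X S ξ s
  rw [this]
  simp [Finsupp.linearCombination_apply]

/-- The standard resolution. -/
def stdSSA (R : OverAlg A E) : SSA A E := ⟨tw R, face R, face_face R⟩

/-- The contraction of the standard resolution. -/
def stdContr (R : OverAlg A E) : (stdSSA R).Contr where
  h n := (tw R n).X
  face_zero n x := by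
    refine (congrArg (fun f : Hom _ _ => f.f _) (face_zero R n)).trans ?_
    exact counit_X _ _
  face_succ n i x := Tmap_X _ _

/-- The polynomial algebras on the terms of the standard resolution. -/
def polySSA (R : OverAlg A E) {σ : Type u} (ξ : σ → E) : SSA A E where
  obj n := poly (tw R n) ξ
  face n i := polyHom (face R n i) ξ
  face_face n i j hij x := by
    refine poly_hom_ext (f := (polyHom (face R n i) ξ).f.comp (polyHom (face R (n + 1) j.succ) ξ).f)
      (g := (polyHom (face R n j) ξ).f.comp (polyHom (face R (n + 1) i.castSucc) ξ).f)
      (fun r => ?_) (fun s => ?_) x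
    · rw [AlgHom.comp_apply, AlgHom.comp_apply, polyHom_C, polyHom_C, polyHom_C, polyHom_C,
        face_face R n i j hij]
    · rw [AlgHom.comp_apply, AlgHom.comp_apply, polyHom_X, polyHom_X, polyHom_X, polyHom_X]

/-- The map of polynomials obtained by applying a map of sets to the coefficients. -/
def mapCoeff {R S σ : Type u} [CommRing R] [CommRing S] (g : R → S) (hg : g 0 = 0)
    (p : MvPolynomial σ R) : MvPolynomial σ S :=
  .ofCoeff <| Finsupp.mapRange g hg <| AddMonoidAlgebra.coeff p

/-- The contraction of the coefficients. -/
def polyContr (R : OverAlg A E) {σ : Type u} (ξ : σ → E) : (polySSA R ξ).Contr where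
  -- The contraction `x ↦ [x]` is corrected by `[0]` so that zero coefficients stay zero and the
  -- support stays finite.
  h n := mapCoeff (R := (tw R n).C) (S := (tw R (n + 1)).C)
    (fun x => (tw R n).X x - (tw R n).X 0) (sub_self _)
  face_zero n x := by
    refine (polyHom_apply (face R n 0) ξ _).trans ?_
    refine MvPolynomial.ext _ _ fun m => ?_
    rw [MvPolynomial.coeff_map]
    refine (map_sub (face R n 0).f _ _).trans ?_
    have h := (stdContr R).face_zero n
    exact (congrArg₂ (· - ·) (h _) (h _)).trans (sub_zero _)
  face_succ n i x := by
    refine (polyHom_apply (face R (n + 1) i.succ) ξ _).trans ?_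
    refine Eq.trans ?_ (congrArg _ (polyHom_apply (face R n i) ξ x).symm)
    refine MvPolynomial.ext _ _ fun m => ?_
    rw [MvPolynomial.coeff_map]
    refine (map_sub (face R (n + 1) i.succ).f _ _).trans ?_
    have h := (stdContr R).face_succ n i
    refine (congrArg₂ (· - ·) (h _) (h _)).trans ?_
    refine congrArg₂ (fun x y => (tw R n).X x - (tw R n).X y) ?_ (map_zero (face R n i).f)
    exact (MvPolynomial.coeff_map (face R n i).f.toRingHom _ m).symm

/-- The constant augmentation. -/
def polyAug (R : OverAlg A E) {σ : Type u} (ξ : σ → E) : (polySSA R ξ).Aug where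
  W := fun _ => (σ →₀ E)
  w n := ∑ i : Fin (n + 1), (-1 : ℤ) ^ (i : ℕ) • LinearMap.id
  ww n x := congrArg (fun f : (σ →₀ E) →ₗ[E] (σ →₀ E) => f x)
    (alternating_comp' n (fun _ => LinearMap.id) (fun _ => LinearMap.id) fun _ _ _ => rfl)
  D n := polyD (tw R n) ξ
  D_face n x := by
    rw [LinearMap.sum_apply]
    refine Finset.sum_congr rfl fun i _ => ?_
    rw [LinearMap.smul_apply, LinearMap.id_apply]
    exact congrArg _ (polyD_polyHom (face R n i) ξ x).symm

/-- The differentials are alternately the identity and zero, beginning with the identity; the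
identity map is a contraction of the faces. -/
theorem polyAug_col_exact (R : OverAlg A E) {σ : Type u} (ξ : σ → E) (n : ℕ) :
    ((polyAug R ξ).bicx.col 0).Ex n := by
  cases n with
  | zero =>
    intro (x : σ →₀ E)
    refine ⟨x, ?_⟩
    change (∑ i : Fin (0 + 1), (-1 : ℤ) ^ (i : ℕ) • (LinearMap.id : _ →ₗ[E] (σ →₀ E))) x = x
    simp
  | succ n =>
    intro (x : σ →₀ E) hx
    refine ⟨x, ?_⟩
    refine (alternating_contraction n (fun _ => LinearMap.id) (fun _ => LinearMap.id)
      (LinearMap.id : _ →ₗ[E] (σ →₀ E)) LinearMap.id (fun _ => rfl) (fun _ _ => rfl) x).trans ?_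
    refine (congrArg (fun y => x - y) hx).trans (sub_zero x)

/-- The standard complex of `R[σ]` is the sum of that of `R` and of `E^{(σ)}`. -/
theorem polyMap_cone_exact (R : OverAlg A E) {σ : Type u} (ξ : σ → E) (n : ℕ) :
    (Cx.cone (polyMap R ξ)).Ex n := by
  let F : (stdSSA R).Map (polySSA R ξ) :=
    ⟨fun n => polyC (tw R n) ξ, fun n i x => (polyHom_C (face R n i) ξ x).symm⟩
  -- The terms of positive index in the standard resolution are free algebras `T(T^q R)`, for which
  -- `[x] ↦ [[x]]` is a section of the evaluation; the previous case applies to them.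
  exact F.cone_exact (polyAug R ξ) (fun q (x : (tw R q).C) => polyD_C (tw R q) ξ x) (stdContr R) (polyContr R ξ)
    (fun q n => polyMap_cone_exact_of_section ξ (secT (tw R q)) (counit_secT (tw R q)) n) n
    (polyAug_col_exact R ξ n)

end OverAlg

end

end CotangentComplex

/-! ### Contractions from filling of spheres; the bar construction -/

namespace CotangentComplex

noncomputable section

variable {A E : Type u} [CommRing A] [CommRing E] [Algebra A E]

namespace OverAlg

/-- Extension of the contraction by one step, provided that compatible spheres can be filled. -/
def SSA.Fill (Q : SSA A E) : Prop :=
  Function.Surjective (Q.face 0 0).f ∧ ∀ n (y : Fin (n + 2) → (Q.obj (n + 1)).C),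
    (∀ i j : Fin (n + 1), i ≤ j → (Q.face n i).f (y j.succ) = (Q.face n j).f (y i.castSucc)) →
    ∃ z, ∀ i, (Q.face (n + 1) i).f z = y i

/-- The condition on a step of a contraction that allows its continuation. -/
def SSA.Good (Q : SSA A E) (n : ℕ) (h : (Q.obj n).C → (Q.obj (n + 1)).C) : Prop :=
  (∀ x, (Q.face n 0).f (h x) = x) ∧ ∀ (x : (Q.obj (n + 1)).C) (i j : Fin (n + 1)), i ≤ j →
    (Q.face n i).f (Fin.cases (motive := fun _ => (Q.obj (n + 1)).C) x
        (fun k => h ((Q.face n k).f x)) j.succ) =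
      (Q.face n j).f (Fin.cases (motive := fun _ => (Q.obj (n + 1)).C) x
        (fun k => h ((Q.face n k).f x)) i.castSucc)

/-- The family `x, h (d_0 x), h (d_1 x), …` is a compatible sphere, and a filler of it serves as the
next value of the contraction. The simplicial identities make the new step good again. -/
theorem SSA.Good.next {Q : SSA A E} (hQ : Q.Fill) {n : ℕ}
    {h : (Q.obj n).C → (Q.obj (n + 1)).C} (hh : Q.Good n h) :
    ∃ k : (Q.obj (n + 1)).C → (Q.obj (n + 2)).C, Q.Good (n + 1) k ∧
      ∀ i x, (Q.face (n + 1) (Fin.succ i)).f (k x) = h ((Q.face n i).f x) := by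
  have H (x : (Q.obj (n + 1)).C) := hQ.2 n (Fin.cases (motive := fun _ => (Q.obj (n + 1)).C) x
        (fun k => h ((Q.face n k).f x))) (hh.2 x)
  choose k hk using H
  have h0 (x) : (Q.face (n + 1) 0).f (k x) = x := hk x 0
  have hs (i : Fin (n + 1)) (x) : (Q.face (n + 1) i.succ).f (k x) = h ((Q.face n i).f x) :=
    hk x i.succ
  refine ⟨k, ⟨h0, fun x i j hij => ?_⟩, hs⟩
  simp only [Fin.cases_succ]
  induction i using Fin.cases with
  | zero => exact h0 _
  | succ i =>
    induction j using Fin.cases with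
    | zero => exact absurd hij (by simp)
    | succ j =>
      rw [← Fin.succ_castSucc, Fin.cases_succ, hs, hs,
        Q.face_face n i j (by simpa using hij)]

theorem SSA.Fill.contr {Q : SSA A E} (hQ : Q.Fill) : Nonempty Q.Contr := by
  obtain ⟨s, hs⟩ := hQ.1.hasRightInverse
  have good : Q.Good 0 s := by
    refine ⟨hs, fun x i j hij => ?_⟩
    obtain rfl : i = 0 := Subsingleton.elim (α := Fin 1) _ _
    obtain rfl : j = 0 := Subsingleton.elim (α := Fin 1) _ _
    exact hs _
  let c : ∀ n, {h // Q.Good n h} := fun n => Nat.rec (motive := fun n => {h // Q.Good n h})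
    ⟨s, good⟩ (fun n h => ⟨(h.2.next hQ).choose, (h.2.next hQ).choose_spec.1⟩) n
  exact ⟨⟨fun n => (c n).1, fun n => (c n).2.1, fun n i x =>
    ((c n).2.next hQ).choose_spec.2 i x⟩⟩

/-- The polynomial algebra in `q` variables mapping to zero in `E`. -/
abbrev bar (R : OverAlg A E) (q : ℕ) : OverAlg A E := poly R (0 : ULift.{u} (Fin q) → E)

/-- The inclusion of the coefficients. -/
def barC (R : OverAlg A E) (q : ℕ) : Hom R (bar R q) := polyC R _

/-- The sequence `a, X_1, …, X_q, 0, 0, …`. -/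
def barG (R : OverAlg A E) (a : R.C) (q : ℕ) : ℕ → (bar R q).C
  | 0 => (barC R q).f a
  | j + 1 => if h : j < q then polyX R _ ⟨⟨j, h⟩⟩ else 0

theorem barG_of_lt (R : OverAlg A E) (a : R.C) (q j : ℕ) (h : q < j) : barG R a q j = 0 := by
  cases j with
  | zero => simp at h
  | succ j => exact dif_neg (by omega)

theorem barG_X (R : OverAlg A E) (a : R.C) (q : ℕ) (k : ULift.{u} (Fin q)) :
    barG R a q (k.down + 1) = polyX R (0 : ULift.{u} (Fin q) → E) k := dif_pos k.down.2

theorem π_barG (R : OverAlg A E) (a : R.C) (ha : R.π a = 0) (q j : ℕ) :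
    (bar R q).π (barG R a q j) = 0 := by
  cases j with
  | zero => exact ((barC R q).π_f a).trans ha
  | succ j =>
    by_cases h : j < q
    · rw [barG, dif_pos h]
      exact poly_π_X R _ _
    · rw [barG, dif_neg h, map_zero]

/-- The map of bar algebras that changes the variables according to a map of indices. -/
def barHom (R : OverAlg A E) (a : R.C) (ha : R.π a = 0) (q r : ℕ) (c : ℕ → ℕ) :
    Hom (bar R q) (bar R r) :=
  polyLift (barC R r) (fun k => barG R a r (c (k.down + 1))) (fun _ => π_barG R a ha r _)

theorem barHom_C (R : OverAlg A E) (a : R.C) (ha : R.π a = 0) (q r : ℕ) (c : ℕ → ℕ) (x : R.C) :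
    (barHom R a ha q r c).f ((barC R q).f x) = (barC R r).f x := polyLift_C _ _ _ _

theorem barHom_G (R : OverAlg A E) (a : R.C) (ha : R.π a = 0) (q r : ℕ) (c : ℕ → ℕ)
    (hc : c 0 = 0) (hc' : ∀ j, q < j → r < c j) (j : ℕ) :
    (barHom R a ha q r c).f (barG R a q j) = barG R a r (c j) := by
  cases j with
  | zero =>
    rw [hc]
    exact barHom_C R a ha q r c a
  | succ j =>
    by_cases h : j < q
    · rw [barG, dif_pos h]
      exact polyLift_X _ _ _ _
    · rw [barG_of_lt R a q _ (by omega), map_zero, barG_of_lt R a r _ (hc' _ (by omega))]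

theorem bar_hom_ext {R : OverAlg A E} {a : R.C} {q : ℕ} {S : Type u} [CommRing S]
    [Algebra A S] {f g : (bar R q).C →ₐ[A] S} (hC : ∀ r, f ((barC R q).f r) = g ((barC R q).f r))
    (hX : ∀ j, f (barG R a q j) = g (barG R a q j)) (p) : f p = g p :=
  poly_hom_ext hC (fun k => by rw [← barG_X R a q k]; exact hX _) p

/-- The indices of the face `i` of the bar construction. -/
def barIdx (i j : ℕ) : ℕ := if i < j then j - 1 else j

/-- The indices of a section of the face `i` of the bar construction. -/
def barSecIdx (q i j : ℕ) : ℕ := if j ≤ i ∧ j ≤ q then j else j + 1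

/-- The faces of the bar construction. -/
def barFace (R : OverAlg A E) (a : R.C) (ha : R.π a = 0) (q : ℕ) (i : Fin (q + 2)) :
    Hom (bar R (q + 1)) (bar R q) := barHom R a ha (q + 1) q (barIdx i)

theorem barFace_G (R : OverAlg A E) (a : R.C) (ha : R.π a = 0) (q : ℕ) (i : Fin (q + 2)) (j : ℕ) :
    (barFace R a ha q i).f (barG R a (q + 1) j) = barG R a q (barIdx i j) := by
  refine barHom_G R a ha _ _ _ (by simp [barIdx]) (fun j hj => ?_) j
  rw [barIdx, if_pos (by omega)]
  omega

theorem barFace_C (R : OverAlg A E) (a : R.C) (ha : R.π a = 0) (q : ℕ) (i : Fin (q + 2)) (x : R.C) :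
    (barFace R a ha q i).f ((barC R (q + 1)).f x) = (barC R q).f x := barHom_C _ _ _ _ _ _ _

/-- A section of a face of the bar construction. -/
def barSec (R : OverAlg A E) (a : R.C) (ha : R.π a = 0) (q i : ℕ) :
    Hom (bar R q) (bar R (q + 1)) := barHom R a ha q (q + 1) (barSecIdx q i)

theorem barSec_G (R : OverAlg A E) (a : R.C) (ha : R.π a = 0) (q i : ℕ) (j : ℕ) :
    (barSec R a ha q i).f (barG R a q j) = barG R a (q + 1) (barSecIdx q i j) := by
  refine barHom_G R a ha _ _ _ (by simp [barSecIdx]) (fun j hj => ?_) j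
  rw [barSecIdx, if_neg (by omega)]
  omega

theorem barFace_face (R : OverAlg A E) (a : R.C) (ha : R.π a = 0) (q : ℕ) (i j : Fin (q + 2))
    (hij : i ≤ j) (x) : (barFace R a ha q i).f ((barFace R a ha (q + 1) j.succ).f x) =
      (barFace R a ha q j).f ((barFace R a ha (q + 1) i.castSucc).f x) := by
  refine bar_hom_ext (a := a)
    (f := (barFace R a ha q i).f.comp (barFace R a ha (q + 1) j.succ).f)
    (g := (barFace R a ha q j).f.comp (barFace R a ha (q + 1) i.castSucc).f)
    (fun r => ?_) (fun k => ?_) x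
  · simp only [AlgHom.comp_apply, barFace_C]
  · simp only [AlgHom.comp_apply, barFace_G]
    congr 1
    have : (i : ℕ) ≤ j := hij
    simp only [barIdx, Fin.val_succ, Fin.val_castSucc]
    split_ifs <;> omega

/-- The element `u_i = g_i - g_(i+1)` generating the kernel of a face. -/
def barU (R : OverAlg A E) (a : R.C) (q i : ℕ) : (bar R q).C := barG R a q i - barG R a q (i + 1)

theorem barFace_surjective (R : OverAlg A E) (a : R.C) (ha : R.π a = 0) (q : ℕ) (i : Fin (q + 2)) :
    Function.Surjective (barFace R a ha q i).f := by
  refine fun x => ⟨(barSec R a ha q i).f x, ?_⟩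
  refine bar_hom_ext (a := a) (f := (barFace R a ha q i).f.comp (barSec R a ha q i).f)
    (g := AlgHom.id A _) (fun r => ?_) (fun k => ?_) x
  · exact (congrArg (barFace R a ha q i).f (barHom_C R a ha _ _ _ r)).trans (barFace_C R a ha q i r)
  · simp only [AlgHom.comp_apply, barSec_G, barFace_G, AlgHom.id_apply]
    by_cases hk : q < k
    · rw [barG_of_lt R a q k hk, barG_of_lt]
      simp only [barIdx, barSecIdx]
      split_ifs <;> omega
    · congr 1
      simp only [barIdx, barSecIdx]
      split_ifs <;> omega

/-- Face `i` identifies `g_i` with `g_{i+1}`. Modulo `u_i = g_i - g_{i+1}`, the face followed by its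
section is the identity on the coefficients and on every `g_k`, hence everywhere; an element killed
by the face is therefore zero modulo `u_i`. -/
theorem barFace_ker (R : OverAlg A E) (a : R.C) (ha : R.π a = 0) (q : ℕ) (i : Fin (q + 2))
    (x) (hx : (barFace R a ha q i).f x = 0) : barU R a (q + 1) i ∣ x := by
  rw [← Ideal.mem_span_singleton, ← Ideal.Quotient.eq_zero_iff_mem]
  have h := bar_hom_ext (a := a)
    (f := (Ideal.Quotient.mkₐ A (Ideal.span {barU R a (q + 1) i})).comp
      ((barSec R a ha q i).f.comp (barFace R a ha q i).f))
    (g := Ideal.Quotient.mkₐ A (Ideal.span {barU R a (q + 1) i})) (fun r => ?_) (fun k => ?_) x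
  · refine h.symm.trans ?_
    rw [AlgHom.comp_apply, AlgHom.comp_apply, hx, map_zero, map_zero]
  · rw [AlgHom.comp_apply, AlgHom.comp_apply, barFace_C]
    exact congrArg _ (barHom_C _ _ _ _ _ _ _)
  · rw [AlgHom.comp_apply, AlgHom.comp_apply, barFace_G, barSec_G]
    refine Ideal.Quotient.eq.mpr (Ideal.mem_span_singleton.mpr ?_)
    by_cases h1 : k = i
    · have : barSecIdx q i (barIdx i k) = i + 1 ∨ barSecIdx q i (barIdx i k) = k := by
        subst h1
        simp only [barIdx, barSecIdx]
        split_ifs <;> omega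
      obtain h | h := this
      · rw [h, h1, barU, ← neg_sub, neg_dvd]
      · rw [h, sub_self]
        exact dvd_zero _
    · by_cases h2 : k = i + 1
      · have : barSecIdx q i (barIdx i k) = i ∨ barSecIdx q i (barIdx i k) = i + 1 := by
          subst h2
          simp only [barIdx, barSecIdx]
          split_ifs <;> omega
        obtain h | h := this
        · rw [h, h2, barU]
        · rw [h, h2, sub_self]
          exact dvd_zero _
      · by_cases hk : q + 1 < k
        · rw [barG_of_lt R a _ k hk, barG_of_lt, sub_zero]
          · exact dvd_zero _
          · simp only [barIdx, barSecIdx]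
            split_ifs <;> omega
        · have : barSecIdx q i (barIdx i k) = k := by
            simp only [barIdx, barSecIdx]
            split_ifs <;> omega
          rw [this, sub_self]
          exact dvd_zero _

end OverAlg

end

end CotangentComplex

/-! ### The bar construction resolves the quotient by a nonzerodivisor -/

namespace CotangentComplex

noncomputable section

variable {A E : Type u} [CommRing A] [CommRing E] [Algebra A E]

namespace OverAlg

open scoped nonZeroDivisors

/-- The translation of a variable of a bar algebra by a multiple of the preceding one. -/
def barShift (R : OverAlg A E) (a : R.C) (ha : R.π a = 0) (q i : ℕ) (e : A) :
    Hom (bar R q) (bar R q) :=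
  polyLift (barC R q)
    (fun k => barG R a q (k.down + 1) + if k.down = i then e • barG R a q i else 0)
    (fun k => by
      rw [map_add, π_barG R a ha, zero_add]
      split_ifs
      · rw [map_smul, π_barG R a ha, smul_zero]
        rfl
      · exact map_zero _)

theorem barShift_G (R : OverAlg A E) (a : R.C) (ha : R.π a = 0) (q i : ℕ) (hi : i < q) (e : A)
    (j : ℕ) : (barShift R a ha q i e).f (barG R a q j) =
      barG R a q j + if j = i + 1 then e • barG R a q i else 0 := by
  cases j with
  | zero =>
    rw [if_neg (by omega), add_zero]
    exact polyLift_C _ _ _ _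
  | succ j =>
    by_cases hj : j < q
    · rw [barG, dif_pos hj]
      refine (polyLift_X _ _ _ _).trans ?_
      simp [barG, hj]
    · rw [barG_of_lt R a q (j + 1) (by omega), map_zero, if_neg (by omega), add_zero]

theorem barShift_C (R : OverAlg A E) (a : R.C) (ha : R.π a = 0) (q i : ℕ) (e : A) (r : R.C) :
    (barShift R a ha q i e).f ((barC R q).f r) = (barC R q).f r := polyLift_C _ _ _ _

theorem barShift_shift (R : OverAlg A E) (a : R.C) (ha : R.π a = 0) (q i : ℕ) (hi : i < q) (e : A)
    (x) : (barShift R a ha q i (-e)).f ((barShift R a ha q i e).f x) = x := by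
  refine bar_hom_ext (a := a) (f := (barShift R a ha q i (-e)).f.comp (barShift R a ha q i e).f)
    (g := AlgHom.id A _) (fun r => ?_) (fun k => ?_) x
  · rw [AlgHom.comp_apply, barShift_C, barShift_C, AlgHom.id_apply]
  · rw [AlgHom.comp_apply, barShift_G R a ha q i hi, map_add, barShift_G R a ha q i hi,
      AlgHom.id_apply]
    by_cases h : k = i + 1
    · rw [if_pos h, if_pos h, map_smul, barShift_G R a ha q i hi, if_neg (by omega)]
      simp
    · rw [if_neg h, if_neg h, map_zero]
      simp

/-- For `i < q` the automorphism `X_{i+1} ↦ X_{i+1} + g_i` carries `u_i` to `-X_{i+1}`. For `i = q`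
the successor `g_{q+1}` is zero, so `u_q` is a variable, or `a` itself when `q = 0`. -/
theorem barU_mem (R : OverAlg A E) (a : R.C) (ha : R.π a = 0) (ha' : a ∈ R.C⁰) (q i : ℕ)
    (hi : i ≤ q) : barU R a q i ∈ (bar R q).C⁰ := by
  have hX (j : ℕ) (hj : j < q) : barG R a q (j + 1) ∈ (bar R q).C⁰ := by
    rw [barG, dif_pos hj]
    have h : IsRegular (MvPolynomial.X ⟨⟨j, hj⟩⟩ : MvPolynomial (ULift.{u} (Fin q)) R.C) :=
      MvPolynomial.isRegular_X
    exact h.mem_nonZeroDivisors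
  obtain rfl | hi := hi.eq_or_lt
  · rw [barU, barG_of_lt R a i (i + 1) (by omega), sub_zero]
    cases i with
    | zero =>
      rw [mem_nonZeroDivisors_iff_left]
      intro (x : MvPolynomial (ULift.{u} (Fin 0)) R.C) hx
      refine MvPolynomial.ext _ _ fun m => ?_
      have h : MvPolynomial.C a * x = 0 := hx
      have := congrArg (MvPolynomial.coeff m) h
      rw [MvPolynomial.coeff_C_mul, MvPolynomial.coeff_zero] at this
      rw [mem_nonZeroDivisors_iff_left] at ha'
      exact ha' _ this
    | succ j => exact hX j (by omega)
  · rw [mem_nonZeroDivisors_iff_left]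
    intro x hx
    have h := congrArg (barShift R a ha q i 1).f hx
    rw [map_mul, map_zero, barU, map_sub, barShift_G R a ha q i hi, barShift_G R a ha q i hi,
      if_neg (by omega), if_pos rfl, one_smul, add_zero, sub_add_cancel_right, neg_mul,
      neg_eq_zero] at h
    have h' := (mem_nonZeroDivisors_iff_left.mp (hX i hi)) _ h
    rw [← barShift_shift R a ha q i hi 1 x, h', map_zero]

/-- The augmentation of the bar construction. -/
def barAugment {R S : OverAlg A E} (g : Hom R S) : Hom (bar R 0) S :=
  polyLift g (fun k => k.down.elim0) (fun k => k.down.elim0)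

theorem barAugment_C {R S : OverAlg A E} (g : Hom R S) (r : R.C) :
    (barAugment g).f ((barC R 0).f r) = g.f r := polyLift_C _ _ _ _

theorem barAugment_G {R S : OverAlg A E} (g : Hom R S) (a : R.C) (hg : g.f a = 0) (j : ℕ) :
    (barAugment g).f (barG R a 0 j) = 0 := by
  cases j with
  | zero => exact (barAugment_C g a).trans hg
  | succ j => rw [barG_of_lt R a 0 _ (by omega), map_zero]

/-- The terms of the bar construction. -/
def barObj (R S : OverAlg A E) : ℕ → OverAlg A E
  | 0 => S
  | q + 1 => bar R q

variable {R S : OverAlg A E} (g : Hom R S) (a : R.C) (hg : g.f a = 0)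

/-- The faces of the bar construction, including the augmentation. -/
def barSSAFace (ha : R.π a = 0) : ∀ q, Fin (q + 1) → Hom (barObj R S (q + 1)) (barObj R S q)
  | 0, _ => barAugment g
  | q + 1, i => barFace R a ha q i

theorem π_eq_zero_of_hom {R S : OverAlg A E} (g : Hom R S) {a : R.C} (hg : g.f a = 0) :
    R.π a = 0 := by
  rw [← g.π_f, hg, map_zero]

/-- The bar resolution of `R/a`. -/
def barSSA : SSA A E where
  obj := barObj R S
  face := barSSAFace g a (π_eq_zero_of_hom g hg)
  face_face n i j hij x := by
    cases n with
    | zero =>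
      have ha := π_eq_zero_of_hom g hg
      refine bar_hom_ext (a := a)
        (f := (barAugment g).f.comp (barFace R a ha 0 j.succ).f)
        (g := (barAugment g).f.comp (barFace R a ha 0 i.castSucc).f)
        (fun r => ?_) (fun k => ?_) x
      · simp only [AlgHom.comp_apply, barFace_C]
      · simp only [AlgHom.comp_apply, barFace_G, barAugment_G g a hg]
    | succ n => exact barFace_face R a (π_eq_zero_of_hom g hg) n i j hij x

/-- Write `x = u_0 ⋯ u_{k-1} t`. Face `k` sends each of these `u_l` to the `u_l` one level below, a
nonzerodivisor, so it kills `t`, and `u_k` divides `t`. -/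
theorem bar_dvd (hker : ∀ x, g.f x = 0 → a ∣ x) (ha' : a ∈ R.C⁰) (n : ℕ) (x : (bar R n).C) (k : ℕ)
    (hk : k ≤ n + 1) (hx : ∀ i : Fin (n + 1), (i : ℕ) < k → ((barSSA g a hg).face n i).f x = 0) :
    ∏ l ∈ Finset.range k, barU R a n l ∣ x := by
  have ha := π_eq_zero_of_hom g hg
  induction k with
  | zero => simp
  | succ k ih =>
    obtain ⟨t, ht⟩ := ih (by omega) (fun i hi => hx i (by omega))
    rw [Finset.prod_range_succ]
    suffices h : barU R a n k ∣ t by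
      rw [ht]
      exact mul_dvd_mul_left _ h
    have hxk := hx ⟨k, by omega⟩ (by simp)
    cases n with
    -- At level `0` there are no variables: the algebra is `R`, its only face is `g`, and `u_0 = a`
    -- generates the kernel.
    | zero =>
      obtain rfl : k = 0 := by omega
      rw [Finset.prod_range_zero, one_mul] at ht
      subst ht
      obtain ⟨r, hr⟩ := MvPolynomial.C_surjective (R := R.C) (ULift.{u} (Fin 0))
        (show MvPolynomial (ULift.{u} (Fin 0)) R.C from x)
      obtain rfl : (barC R 0).f r = x := hr
      obtain ⟨b, rfl⟩ := hker r ((barAugment_C g r).symm.trans hxk)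
      rw [map_mul, barU, barG_of_lt R a 0 (0 + 1) (by omega), sub_zero]
      exact dvd_mul_right _ _
    | succ n =>
      have h : (barFace R a ha n ⟨k, by omega⟩).f x = 0 := hxk
      rw [ht, map_mul, map_prod] at h
      refine barFace_ker R a ha n ⟨k, by omega⟩ t
        ((mem_nonZeroDivisors_iff_left.mp (prod_mem fun l hl => ?_)) _ h)
      have hl := Finset.mem_range.mp hl
      have : (barFace R a ha n ⟨k, by omega⟩).f (barU R a (n + 1) l) = barU R a n l := by
        rw [barU, map_sub, barFace_G, barFace_G, barIdx, barIdx, if_neg (by simp; omega),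
          if_neg (by simp; omega), barU]
      rw [this]
      exact barU_mem R a ha ha' n l (by omega)

/-- The faces are prescribed one at a time, starting from face `0`. Each correction is a multiple of
`u_0 ⋯ u_{k-1}`, so it does not disturb the faces already arranged. -/
theorem barSSA_fill (hsurj : Function.Surjective g.f) (hker : ∀ x, g.f x = 0 → a ∣ x)
    (ha' : a ∈ R.C⁰) : (barSSA g a hg).Fill := by
  have ha := π_eq_zero_of_hom g hg
  refine ⟨fun x => ?_, fun n (y : Fin (n + 2) → (bar R n).C) hy => ?_⟩
  · obtain ⟨r, rfl⟩ := hsurj x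
    exact ⟨(barC R 0).f r, barAugment_C g r⟩
  · have key (k : ℕ) (hk : k ≤ n + 2) : ∃ z : (bar R (n + 1)).C,
        ∀ i : Fin (n + 2), (i : ℕ) < k → (barFace R a ha n i).f z = y i := by
      induction k with
      | zero => exact ⟨0, fun i hi => absurd hi (by omega)⟩
      | succ k ih =>
        obtain ⟨z, hz⟩ := ih (by omega)
        let κ : Fin (n + 2) := ⟨k, by omega⟩
        -- The defect at face `k` is killed by all earlier faces, because the sphere is compatible
        -- and `z` already has the right earlier faces; hence it is divisible by `u_0 ⋯ u_{k-1}`.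
        obtain ⟨v, hv⟩ := bar_dvd g a hg hker ha' n (y κ - (barFace R a ha n κ).f z) k (by omega)
          (fun i hi => by
            obtain ⟨m, rfl⟩ : ∃ m, k = m + 1 := ⟨k - 1, by omega⟩
            let μ : Fin (n + 1) := ⟨m, by omega⟩
            have hle : i ≤ μ := by
              rw [Fin.le_def]
              change (i : ℕ) ≤ m
              omega
            refine (map_sub ((barSSA g a hg).face n i).f (y κ)
              ((barFace R a ha n κ).f z)).trans (sub_eq_zero.mpr ?_)
            refine (hy i μ hle).trans ?_
            refine Eq.trans ?_ ((barSSA g a hg).face_face n i μ hle z).symm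
            exact congrArg ((barSSA g a hg).face n μ).f (hz i.castSucc hi).symm)
        obtain ⟨v', rfl⟩ := barFace_surjective R a ha n κ v
        refine ⟨z + (∏ l ∈ Finset.range k, barU R a (n + 1) l) * v', fun i hi => ?_⟩
        rw [map_add, map_mul, map_prod]
        by_cases hik : (i : ℕ) < k
        · have : (barFace R a ha n i).f (barU R a (n + 1) i) = 0 := by
            rw [barU, map_sub, barFace_G, barFace_G, barIdx, barIdx, if_neg (by omega),
              if_pos (by omega), Nat.add_sub_cancel, sub_self]
          rw [Finset.prod_eq_zero (Finset.mem_range.mpr hik) this, zero_mul, add_zero]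
          exact hz i hik
        · obtain rfl : i = κ := Fin.ext (by change (i : ℕ) = k; omega)
          have : ∏ l ∈ Finset.range k, (barFace R a ha n κ).f (barU R a (n + 1) l) =
              ∏ l ∈ Finset.range k, barU R a n l := Finset.prod_congr rfl fun l hl => by
            have hl := Finset.mem_range.mp hl
            have hκ : (κ : ℕ) = k := rfl
            rw [barU, map_sub, barFace_G, barFace_G, barIdx, barIdx, if_neg (by omega),
              if_neg (by omega), barU]
          rw [this, ← hv, add_sub_cancel]
    obtain ⟨z, hz⟩ := key (n + 2) le_rfl
    exact ⟨z, fun i => hz i i.2⟩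

end OverAlg

end

end CotangentComplex

/-! ### The linearized bar construction and the quotient `R/a` -/

namespace CotangentComplex

noncomputable section

variable {A E : Type u} [CommRing A] [CommRing E] [Algebra A E]

namespace OverAlg

/-- The derivation of a bar algebra. -/
abbrev barD (R : OverAlg A E) (q : ℕ) : Der (bar R q) (ULift.{u} (Fin q) →₀ E) := polyD R _

/-- The differential of `g_j`. -/
def barE (E : Type u) [CommRing E] (q : ℕ) : ℕ → (ULift.{u} (Fin q) →₀ E)
  | 0 => 0
  | j + 1 => if h : j < q then Finsupp.single ⟨⟨j, h⟩⟩ 1 else 0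

theorem barD_G (R : OverAlg A E) (a : R.C) (q j : ℕ) :
    (barD R q).D (barG R a q j) = barE E q j := by
  cases j with
  | zero => exact polyD_C R _ a
  | succ j =>
    by_cases hj : j < q
    · rw [barG, dif_pos hj, barE, dif_pos hj]
      exact polyD_X R _ _
    · rw [barG, dif_neg hj, barE, dif_neg hj, map_zero]

theorem barE_of_lt (q j : ℕ) (h : q < j) : barE E q j = 0 := by
  cases j with
  | zero => simp at h
  | succ j => exact dif_neg (by omega)

theorem barE_single (q : ℕ) (k : ULift.{u} (Fin q)) :
    barE E q (k.down + 1) = Finsupp.single k 1 := dif_pos k.down.2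

theorem barE_ext {q : ℕ} {M : Type u} [AddCommGroup M] [Module E M]
    {f g : (ULift.{u} (Fin q) →₀ E) →ₗ[E] M} (h : ∀ j, j < q → f (barE E q (j + 1)) = g (barE E q (j + 1)))
    (x) : f x = g x := by
  have : f = g := Finsupp.lhom_ext fun k e => by
    have := h k.down k.down.2
    rw [barE_single] at this
    rw [← mul_one e, ← smul_eq_mul, ← Finsupp.smul_single, map_smul, map_smul, this]
  rw [this]

/-- The linear map changing the indices of the basis. -/
def barLin (E : Type u) [CommRing E] (q r : ℕ) (c : ℕ → ℕ) :
    (ULift.{u} (Fin q) →₀ E) →ₗ[E] (ULift.{u} (Fin r) →₀ E) :=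
  Finsupp.linearCombination E (fun k => barE E r (c (k.down + 1)))

theorem barLin_E (q r : ℕ) (c : ℕ → ℕ) (hc : c 0 = 0) (hc' : ∀ j, q < j → r < c j) (j : ℕ) :
    barLin E q r c (barE E q j) = barE E r (c j) := by
  cases j with
  | zero =>
    rw [hc]
    exact map_zero _
  | succ j =>
    by_cases h : j < q
    · rw [barE, dif_pos h, barLin, Finsupp.linearCombination_single, one_smul]
    · rw [barE_of_lt q _ (by omega), map_zero, barE_of_lt r _ (hc' _ (by omega))]

/-- The faces of the linearized bar construction. -/
def barLinFace (E : Type u) [CommRing E] (q : ℕ) (i : Fin (q + 2)) :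
    (ULift.{u} (Fin (q + 1)) →₀ E) →ₗ[E] (ULift.{u} (Fin q) →₀ E) :=
  barLin E (q + 1) q (barIdx i)

theorem barLinFace_E (q : ℕ) (i : Fin (q + 2)) (j : ℕ) :
    barLinFace E q i (barE E (q + 1) j) = barE E q (barIdx i j) := by
  refine barLin_E _ _ _ (by simp [barIdx]) (fun j hj => ?_) j
  rw [barIdx, if_pos (by omega)]
  omega

theorem barLinFace_face (q : ℕ) (i j : Fin (q + 2)) (hij : i ≤ j) :
    barLinFace E q i ∘ₗ barLinFace E (q + 1) j.succ =
      barLinFace E q j ∘ₗ barLinFace E (q + 1) i.castSucc := by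
  refine LinearMap.ext fun x => barE_ext (fun k _ => ?_) x
  simp only [LinearMap.comp_apply, barLinFace_E]
  congr 1
  have : (i : ℕ) ≤ j := hij
  simp only [barIdx, Fin.val_succ, Fin.val_castSucc]
  split_ifs <;> omega

theorem barD_face (R : OverAlg A E) (a : R.C) (ha : R.π a = 0) (q : ℕ) (i : Fin (q + 2)) (x) :
    (barD R q).D ((barFace R a ha q i).f x) = barLinFace E q i ((barD R (q + 1)).D x) := by
  rw [poly_chain (barD R q) (barFace R a ha q i) (fun r =>
    (congrArg (barD R q).D (barFace_C R a ha q i r)).trans (polyD_C R _ r)), barLinFace, barLin]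
  congr 2
  funext k
  rw [← barG_X R a, barFace_G, barD_G]

/-- The differentials of the linearized bar construction. -/
def barDiff (E : Type u) [CommRing E] (q : ℕ) :
    (ULift.{u} (Fin (q + 1)) →₀ E) →ₗ[E] (ULift.{u} (Fin q) →₀ E) :=
  ∑ i : Fin (q + 2), (-1 : ℤ) ^ (i : ℕ) • barLinFace E q i

theorem barDiff_D (R : OverAlg A E) (a : R.C) (ha : R.π a = 0) (q : ℕ) (x) :
    barDiff E q ((barD R (q + 1)).D x) =
      ∑ i : Fin (q + 2), (-1 : ℤ) ^ (i : ℕ) • (barD R q).D ((barFace R a ha q i).f x) := by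
  simp only [barDiff, LinearMap.sum_apply, LinearMap.smul_apply, barD_face]

theorem barDiff_diff (q : ℕ) (x) : barDiff E q (barDiff E (q + 1) x) = 0 :=
  congrArg (fun f => f x) (alternating_comp' (q + 1) (barLinFace E q) (barLinFace E (q + 1))
    (barLinFace_face q))

/-- The shift of the variables of the linearized bar construction. -/
def barLinShift (E : Type u) [CommRing E] (q : ℕ) :
    (ULift.{u} (Fin q) →₀ E) →ₗ[E] (ULift.{u} (Fin (q + 1)) →₀ E) :=
  barLin E q (q + 1) (fun j => if j = 0 then 0 else j + 1)

theorem barLinShift_E (q j : ℕ) : barLinShift E q (barE E q (j + 1)) = barE E (q + 1) (j + 2) := by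
  refine (barLin_E q (q + 1) _ (by simp) (fun j hj => ?_) (j + 1)).trans (by simp)
  rw [if_neg (by omega)]
  omega

/-- The shift `e_j ↦ e_{j+1}` would contract the complex if it could send `e_0` to `e_1`; but `e_0 =
da = 0`. The formula therefore fails exactly by the coefficient of `e_1`, which is `x ⟨0⟩`. -/
theorem barDiff_shift (q : ℕ) (x : ULift.{u} (Fin (q + 1)) →₀ E) :
    barDiff E (q + 1) (barLinShift E (q + 1) x) + barLinShift E q (barDiff E q x) =
      x - x ⟨0⟩ • barE E (q + 1) 1 := by
  have key := barE_ext (E := E) (q := q + 1)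
    (f := barDiff E (q + 1) ∘ₗ barLinShift E (q + 1) + barLinShift E q ∘ₗ barDiff E q)
    (g := LinearMap.id - (Finsupp.lapply ⟨0⟩).smulRight (barE E (q + 1) 1)) (fun j hj => ?_) x
  · exact key
  · rw [LinearMap.add_apply, LinearMap.comp_apply, LinearMap.comp_apply, barLinShift_E,
      LinearMap.sub_apply, LinearMap.id_apply, LinearMap.smulRight_apply]
    simp only [barDiff, LinearMap.sum_apply, LinearMap.smul_apply, map_sum, map_zsmul]
    rw [Fin.sum_univ_succ, add_assoc, ← Finset.sum_add_distrib, sub_eq_add_neg]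
    congr 1
    · rw [Fin.val_zero, pow_zero, one_smul, barLinFace_E]
      rfl
    · have (i : Fin (q + 2)) : (-1 : ℤ) ^ (i.succ : ℕ) • barLinFace E (q + 1) i.succ
            (barE E (q + 2) (j + 2)) + (-1 : ℤ) ^ (i : ℕ) • barLinShift E q (barLinFace E q i
            (barE E (q + 1) (j + 1))) = if j = 0 ∧ i = 0 then - barE E (q + 1) 1 else 0 := by
        rw [barLinFace_E, barLinFace_E, Fin.val_succ, pow_succ, mul_neg_one, neg_smul,
          neg_add_eq_sub, barIdx, barIdx]
        by_cases hi : (i : ℕ) < j + 1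
        · rw [if_pos hi, if_pos (by omega)]
          cases j with
          | zero =>
            have h0 : i = 0 := Fin.ext (by simpa using hi)
            subst h0
            rw [if_pos ⟨rfl, rfl⟩, Fin.val_zero, pow_zero, one_smul, one_smul, Nat.add_sub_cancel]
            refine (congrArg (· - _) (map_zero (barLinShift E q))).trans (zero_sub _)
          | succ j =>
            rw [if_neg (by omega), Nat.add_sub_cancel, barLinShift_E]
            exact sub_self _
        · have h0 : ¬(j = 0 ∧ i = 0) := fun h => hi (by rw [h.2]; simp)
          rw [if_neg hi, if_neg (by omega), if_neg h0, barLinShift_E]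
          exact sub_self _
      rw [Finset.sum_congr rfl fun i _ => this i]
      cases j with
      | zero =>
        rw [Finset.sum_eq_single 0 (fun i _ hi => if_neg (fun h => hi h.2)) (by simp),
          if_pos ⟨rfl, rfl⟩]
        simp [barE]
      | succ j =>
        rw [Finset.sum_eq_zero fun i _ => if_neg (by omega)]
        rw [Finsupp.lapply_apply, barE, dif_pos hj, Finsupp.single_eq_of_ne (by simp), zero_smul,
          neg_zero]

/-- Face `0` sends `e_1` to `e_0 = 0`, the other `q + 2` faces fix it, and their signs are summed.
-/
theorem barDiff_E_one (q : ℕ) :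
    barDiff E (q + 1) (barE E (q + 2) 1) = (if Even q then 0 else -1 : E) • barE E (q + 1) 1 := by
  have h (n : ℕ) : ∑ i : Fin n, (-1 : ℤ) ^ (i.succ : ℕ) = if Even n then 0 else -1 := by
    refine (Fin.sum_univ_eq_sum_range (fun i => (-1 : ℤ) ^ (i + 1)) n).trans ?_
    induction n with
    | zero => simp
    | succ n ih =>
      rw [Finset.sum_range_succ, ih]
      by_cases hn : Even n
      · simp [hn, Nat.even_add_one, hn.neg_one_pow, pow_succ]
      · simp [hn, Nat.even_add_one, (Nat.not_even_iff_odd.mp hn).neg_one_pow, pow_succ]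
  have h0 (i : Fin (q + 2)) : (-1 : ℤ) ^ (i.succ : ℕ) • barLinFace E (q + 1) i.succ
      (barE E (q + 2) 1) = (-1 : ℤ) ^ (i.succ : ℕ) • barE E (q + 1) 1 := by
    rw [barLinFace_E, barIdx, if_neg (by simp)]
  rw [barDiff, LinearMap.sum_apply, Fin.sum_univ_succ]
  simp only [LinearMap.smul_apply, h0, ← Finset.sum_smul]
  rw [h, barLinFace_E, barIdx, if_pos (by simp), barE]
  by_cases hq : Even q
  · simp [hq, Nat.even_add]
  · simp [hq, Nat.even_add]

/-- By the homotopy a cycle is a boundary plus a multiple of `e_1`. For `q` even `e_1` is itself a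
boundary; for `q` odd the differential of `e_1` is `-e_1`, which forces the multiple to be zero. -/
theorem barDiff_exact (q : ℕ) (x : ULift.{u} (Fin (q + 2)) →₀ E) (hx : barDiff E (q + 1) x = 0) :
    ∃ y, barDiff E (q + 2) y = x := by
  have h1 := barDiff_shift (q + 1) x
  rw [hx, map_zero, add_zero] at h1
  have h2 := congrArg (barDiff E (q + 1)) h1
  rw [barDiff_diff, map_sub, hx, map_smul, zero_sub, barDiff_E_one] at h2
  by_cases hq : Even q
  · have h3 := barDiff_E_one (E := E) (q + 1)
    rw [if_neg (by simpa [Nat.even_add_one] using hq), neg_smul, one_smul] at h3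
    refine ⟨barLinShift E (q + 2) x - x ⟨0⟩ • barE E (q + 3) 1, ?_⟩
    rw [map_sub, h1, map_smul, h3, smul_neg, sub_neg_eq_add]
    exact sub_add_cancel _ _
  · rw [if_neg hq, neg_smul, one_smul, smul_neg, neg_neg, barE, dif_pos (by omega)] at h2
    have h3 : x ⟨0⟩ = 0 := by
      have := congrArg (fun f => f ⟨0⟩) h2.symm
      simpa using this
    exact ⟨_, h1.trans (by rw [h3, zero_smul, sub_zero])⟩

/-- The modules of the augmentation of the bar construction. -/
def barW (E : Type u) [CommRing E] : ℕ → Type u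
  | 0 => PUnit.{u + 1}
  | q + 1 => ULift.{u} (Fin q) →₀ E

instance : ∀ q, AddCommGroup (barW E q)
  | 0 => inferInstanceAs (AddCommGroup PUnit.{u + 1})
  | q + 1 => inferInstanceAs (AddCommGroup (ULift.{u} (Fin q) →₀ E))

instance : ∀ q, Module E (barW E q)
  | 0 => inferInstanceAs (Module E PUnit.{u + 1})
  | q + 1 => inferInstanceAs (Module E (ULift.{u} (Fin q) →₀ E))

/-- The differentials of the augmentation of the bar construction. -/
def barw (E : Type u) [CommRing E] : ∀ q, barW E (q + 1) →ₗ[E] barW E q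
  | 0 => 0
  | q + 1 => barDiff E q

/-- The derivations of the augmentation of the bar construction. -/
def barDer (R S : OverAlg A E) : ∀ q, Der (barObj R S q) (barW E q)
  | 0 => Der.zero S
  | q + 1 => barD R q

/-- The augmentation of the standard complexes of the bar construction. -/
def barAug {R S : OverAlg A E} (g : Hom R S) (a : R.C) (hg : g.f a = 0) : (barSSA g a hg).Aug where
  W := barW E
  w := barw E
  ww
    | 0, _ => rfl
    | q + 1, x => barDiff_diff q x
  D := barDer R S
  D_face
    | 0, _ => rfl
    | q + 1, x => barDiff_D R a (π_eq_zero_of_hom g hg) q x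

/-- The constant semi-simplicial algebra. -/
def constSSA (R : OverAlg A E) : SSA A E := ⟨fun _ => R, fun _ _ => Hom.id R, fun _ _ _ _ _ => rfl⟩

/-- The terms of the map from the constant algebra to the bar construction. -/
def barInclHom {R S : OverAlg A E} (g : Hom R S) : ∀ q, Hom R (barObj R S q)
  | 0 => g
  | q + 1 => barC R q

/-- The map from the constant algebra to the bar construction. -/
def barIncl {R S : OverAlg A E} (g : Hom R S) (a : R.C) (hg : g.f a = 0) :
    (constSSA R).Map (barSSA g a hg) where
  f := barInclHom g
  f_face
    | 0, _, x => (barAugment_C g x).symm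
    | q + 1, i, x => (barFace_C R a (π_eq_zero_of_hom g hg) q i x).symm

open scoped nonZeroDivisors in
/-- The relative standard complex of the quotient by a nonzerodivisor is exact in degrees at least
two. -/
theorem quotient_cone_exact {R S : OverAlg A E} (g : Hom R S) (a : R.C) (hg : g.f a = 0)
    (hsurj : Function.Surjective g.f) (hker : ∀ x, g.f x = 0 → a ∣ x) (ha : a ∈ R.C⁰) (n : ℕ) :
    (Cx.cone (betaHom g)).Ex (n + 3) := by
  obtain ⟨hQ⟩ := (barSSA_fill g a hg hsurj hker ha).contr
  -- The constant object is contracted by identities. Row `q + 1` compares `R` with `R[X_1, …,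
  -- X_q]`, and the first column is the linearized bar complex, whose term of index `n + 3` is
  -- `E^{n+2}`.
  refine (barIncl g a hg).cone_exact (barAug g a hg) ?_
    ⟨fun _ x => x, fun _ _ => rfl, fun _ _ _ => rfl⟩ hQ ?_ (n + 3) ?_
  · rintro (_ | q) x
    · rfl
    · exact polyD_C R _ x
  · exact fun q n => polyMap_cone_exact R _ n
  · exact fun x hx => barDiff_exact n x hx

end OverAlg

end

end CotangentComplex

/-! ### Maps that behave like local complete intersections -/

namespace CotangentComplex

noncomputable section

variable {A E : Type u} [CommRing A] [CommRing E] [Algebra A E]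

namespace OverAlg

/-- A map of algebras whose relative standard complex behaves as that of a local complete
intersection: it is injective on homology in degrees `≥ 1`, surjective in degrees `≥ 2`. -/
structure Hom.Lci {R S : OverAlg A E} (g : Hom R S) : Prop where
  inj : ∀ n x, bdiff R n x = 0 → (∃ y, bdiff S (n + 1) y = bmap g (n + 1) x) →
    ∃ y, bdiff R (n + 1) y = x
  surj : ∀ n y, bdiff S (n + 1) y = 0 →
    ∃ x, bdiff R (n + 1) x = 0 ∧ ∃ z, bdiff S (n + 2) z = y - bmap g (n + 2) x

/-- The augmentation occupies index `0` of `beta`, so index `n + 3` of the cone is degree `n + 2` of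
the relative complex. Vanishing there gives injectivity on homology one degree lower and
surjectivity in the same degree. -/
theorem Hom.Lci.of_cone {R S : OverAlg A E} (g : Hom R S)
    (h : ∀ n, (Cx.cone (betaHom g)).Ex (n + 3)) : g.Lci where
  inj n := Cx.injOn_of_cone (betaHom g) (n + 1) (h n)
  surj n := Cx.surjOn_of_cone (betaHom g) (n + 2) (h n)

theorem polyC_lci (R : OverAlg A E) {σ : Type u} (ξ : σ → E) : (polyC R ξ).Lci where
  inj n := Cx.injOn_of_cone (polyMap R ξ) (n + 1) (polyMap_cone_exact R ξ (n + 3))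
  surj n := Cx.surjOn_of_cone (polyMap R ξ) (n + 2) (polyMap_cone_exact R ξ (n + 3))

open scoped nonZeroDivisors in
theorem quotient_lci {R S : OverAlg A E} (g : Hom R S) (a : R.C) (hg : g.f a = 0)
    (hsurj : Function.Surjective g.f) (hker : ∀ x, g.f x = 0 → a ∣ x) (ha : a ∈ R.C⁰) : g.Lci :=
  .of_cone g (quotient_cone_exact g a hg hsurj hker ha)

theorem bmap_comp {R S U : OverAlg A E} (h : Hom S U) (g : Hom R S) (n : ℕ) (x) :
    bmap (h.comp g) n x = bmap h n (bmap g n x) := by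
  have : bmap (h.comp g) n = bmap h n ∘ₗ bmap g n := by
    refine Finsupp.lhom_ext fun x e => ?_
    rw [LinearMap.comp_apply, bmap_single, bmap_single, bmap_single, twmap_comp]
    rfl
  exact congrArg (fun f => f x) this

theorem Hom.Lci.comp {R S U : OverAlg A E} {h : Hom S U} {g : Hom R S} (hh : h.Lci) (hg : g.Lci) :
    (h.comp g).Lci where
  inj n x hx hy := by
    simp only [bmap_comp] at hy
    exact hg.inj n x hx (hh.inj n _ (by rw [← bmap_bdiff, hx, map_zero]) hy)
  surj n y hy := by
    obtain ⟨x, hx, z, hz⟩ := hh.surj n y hy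
    obtain ⟨x', hx', z', hz'⟩ := hg.surj n x hx
    refine ⟨x', hx', z + bmap h _ z', ?_⟩
    rw [map_add, hz, ← bmap_bdiff, hz', bmap_comp, map_sub, sub_add_sub_cancel]

theorem bmap_injective {R S : OverAlg A E} {g : Hom R S} (hg : Function.Injective g.f) (n : ℕ) :
    Function.Injective (bmap g n) := by
  refine Finsupp.mapDomain_injective fun x y h => twmap_injective hg n ?_
  rwa [twhom_f, twhom_f] at h

section Directed

variable {S : OverAlg A E} {ι : Type u} [Nonempty ι] (B : ι → OverAlg A E)
  (i : ∀ k, Hom (B k) S)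
  (hdir : ∀ k l, ∃ m, Set.range (i k).f ⊆ Set.range (i m).f ∧ Set.range (i l).f ⊆ Set.range (i m).f)
  (hcov : ∀ x, ∃ k, x ∈ Set.range (i k).f)

theorem exists_of_range_subset {R R' : OverAlg A E} {g : Hom R S} {g' : Hom R' S}
    (h : Set.range g.f ⊆ Set.range g'.f) : ∃ φ : R.C → R'.C, ∀ x, g'.f (φ x) = g.f x :=
  ⟨fun x => (h ⟨x, rfl⟩).choose, fun x => (h ⟨x, rfl⟩).choose_spec⟩

theorem range_twmap_subset {R R' : OverAlg A E} {g : Hom R S} {g' : Hom R' S}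
    (h : Set.range g.f ⊆ Set.range g'.f) (n : ℕ) :
    Set.range (twmap g.f n) ⊆ Set.range (twmap g'.f n) := by
  obtain ⟨φ, hφ⟩ := exists_of_range_subset h
  rintro _ ⟨x, rfl⟩
  exact ⟨twmap φ n x, (twmap_comp _ _ n x).trans (congrArg (fun f => twmap f n x) (funext hφ))⟩

-- An element of an iterated polynomial algebra involves finitely many elements of `S`, and
-- directedness puts them in one member of the family.
include hdir hcov in
theorem exists_mem_range_twmap (n : ℕ) (x : (tw S n).C) : ∃ k, x ∈ Set.range (twmap (i k).f n) := by
  induction n with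
  | zero => exact hcov x
  | succ n ih =>
    induction (show MvPolynomial (tw S n).C A from x) using MvPolynomial.induction_on with
    | C a => exact ⟨Classical.arbitrary ι, MvPolynomial.C a, MvPolynomial.rename_C _ _⟩
    | add p q hp hq =>
      obtain ⟨k, hk⟩ := hp
      obtain ⟨l, hl⟩ := hq
      obtain ⟨m, hkm, hlm⟩ := hdir k l
      obtain ⟨p', rfl⟩ := range_twmap_subset hkm (n + 1) hk
      obtain ⟨q', rfl⟩ := range_twmap_subset hlm (n + 1) hl
      exact ⟨m, p' + q', map_add (Tmap (R := tw (B m) n) (S := tw S n) _) p' q'⟩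
    | mul_X p y hp =>
      obtain ⟨k, hk⟩ := hp
      obtain ⟨l, hl⟩ := ih y
      obtain ⟨m, hkm, hlm⟩ := hdir k l
      obtain ⟨p', rfl⟩ := range_twmap_subset hkm (n + 1) hk
      obtain ⟨y', rfl⟩ := range_twmap_subset hlm n hl
      refine ⟨m, p' * (show (tw (B m) (n + 1)).C from (tw (B m) n).X y'), ?_⟩
      refine (map_mul (Tmap (R := tw (B m) n) (S := tw S n) _) p' _).trans ?_
      exact congrArg (_ * ·) (Tmap_X _ _)

include hdir hcov in
theorem exists_mem_range_bmap (n : ℕ) (x : (tw S n).C →₀ E) : ∃ k, ∃ y, bmap (i k) n y = x := by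
  induction x using Finsupp.induction_linear with
  | zero => exact ⟨Classical.arbitrary ι, 0, map_zero _⟩
  | add p q hp hq =>
    obtain ⟨k, p, rfl⟩ := hp
    obtain ⟨l, q, rfl⟩ := hq
    obtain ⟨m, hkm, hlm⟩ := hdir k l
    have (k : ι) (h : Set.range (i k).f ⊆ Set.range (i m).f) (p) :
        ∃ p', bmap (i m) n p' = bmap (i k) n p := by
      obtain ⟨φ, hφ⟩ := exists_of_range_subset h
      refine ⟨Finsupp.lmapDomain E E (twmap φ n) p, ?_⟩
      have : bmap (i m) n ∘ₗ Finsupp.lmapDomain E E (twmap φ n) = bmap (i k) n :=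
        Finsupp.lhom_ext fun x e => by
          rw [LinearMap.comp_apply, lmap_single, bmap_single, bmap_single, twmap_comp]
          exact congrArg (fun f => Finsupp.single (twmap f n x) e) (funext hφ)
      exact congrArg (fun f => f p) this
    obtain ⟨p', hp⟩ := this k hkm p
    obtain ⟨q', hq⟩ := this l hlm q
    exact ⟨m, p' + q', by rw [map_add, hp, hq]⟩
  | single y e =>
    obtain ⟨k, y, rfl⟩ := exists_mem_range_twmap B i hdir hcov n y
    exact ⟨k, Finsupp.single y e, bmap_single _ _ _ _⟩

include hdir hcov in
/-- The property of being a local complete intersection passes to directed unions. -/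
theorem Hom.Lci.of_directed {R : OverAlg A E} (g : Hom R S) (hi : ∀ k, Function.Injective (i k).f)
    (h : ∀ k, ∃ gk : Hom R (B k), (i k).comp gk = g ∧ gk.Lci) : g.Lci where
  inj n x hx hy := by
    obtain ⟨y, hy⟩ := hy
    obtain ⟨k, y, rfl⟩ := exists_mem_range_bmap B i hdir hcov _ y
    obtain ⟨gk, rfl, hk⟩ := h k
    -- The bounding chain already lives over some `B k`; the relation it satisfies over `S` descends
    -- because the chains of `B k` inject into those of `S`.
    refine hk.inj n x hx ⟨y, bmap_injective (hi k) _ ?_⟩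
    rw [bmap_bdiff, hy, bmap_comp]
  surj n y hy := by
    obtain ⟨k, y, rfl⟩ := exists_mem_range_bmap B i hdir hcov _ y
    obtain ⟨gk, rfl, hk⟩ := h k
    obtain ⟨x, hx, z, hz⟩ := hk.surj n y (bmap_injective (hi k) _ (by
      rw [bmap_bdiff, hy, map_zero]))
    refine ⟨x, hx, bmap (i k) _ z, ?_⟩
    rw [← bmap_bdiff, hz, map_sub, bmap_comp]

end Directed

/-- Viewing `S` as the directed union of the single algebra `R` reduces this to the identity,
without an inverse of `g`. -/
theorem Hom.Lci.of_bijective {R S : OverAlg A E} (g : Hom R S) (hg : Function.Bijective g.f) :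
    g.Lci := by
  refine Hom.Lci.of_directed (ι := PUnit) (fun _ => R) (fun _ => g) (fun _ _ => ⟨⟨⟩, le_rfl, le_rfl⟩)
    (fun x => ⟨⟨⟩, hg.2 x⟩) g (fun _ => hg.1) (fun _ => ⟨Hom.id R, rfl, ?_, ?_⟩)
  · rintro n x - ⟨y, hy⟩
    refine ⟨y, hy.trans ?_⟩
    rw [show bmap (Hom.id R) (n + 1) x = x from ?_]
    exact (congrArg (fun f => Finsupp.mapDomain f x) (funext fun x =>
      (twhom_f (Hom.id R) (n + 1) x).trans (twmap_id (n + 1) x))).trans Finsupp.mapDomain_id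
  · intro n y hy
    refine ⟨y, hy, 0, ?_⟩
    rw [map_zero, show bmap (Hom.id R) (n + 2) y = y from ?_, sub_self]
    exact (congrArg (fun f => Finsupp.mapDomain f y) (funext fun x =>
      (twhom_f (Hom.id R) (n + 2) x).trans (twmap_id (n + 2) x))).trans Finsupp.mapDomain_id

end OverAlg

end

end CotangentComplex

/-! ### Localizations, fraction fields and simple extensions -/

namespace CotangentComplex

noncomputable section

variable {A E : Type u} [CommRing A] [CommRing E] [Algebra A E]

namespace OverAlg

instance {R : OverAlg A E} [IsDomain R.C] {σ : Type u} (ξ : σ → E) : IsDomain (poly R ξ).C :=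
  inferInstanceAs (IsDomain (MvPolynomial σ R.C))

section Localization

variable {R S : OverAlg A E} (g : Hom R S) (q : R.C) (y : S.C) (hy : g.f q * y = 1)

/-- The map `R[X] → S` sending `X` to `y`. -/
def polyEval : Hom (poly R (fun _ : PUnit.{u + 1} => S.π y)) S := polyLift g (fun _ => y) fun _ => rfl

theorem polyEval_C (r) : (polyEval g y).f ((polyC R _).f r) = g.f r := polyLift_C _ _ _ _

theorem polyEval_X (s) : (polyEval g y).f (polyX R _ s) = y := polyLift_X _ _ _ _

/-- The polynomial `q X - 1`. -/
def invPoly : (poly R (fun _ : PUnit.{u + 1} => S.π y)).C :=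
  (polyC R _).f q * polyX R _ PUnit.unit - 1

include hy in
theorem polyEval_invPoly : (polyEval g y).f (invPoly q y) = 0 := by
  rw [invPoly, map_sub, map_mul, polyEval_C, polyEval_X, hy, map_one, sub_self]

/-- The localization `R[1/q]`. -/
def away : OverAlg A E where
  C := (poly R (fun _ : PUnit.{u + 1} => S.π y)).C ⧸ Ideal.span {invPoly q y}
  π := S.π.comp (Ideal.Quotient.liftₐ _ (polyEval g y).f fun x hx => by
    obtain ⟨z, rfl⟩ := Ideal.mem_span_singleton.mp hx
    rw [map_mul, polyEval_invPoly g q y hy, zero_mul])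

/-- The map `R[1/q] → S`. -/
def awayMap : Hom (away g q y hy) S where
  f := Ideal.Quotient.liftₐ _ (polyEval g y).f fun x hx => by
    obtain ⟨z, rfl⟩ := Ideal.mem_span_singleton.mp hx
    rw [map_mul, polyEval_invPoly g q y hy, zero_mul]
  π_f _ := rfl

/-- The map `R[X] → R[1/q]`. -/
def polyAway : Hom (poly R (fun _ : PUnit.{u + 1} => S.π y)) (away g q y hy) where
  f := Ideal.Quotient.mkₐ A _
  π_f := (polyEval g y).π_f

theorem awayMap_polyAway (x) : (awayMap g q y hy).f ((polyAway g q y hy).f x) = (polyEval g y).f x :=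
  rfl

theorem polyAway_eq_zero (x) : (polyAway g q y hy).f x = 0 ↔ invPoly q y ∣ x :=
  Ideal.Quotient.eq_zero_iff_mem.trans Ideal.mem_span_singleton

theorem invPoly_ne_zero [Nontrivial R.C] : invPoly q y ≠ 0 := by
  intro h
  have : MvPolynomial.constantCoeff (show MvPolynomial PUnit.{u + 1} R.C from
    MvPolynomial.C q * MvPolynomial.X PUnit.unit - 1) = 0 :=
    (congrArg MvPolynomial.constantCoeff h).trans (map_zero _)
  simp at this

/-- Clearing denominators: modulo `qX - 1`, each factor `X` is absorbed by a factor `q`. -/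
theorem exists_pow_mul (p) : ∃ n r, invPoly q y ∣ (polyC R _).f q ^ n * p - (polyC R _).f r := by
  induction p using poly_induction with
  | C r => exact ⟨0, r, by simp⟩
  | add p p' hp hp' =>
    obtain ⟨n, r, hr⟩ := hp
    obtain ⟨n', r', hr'⟩ := hp'
    refine ⟨n + n', q ^ n' * r + q ^ n * r', ?_⟩
    have := dvd_add (hr.mul_left ((polyC R _).f q ^ n')) (hr'.mul_left ((polyC R _).f q ^ n))
    refine this.trans (Eq.dvd ?_)
    simp only [map_add, map_mul, map_pow]
    ring
  | mul p s hp =>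
    obtain ⟨n, r, hr⟩ := hp
    refine ⟨n + 1, r, ?_⟩
    have := dvd_add (hr.mul_left ((polyC R _).f q * polyX R _ s))
      ((dvd_refl (invPoly q y)).mul_right ((polyC R _).f r))
    refine this.trans (Eq.dvd ?_)
    rw [invPoly]
    ring

theorem polyAway_lci [IsDomain R.C] : (polyAway g q y hy).Lci :=
  quotient_lci _ (invPoly q y) ((polyAway_eq_zero g q y hy _).mpr dvd_rfl)
    Ideal.Quotient.mk_surjective (fun x hx => (polyAway_eq_zero g q y hy x).mp hx)
    (mem_nonZeroDivisors_of_ne_zero (invPoly_ne_zero q y))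

/-- If `p` evaluates to zero, the constant `r` with `q^n p ≡ r` evaluates to zero, so `r = 0` as `g`
is injective. Multiplying `q^n p ≡ 0` by `X^n` recovers `p ≡ 0`, because `qX ≡ 1`. -/
theorem awayMap_injective (hg : Function.Injective g.f) :
    Function.Injective (awayMap g q y hy).f := by
  rw [injective_iff_map_eq_zero]
  intro z hz
  obtain ⟨p, rfl⟩ := Ideal.Quotient.mk_surjective z
  obtain ⟨n, r, hr⟩ := exists_pow_mul q y p
  have hp : (polyEval g y).f p = 0 := hz
  have h1 : (polyEval g y).f ((polyC R _).f q ^ n * p - (polyC R _).f r) = 0 := by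
    obtain ⟨w, hw⟩ := hr
    rw [hw, map_mul, polyEval_invPoly g q y hy, zero_mul]
  rw [map_sub, map_mul, hp, mul_zero, zero_sub, neg_eq_zero, polyEval_C] at h1
  have h2 : r = 0 := hg (h1.trans (map_zero _).symm)
  rw [h2, map_zero, sub_zero] at hr
  refine (polyAway_eq_zero g q y hy p).mpr ?_
  have h3 := hr.mul_left (polyX R _ PUnit.unit ^ n)
  rw [← mul_assoc, ← mul_pow] at h3
  have h4 : invPoly q y ∣ (polyX R _ PUnit.unit * (polyC R _).f q) ^ n - 1 ^ n := by
    refine Dvd.dvd.trans (Eq.dvd ?_) (sub_dvd_pow_sub_pow _ _ n)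
    rw [invPoly, mul_comm]
  have h5 := dvd_sub h3 (h4.mul_right p)
  rw [one_pow, sub_mul, one_mul, sub_sub_cancel] at h5
  exact h5

theorem mem_range_awayMap (s : S.C) :
    s ∈ Set.range (awayMap g q y hy).f ↔ ∃ n r, g.f q ^ n * s = g.f r := by
  constructor
  · rintro ⟨z, rfl⟩
    obtain ⟨p, rfl⟩ := Ideal.Quotient.mk_surjective z
    obtain ⟨n, r, w, hw⟩ := exists_pow_mul q y p
    refine ⟨n, r, ?_⟩
    have := congrArg (polyEval g y).f hw
    rw [map_sub, map_mul, map_mul, polyEval_invPoly g q y hy, zero_mul, map_pow, polyEval_C,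
      polyEval_C, sub_eq_zero] at this
    exact this
  · rintro ⟨n, r, h⟩
    refine ⟨(polyAway g q y hy).f ((polyC R _).f r * polyX R _ PUnit.unit ^ n), ?_⟩
    rw [awayMap_polyAway, map_mul, map_pow, polyEval_C, polyEval_X, ← h, mul_right_comm, ← mul_pow,
      hy, one_pow, one_mul]

include hy in
theorem exists_away [IsDomain R.C] (hg : Function.Injective g.f) :
    ∃ (B : OverAlg A E) (i : Hom B S), Function.Injective i.f ∧
      (∀ s, s ∈ Set.range i.f ↔ ∃ n r, g.f q ^ n * s = g.f r) ∧
      ∃ gk : Hom R B, i.comp gk = g ∧ gk.Lci :=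
  ⟨away g q y hy, awayMap g q y hy, awayMap_injective g q y hy hg, mem_range_awayMap g q y hy,
    (polyAway g q y hy).comp (polyC R _), Hom.ext fun r => polyEval_C g y r,
    (polyAway_lci g q y hy).comp (polyC_lci R _)⟩

end Localization

/-- The map from a domain to its field of fractions is a local complete intersection. -/
theorem fraction_lci {R S : OverAlg A E} (g : Hom R S) [IsDomain R.C] (hS : IsField S.C)
    (hg : Function.Injective g.f) (h : ∀ y, ∃ p q, q ≠ 0 ∧ g.f q * y = g.f p) : g.Lci := by
  have hinv (q : {q : R.C // q ≠ 0}) : ∃ y, g.f q * y = 1 :=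
    hS.mul_inv_cancel fun h0 => q.2 (hg (h0.trans (map_zero _).symm))
  have hB (q : {q : R.C // q ≠ 0}) := exists_away g q.1 (hinv q).choose (hinv q).choose_spec hg
  choose B i hi hr hk using hB
  have : Nonempty {q : R.C // q ≠ 0} := ⟨⟨1, one_ne_zero⟩⟩
  -- The field is the union of the rings `R[1/q]`, directed because `R[1/p]` and `R[1/q]` lie in
  -- `R[1/(pq)]`.
  refine Hom.Lci.of_directed B i (fun p q => ?_) (fun s => ?_) g hi hk
  · refine ⟨⟨p * q, mul_ne_zero p.2 q.2⟩, fun s hs => ?_, fun s hs => ?_⟩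
    · obtain ⟨n, r, h⟩ := (hr p s).mp hs
      refine (hr _ s).mpr ⟨n, q.1 ^ n * r, ?_⟩
      rw [map_mul, map_mul, ← h, map_pow]
      ring
    · obtain ⟨n, r, h⟩ := (hr q s).mp hs
      refine (hr _ s).mpr ⟨n, p.1 ^ n * r, ?_⟩
      rw [map_mul, map_mul, ← h, map_pow]
      ring
  · obtain ⟨p, q, hq, h⟩ := h s
    exact ⟨⟨q, hq⟩, (hr _ s).mpr ⟨1, p, by rw [pow_one, h]⟩⟩

/-- A simple field extension is a local complete intersection. -/
theorem simple_lci {R S : OverAlg A E} (g : Hom R S) (hR : IsField R.C) (hS : IsField S.C) (x : S.C)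
    (h : ∀ y, ∃ p q, (polyEval g x).f q ≠ 0 ∧ (polyEval g x).f q * y = (polyEval g x).f p) :
    g.Lci := by
  let := hR.toField
  have : IsDomain R.C := hR.isDomain
  have : IsDomain S.C := hS.isDomain
  have hcomp : (polyEval g x).comp (polyC R _) = g := Hom.ext fun r => polyEval_C g x r
  suffices (polyEval g x).Lci by
    rw [← hcomp]
    exact this.comp (polyC_lci R _)
  -- If `x` is transcendental, `S` is the fraction field of `R[X]`. If it is algebraic, the kernel
  -- is a nonzero prime of a principal ideal domain, hence maximal, so `S` is the quotient of `R[X]`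
  -- by one nonzero polynomial.
  by_cases hinj : Function.Injective (polyEval g x).f
  · refine fraction_lci _ hS hinj fun y => ?_
    obtain ⟨p, q, hq, hpq⟩ := h y
    exact ⟨p, q, fun h0 => hq (by rw [h0, map_zero]), hpq⟩
  · have hpid : IsPrincipalIdealRing (poly R (fun _ : PUnit.{u + 1} => S.π x)).C :=
      IsPrincipalIdealRing.of_surjective (MvPolynomial.uniqueAlgEquiv R.C PUnit.{u + 1}).symm.toRingHom
        (MvPolynomial.uniqueAlgEquiv R.C PUnit.{u + 1}).symm.surjective
    let I := RingHom.ker (polyEval g x).f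
    have hI : I ≠ ⊥ := fun h0 => hinj ((RingHom.injective_iff_ker_eq_bot _).mpr h0)
    have hprime : I.IsPrime := RingHom.ker_isPrime _
    have hmax : I.IsMaximal := IsPrime.to_maximal_ideal hI
    obtain ⟨a, ha⟩ := (hpid.principal I).principal
    refine quotient_lci _ a ?_ (fun y => ?_) (fun z hz => ?_) (mem_nonZeroDivisors_of_ne_zero ?_)
    · have : a ∈ I := by
        rw [ha]
        exact Ideal.mem_span_singleton_self a
      exact this
    · obtain ⟨p, q, hq, hpq⟩ := h y
      obtain ⟨q', i, hi, hqi⟩ := hmax.exists_inv (x := q) hq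
      have h1 := congrArg (polyEval g x).f hqi
      rw [map_add, show (polyEval g x).f i = 0 from hi, add_zero, map_mul, map_one] at h1
      refine ⟨q' * p, ?_⟩
      rw [map_mul, ← hpq, ← mul_assoc, h1, one_mul]
    · have : z ∈ I := hz
      rw [ha] at this
      exact Ideal.mem_span_singleton.mp this
    · rintro rfl
      exact hI (ha.trans (by simp))

end OverAlg

end

end CotangentComplex

/-! ### Arbitrary field extensions -/

namespace CotangentComplex

noncomputable section

namespace OverAlg

/-- An `A`-algebra `B` with a map to `E`. -/
abbrev of (A B E : Type u) [CommRing A] [CommRing B] [CommRing E] [Algebra A B] [Algebra B E]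
    [Algebra A E] [IsScalarTower A B E] : OverAlg A E := ⟨B, IsScalarTower.toAlgHom A B E⟩

/-- The map of algebras over `E` given by a tower `A → B → C → E`. -/
def ofHom (A B C E : Type u) [CommRing A] [CommRing B] [CommRing C] [CommRing E] [Algebra A B]
    [Algebra A C] [Algebra B C] [Algebra B E] [Algebra C E] [Algebra A E] [IsScalarTower A B E]
    [IsScalarTower A C E] [IsScalarTower B C E] [IsScalarTower A B C] :
    Hom (of A B E) (of A C E) :=
  ⟨IsScalarTower.toAlgHom A B C, fun x => (IsScalarTower.algebraMap_apply B C E x).symm⟩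

variable (A F E : Type u) [CommRing A] [Field F] [Field E] [Algebra A F] [Algebra F E] [Algebra A E]
  [IsScalarTower A F E]

/-- An intermediate field as an algebra over `E`. -/
abbrev inter (K : IntermediateField F E) : OverAlg A E := ⟨K, K.val.restrictScalars A⟩

/-- The map from the base field to an intermediate field. -/
def interHom (K : IntermediateField F E) : Hom (of A F E) (inter A F E K) :=
  ⟨(Algebra.ofId F K).restrictScalars A, fun _ => rfl⟩

/-- The map from an intermediate field to the extension. -/
def interVal (K : IntermediateField F E) : Hom (inter A F E K) (of A E E) :=
  ⟨K.val.restrictScalars A, fun _ => rfl⟩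

theorem polyEval_range {R : OverAlg A E} {K : IntermediateField F E} (g : Hom R (inter A F E K))
    (L : Subfield E) (φ : L ≃+* R.C) (hφ : ∀ x, (g.f (φ x)).1 = x) (x : K)
    (p : Polynomial L) : ∃ q, ((polyEval g x).f q : K).1 = Polynomial.aeval (x : E) p := by
  induction p using Polynomial.induction_on' with
  | add p q hp hq =>
    obtain ⟨p', hp⟩ := hp
    obtain ⟨q', hq⟩ := hq
    refine ⟨p' + q', ?_⟩
    rw [map_add, map_add, ← hp, ← hq]
    rfl
  | monomial n a =>
    refine ⟨(polyC R _).f (φ a) * polyX R _ PUnit.unit ^ n, ?_⟩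
    rw [map_mul, map_pow, polyEval_C, polyEval_X, Polynomial.aeval_monomial]
    exact congrArg (· * (x : E) ^ n) (hφ a)

/-- A finitely generated extension is a tower of simple ones, so composition and `simple_lci`
suffice. -/
theorem inter_lci (s : Finset E) :
    (interHom A F E (IntermediateField.adjoin F (s : Set E))).Lci := by
  refine IntermediateField.induction_on_adjoin_finset s (fun K => (interHom A F E K).Lci) ?_ ?_
  · refine Hom.Lci.of_bijective _ ⟨(algebraMap F _).injective, fun x => ?_⟩
    obtain ⟨y, hy⟩ := IntermediateField.mem_bot.mp x.2
    exact ⟨y, Subtype.ext hy⟩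
  · intro K x _ hK
    have hle : K ≤ (IntermediateField.adjoin K {x}).restrictScalars F := fun y hy =>
      (IntermediateField.adjoin K {x}).algebraMap_mem ⟨y, hy⟩
    let g : Hom (inter A F E K)
        (inter A F E ((IntermediateField.adjoin K {x}).restrictScalars F)) :=
      ⟨(IntermediateField.inclusion hle).restrictScalars A, fun _ => rfl⟩
    refine Hom.Lci.comp (h := g) ?_ hK
    have hx : x ∈ (IntermediateField.adjoin K {x}).restrictScalars F :=
      IntermediateField.mem_adjoin_simple_self K x
    refine simple_lci g (Field.toIsField K)
      (Field.toIsField ((IntermediateField.adjoin K {x}).restrictScalars F)) ⟨x, hx⟩ fun y => ?_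
    obtain ⟨r, t, hy⟩ := (IntermediateField.mem_adjoin_simple_iff K (y.1 : E)).mp y.2
    obtain ⟨r', hr⟩ := polyEval_range A F E g K.toSubfield (RingEquiv.refl K) (fun _ => rfl)
      ⟨x, hx⟩ r
    obtain ⟨t', ht⟩ := polyEval_range A F E g K.toSubfield (RingEquiv.refl K) (fun _ => rfl)
      ⟨x, hx⟩ t
    -- In the description `y = r(x)/t(x)` the denominator may vanish; by the convention for division
    -- by zero `y` is then `0`, written as `0/1`.
    by_cases h0 : Polynomial.aeval x t = 0
    · refine ⟨0, 1, ?_, ?_⟩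
      · rw [map_one]
        exact one_ne_zero (α := (IntermediateField.adjoin K {x}).restrictScalars F)
      · rw [map_one, map_zero, one_mul]
        refine Subtype.ext (hy.trans ?_)
        rw [h0, div_zero]
        rfl
    · refine ⟨r', t', fun h1 => h0 ?_, Subtype.ext ?_⟩
      · refine ht.symm.trans ?_
        exact congrArg Subtype.val h1
      · refine Eq.trans ?_ hr.symm
        refine (congrArg₂ (· * ·) ht hy).trans ?_
        exact mul_div_cancel₀ _ h0

/-- Field extensions are local complete intersections. -/
theorem field_lci : (ofHom A F E E).Lci := by
  refine Hom.Lci.of_directed (fun s : Finset E => inter A F E (IntermediateField.adjoin F s))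
    (fun s => interVal A F E _) (fun s t => ?_) (fun x => ?_) _ (fun s => Subtype.val_injective)
    (fun s => ⟨interHom A F E _, rfl, inter_lci A F E s⟩)
  · classical
    refine ⟨s ∪ t, ?_, ?_⟩
    · rintro _ ⟨x, rfl⟩
      exact ⟨⟨x.1, IntermediateField.adjoin.mono F _ _ (by simp) x.2⟩, rfl⟩
    · rintro _ ⟨x, rfl⟩
      exact ⟨⟨x.1, IntermediateField.adjoin.mono F _ _ (by simp) x.2⟩, rfl⟩
  · exact ⟨{x}, ⟨⟨x, IntermediateField.subset_adjoin F _ (by simp)⟩, rfl⟩⟩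

end OverAlg

end

end CotangentComplex

/-! ### Regular local rings -/

namespace CotangentComplex

section RegularLocal

open IsLocalRing

variable {R : Type u} [CommRing R]

theorem maximalIdeal_quotient [IsLocalRing R] (I : Ideal R) [IsLocalRing (R ⧸ I)] :
    maximalIdeal (R ⧸ I) = (maximalIdeal R).map (Ideal.Quotient.mk I) := by
  have hs := Ideal.Quotient.mk_surjective (I := I)
  refine le_antisymm (fun y hy => ?_) ?_
  · obtain ⟨z, rfl⟩ := hs y
    refine Ideal.mem_map_of_mem _ ((mem_maximalIdeal z).mpr fun hz => ?_)
    exact (mem_maximalIdeal _).mp hy (hz.map _)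
  · obtain h | h := Ideal.map_eq_top_or_isMaximal_of_surjective _ hs (maximalIdeal.isMaximal R)
    · have : IsLocalHom (Ideal.Quotient.mk I) := .of_surjective _ hs
      rw [Ideal.map_le_iff_le_comap]
      exact fun z hz => (mem_maximalIdeal _).mpr fun h => (mem_maximalIdeal z).mp hz
        (IsUnit.of_map _ z h)
    · exact (eq_maximalIdeal h).le

/-- The number of generators of the maximal ideal drops in the quotient by an element outside its
square. -/
theorem spanFinrank_quotient_lt [IsLocalRing R] [IsNoetherianRing R] (x : R)
    (hx : x ∈ maximalIdeal R) (hx' : x ∉ maximalIdeal R ^ 2) [IsLocalRing (R ⧸ Ideal.span {x})] :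
    (maximalIdeal (R ⧸ Ideal.span {x})).spanFinrank + 1 ≤ (maximalIdeal R).spanFinrank := by
  let v : CotangentSpace R := (maximalIdeal R).toCotangent ⟨x, hx⟩
  have hv : v ≠ 0 := fun h => hx' ((Ideal.toCotangent_eq_zero _ _).mp h)
  -- The class of `x` is completed to a basis of `𝔪/𝔪²`. By Nakayama lifts of the basis generate
  -- `𝔪`, and those other than `x` still generate the maximal ideal of the quotient.
  have hli : LinearIndepOn (ResidueField R) _root_.id {v} := LinearIndepOn.singleton hv
  let b := Module.Basis.extend hli
  let B : Set (CotangentSpace R) := hli.extend (Set.subset_univ _)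
  have hvB : v ∈ B := hli.subset_extend _ rfl
  have hfin : B.Finite := by
    have := Module.Finite.finite_basis b
    exact Set.toFinite B
  have hcard : B.ncard = (maximalIdeal R).spanFinrank := by
    rw [spanFinrank_maximalIdeal_eq_finrank_cotangentSpace, Module.finrank_eq_nat_card_basis b]
    rfl
  obtain ⟨ψ, hψ⟩ := (maximalIdeal R).toCotangent_surjective.hasRightInverse
  let s : Set (maximalIdeal R) := insert ⟨x, hx⟩ (ψ '' (B \ {v}))
  have himg : (maximalIdeal R).toCotangent '' s = B := by
    rw [Set.image_insert_eq, ← Set.image_comp,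
      show ((maximalIdeal R).toCotangent ∘ ψ) = _root_.id from funext hψ, Set.image_id]
    exact (Set.insert_sdiff_singleton).trans (Set.insert_eq_of_mem hvB)
  have hspan : Submodule.span R s = ⊤ := by
    rw [← CotangentSpace.span_image_eq_top_iff, himg]
    exact (congrArg _ (Module.Basis.range_extend hli).symm).trans b.span_eq
  have hm : maximalIdeal R = Ideal.span (insert x (Subtype.val '' (ψ '' (B \ {v})))) := by
    have := congrArg (Submodule.map (maximalIdeal R).subtype) hspan
    rw [Submodule.map_span, Submodule.map_top, Submodule.range_subtype] at this
    rw [← Set.image_insert_eq (f := Subtype.val) (a := (⟨x, hx⟩ : maximalIdeal R))]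
    exact this.symm
  have hm' : maximalIdeal (R ⧸ Ideal.span {x}) = Ideal.span (Ideal.Quotient.mk (Ideal.span {x}) ''
      (Subtype.val '' (ψ '' (B \ {v})))) := by
    rw [maximalIdeal_quotient]
    conv_lhs => rw [hm]
    rw [Ideal.map_span, Set.image_insert_eq, Ideal.span_insert,
      Ideal.Quotient.eq_zero_iff_mem.mpr (Ideal.mem_span_singleton_self x)]
    simp
  have hle : (maximalIdeal (R ⧸ Ideal.span {x})).spanFinrank ≤ (B \ {v}).ncard := by
    rw [hm', ← Set.image_comp, ← Set.image_comp]
    exact (Submodule.spanFinrank_span_le_ncard_of_finite ((hfin.sdiff).image _)).trans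
      (Set.ncard_image_le hfin.sdiff)
  rw [← hcard, ← Set.ncard_sdiff_singleton_add_one hvB hfin]
  omega

/-- Prime avoidance for `𝔪²` and the finitely many minimal primes; `𝔪²` is the member allowed not to
be prime. Containment of `𝔪` in `𝔪²` would make the ring a field, and in a minimal prime would make
its dimension zero. -/
theorem exists_notMem_sq_minimalPrimes [IsLocalRing R] [IsNoetherianRing R] (hR : ¬ IsField R)
    (hdim : ringKrullDim R ≠ 0) :
    ∃ x ∈ maximalIdeal R, x ∉ maximalIdeal R ^ 2 ∧ ∀ p ∈ minimalPrimes R, x ∉ p := by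
  by_contra! h
  have hfin : (minimalPrimes R).Finite := (⊥ : Ideal R).finite_minimalPrimes_of_isNoetherianRing R
  classical
  have key := (Ideal.subset_union_prime (s := insert (maximalIdeal R ^ 2) hfin.toFinset)
    (f := fun I : Ideal R => I) (maximalIdeal R ^ 2) (maximalIdeal R ^ 2) (fun p hp hp' _ => by
      rw [Finset.mem_insert, Set.Finite.mem_toFinset] at hp
      exact Ideal.IsMinimalPrime.isPrime (hp.resolve_left hp')) (I := maximalIdeal R)).mp
    (fun x hx => by
      simp only [Finset.coe_insert, Set.Finite.coe_toFinset, Set.mem_iUnion, exists_prop]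
      by_cases hx' : x ∈ maximalIdeal R ^ 2
      · exact ⟨_, Set.mem_insert _ _, hx'⟩
      · obtain ⟨p, hp, hxp⟩ := h x hx hx'
        exact ⟨p, Set.mem_insert_of_mem _ hp, hxp⟩)
  obtain ⟨p, hp, hle⟩ := key
  rw [Finset.mem_insert, Set.Finite.mem_toFinset] at hp
  obtain rfl | hp := hp
  · exact absurd hle (not_le_of_gt ((maximalIdeal_sq_lt_maximalIdeal R).mpr hR))
  · have := Ideal.IsMinimalPrime.isPrime hp
    obtain rfl : p = maximalIdeal R := le_antisymm (le_maximalIdeal this.ne_top) hle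
    refine hdim ?_
    rw [← maximalIdeal_height_eq_ringKrullDim, Ideal.height_eq_zero_iff.mpr hp]
    rfl

/-- The embedding dimension drops by at least one and the Krull dimension by at most one, so
equality persists. -/
theorem isRegularLocalRing_quotient [IsRegularLocalRing R] (x : R)
    (hx : x ∈ maximalIdeal R) (hx' : x ∉ maximalIdeal R ^ 2) :
    IsRegularLocalRing (R ⧸ Ideal.span {x}) ∧ ∀ _ : IsLocalRing (R ⧸ Ideal.span {x}),
      (maximalIdeal (R ⧸ Ideal.span {x})).spanFinrank < (maximalIdeal R).spanFinrank := by
  have : Nontrivial (R ⧸ Ideal.span {x}) := Ideal.Quotient.nontrivial_iff.mpr fun h =>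
    (maximalIdeal.isMaximal R).ne_top (top_le_iff.mp (h ▸ (Ideal.span_singleton_le_iff_mem _).mpr hx))
  have hloc : IsLocalRing (R ⧸ Ideal.span {x}) :=
    .of_surjective' _ (Ideal.Quotient.mk_surjective (I := Ideal.span {x}))
  have hlt := spanFinrank_quotient_lt x hx hx'
  refine ⟨.of_spanFinrank_maximalIdeal_le _ ?_, fun _ => hlt⟩
  have hdim := ringKrullDim_le_ringKrullDim_quotient_add_card {x} (by
    rw [IsLocalRing.ringJacobson_eq_maximalIdeal]
    simpa using hx)
  rw [← IsRegularLocalRing.spanFinrank_maximalIdeal, Finset.coe_singleton, Finset.card_singleton,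
    Nat.cast_one] at hdim
  refine ENat.WithBot.add_le_add_one_right_iff.mp (le_trans ?_ hdim)
  exact_mod_cast hlt

/-- The prime `(x)` contains a minimal prime `p`. As `x ∉ p`, every element of `p` is `x` times an
element of `p`, so `p = x p` and `p = 0` by Nakayama. -/
theorem isDomain_of_quotient [IsLocalRing R] [IsNoetherianRing R] (x : R)
    (hx : x ∈ maximalIdeal R) (hmin : ∀ p ∈ minimalPrimes R, x ∉ p)
    (h : IsDomain (R ⧸ Ideal.span {x})) : IsDomain R := by
  have hprime : (Ideal.span {x}).IsPrime := (Ideal.Quotient.isDomain_iff_prime _).mp h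
  obtain ⟨p, hp, hle⟩ := Ideal.exists_minimalPrimes_le (I := ⊥) (J := Ideal.span {x}) bot_le
  have hpp := Ideal.IsMinimalPrime.isPrime hp
  have hbot : p = ⊥ := by
    refine Submodule.eq_bot_of_le_smul_of_le_jacobson_bot (Ideal.span {x}) p
      (IsNoetherian.noetherian p) (fun y hy => ?_) ?_
    · obtain ⟨z, rfl⟩ := Ideal.mem_span_singleton.mp (hle hy)
      have hz := (hpp.mem_or_mem hy).resolve_left (hmin p hp)
      exact Submodule.smul_mem_smul (Ideal.mem_span_singleton_self x) hz
    · rw [IsLocalRing.jacobson_eq_maximalIdeal _ bot_ne_top]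
      exact (Ideal.span_singleton_le_iff_mem _).mpr hx
  rw [hbot] at hpp
  have : Nontrivial R := inferInstance
  exact IsDomain.of_bot_isPrime R

theorem isDomain_of_isRegularLocalRing (n : ℕ) : ∀ (R : Type u) [CommRing R] [IsRegularLocalRing R],
    (maximalIdeal R).spanFinrank = n → IsDomain R := by
  induction n using Nat.strong_induction_on with
  | _ n ih =>
    rintro R _ _ rfl
    by_cases hR : IsField R
    · exact hR.isDomain
    · have hdim : ringKrullDim R ≠ 0 := by
        rw [← IsRegularLocalRing.spanFinrank_maximalIdeal]
        intro h
        have h' : (maximalIdeal R).spanFinrank = 0 := by exact_mod_cast h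
        rw [Submodule.spanFinrank_eq_zero_iff_eq_bot (IsNoetherian.noetherian _)] at h'
        exact hR (isField_iff_maximalIdeal_eq.mpr h')
      obtain ⟨x, hx, hx', hmin⟩ := exists_notMem_sq_minimalPrimes hR hdim
      obtain ⟨hreg, hlt⟩ := isRegularLocalRing_quotient x hx hx'
      exact isDomain_of_quotient x hx hmin (ih _ (hlt _) _ rfl)

end RegularLocal

namespace OverAlg

open IsLocalRing

/-- The map from a regular local ring to its residue field is a local complete intersection. -/
theorem regular_lci (n : ℕ) {A E : Type u} [CommRing A] [CommRing E] [Algebra A E]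
    {S : OverAlg A E} (hS : IsField S.C) : ∀ {R : OverAlg A E} (g : Hom R S)
      [IsRegularLocalRing R.C], Function.Surjective g.f → (maximalIdeal R.C).spanFinrank = n →
      g.Lci := by
  induction n using Nat.strong_induction_on with
  | _ n ih =>
    rintro R g hreg hg rfl
    have hdom := isDomain_of_isRegularLocalRing _ R.C rfl
    have hker : RingHom.ker g.f = maximalIdeal R.C := by
      let := hS.toField
      exact eq_maximalIdeal (RingHom.ker_isMaximal_of_surjective g.f.toRingHom hg)
    by_cases hR : IsField R.C
    · refine Hom.Lci.of_bijective g ⟨?_, hg⟩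
      rw [isField_iff_maximalIdeal_eq, ← hker] at hR
      exact (RingHom.injective_iff_ker_eq_bot _).mpr hR
    -- Any parameter outside `𝔪²` will do: it is a nonzerodivisor since a regular local ring is a
    -- domain, and the quotient is regular of smaller embedding dimension.
    · obtain ⟨x, hx, hx'⟩ := SetLike.exists_of_lt ((maximalIdeal_sq_lt_maximalIdeal R.C).mpr hR)
      obtain ⟨hreg', hlt⟩ := isRegularLocalRing_quotient x hx hx'
      have hgx : g.f x = 0 := by
        rw [← hker] at hx
        exact hx
      let h : (R.C ⧸ Ideal.span {x}) →ₐ[A] S.C := Ideal.Quotient.liftₐ _ g.f fun y hy => by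
        obtain ⟨z, rfl⟩ := Ideal.mem_span_singleton.mp hy
        rw [map_mul, hgx, zero_mul]
      let R' : OverAlg A E := ⟨R.C ⧸ Ideal.span {x}, S.π.comp h⟩
      let q : Hom R R' := ⟨Ideal.Quotient.mkₐ A _, g.π_f⟩
      let g' : Hom R' S := ⟨h, fun _ => rfl⟩
      have hg' : g'.Lci := ih _ (hlt _) (R := R') g' (fun y => by
        obtain ⟨z, rfl⟩ := hg y
        exact ⟨q.f z, rfl⟩) rfl
      have hq : q.Lci := quotient_lci q x (Ideal.Quotient.eq_zero_iff_mem.mpr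
        (Ideal.mem_span_singleton_self x)) Ideal.Quotient.mk_surjective
        (fun y hy => Ideal.mem_span_singleton.mp (Ideal.Quotient.eq_zero_iff_mem.mp hy))
        (mem_nonZeroDivisors_of_ne_zero (by
          rintro rfl
          exact hx' (zero_mem _)))
      exact hg'.comp hq

end OverAlg

end CotangentComplex

/-! ### Homology classes and canonical maps in terms of cycles -/

namespace CotangentComplex

section Homology

variable {B : Type u} [CommRing B] (K : ChainComplex (ModuleCat.{u} B) ℕ)

theorem iCycles_injective (n : ℕ) : Function.Injective (K.iCycles n).hom :=
  (ModuleCat.mono_iff_injective _).mp inferInstance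

theorem homologyπ_surjective (n : ℕ) : Function.Surjective (K.homologyπ n).hom :=
  (ModuleCat.epi_iff_surjective _).mp inferInstance

theorem d_iCycles (n m : ℕ) (c : K.cycles n) : (K.d n m).hom ((K.iCycles n).hom c) = 0 :=
  congrArg (fun f => f.hom c) (K.iCycles_d n m)

theorem exists_iCycles (n m : ℕ) (h : (ComplexShape.down ℕ).next n = m) (z : K.X n)
    (hz : (K.d n m).hom z = 0) : ∃ c, (K.iCycles n).hom c = z := by
  let f : ModuleCat.of B (LinearMap.ker (K.d n m).hom) ⟶ K.X n :=
    ModuleCat.ofHom (LinearMap.ker (K.d n m).hom).subtype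
  have hf : f ≫ K.d n m = 0 := by
    ext x
    exact x.2
  refine ⟨(K.liftCycles f m h hf).hom ⟨z, hz⟩, ?_⟩
  exact congrArg (fun g => g.hom ⟨z, hz⟩) (K.liftCycles_i f m h hf)

theorem homologyπ_eq_zero_iff (n : ℕ) (c : K.cycles n) :
    (K.homologyπ n).hom c = 0 ↔ ∃ y, (K.d (n + 1) n).hom y = (K.iCycles n).hom c := by
  have hex := ShortComplex.exact_of_g_is_cokernel
    (.mk _ _ (K.toCycles_comp_homologyπ (n + 1) n)) (K.homologyIsCokernel (n + 1) n (by simp))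
  rw [ShortComplex.moduleCat_exact_iff] at hex
  have hi (y) : (K.iCycles n).hom ((K.toCycles (n + 1) n).hom y) = (K.d (n + 1) n).hom y :=
    congrArg (fun f => f.hom y) (K.toCycles_i (n + 1) n)
  constructor
  · intro h
    obtain ⟨y, hy⟩ := hex c h
    exact ⟨y, (hi y).symm.trans (congrArg _ hy)⟩
  · rintro ⟨y, hy⟩
    obtain rfl : (K.toCycles (n + 1) n).hom y = c := iCycles_injective K n ((hi y).trans hy)
    exact congrArg (fun f => f.hom y) (K.toCycles_comp_homologyπ (n + 1) n)

theorem exactAt_of_exact (n m : ℕ)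
    (hK : ∀ z : K.X n, (K.d n m).hom z = 0 → ∃ y, (K.d (n + 1) n).hom y = z) : K.ExactAt n := by
  rw [HomologicalComplex.exactAt_iff_isZero_homology]
  have : Subsingleton (K.homology n) := by
    refine subsingleton_of_forall_eq 0 fun x => ?_
    obtain ⟨c, rfl⟩ := homologyπ_surjective K n x
    exact (homologyπ_eq_zero_iff K n c).mpr (hK _ (d_iCycles K n m c))
  exact ModuleCat.isZero_of_subsingleton _

theorem homologyι_desc_π (n m : ℕ) {N : ModuleCat.{u} B} (f : K.X n ⟶ N)
    (h : (ComplexShape.down ℕ).prev n = m) (hf : K.d m n ≫ f = 0) (c : K.cycles n) :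
    (K.homologyι n ≫ K.descOpcycles f m h hf).hom ((K.homologyπ n).hom c) =
      f.hom ((K.iCycles n).hom c) := by
  refine congrArg (fun g => g.hom c) (?_ : K.homologyπ n ≫ K.homologyι n ≫ K.descOpcycles f m h hf =
    K.iCycles n ≫ f)
  rw [K.homology_π_ι_assoc, K.p_descOpcycles]

theorem homologyπ_mapHomologyIso {C D : Type*} [Category* C] [Category* D] [Limits.HasZeroMorphisms C]
    [Limits.HasZeroMorphisms D] (F : C ⥤ D) [F.PreservesZeroMorphisms] (S : ShortComplex C)
    [S.HasHomology] [(S.map F).HasHomology] [F.PreservesLeftHomologyOf S] :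
    (S.map F).homologyπ ≫ (S.mapHomologyIso F).hom = (S.mapCyclesIso F).hom ≫ F.map S.homologyπ := by
  let hl := S.leftHomologyData
  have h1 : (S.map F).homologyπ ≫ (hl.map F).homologyIso.hom =
      (hl.map F).cyclesIso.hom ≫ F.map hl.π := (hl.map F).homologyπ_comp_homologyIso_hom
  have h2 : hl.π ≫ hl.homologyIso.inv = hl.cyclesIso.inv ≫ S.homologyπ :=
    hl.π_comp_homologyIso_inv
  have e1 : (S.mapHomologyIso F).hom = (hl.map F).homologyIso.hom ≫ F.map hl.homologyIso.inv :=
    congrArg Iso.hom (hl.mapHomologyIso_eq F)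
  have e2 : (S.mapCyclesIso F).hom = (hl.map F).cyclesIso.hom ≫ F.map hl.cyclesIso.inv :=
    congrArg Iso.hom (hl.mapCyclesIso_eq F)
  refine (congrArg ((S.map F).homologyπ ≫ ·) e1).trans ?_
  refine (Category.assoc _ _ _).symm.trans ?_
  refine (congrArg (· ≫ F.map hl.homologyIso.inv) h1).trans ?_
  refine (Category.assoc _ _ _).trans ?_
  refine (congrArg ((hl.map F).cyclesIso.hom ≫ ·) ((F.map_comp _ _).symm.trans
    ((congrArg F.map h2).trans (F.map_comp _ _)))).trans ?_
  refine (Category.assoc _ _ _).symm.trans ?_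
  exact congrArg (· ≫ F.map S.homologyπ) e2.symm

end Homology

section Functoriality

variable (A B A' B' : Type u) [CommRing A] [CommRing B] [Algebra A B]
    [CommRing A'] [CommRing B'] [Algebra A' B'] [Algebra A A'] [Algebra B B'] [Algebra A B']
    [IsScalarTower A A' B'] [IsScalarTower A B B']

/-- `Hmap` is built from an abstract isomorphism between homology and restriction of scalars. This
is its effect on representing cycles, the only form in which it is used afterwards. -/
theorem Hmap_homologyπ (n : ℕ) (c : (cotangentComplex A B).cycles n) :
    ∃ c' : (cotangentComplex A' B').cycles n,
      ((cotangentComplex A' B').iCycles n).hom c' =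
        termMap A B A' B' n (((cotangentComplex A B).iCycles n).hom c) ∧
      Hmap n A B A' B' (((cotangentComplex A B).homologyπ n).hom c) =
        ((cotangentComplex A' B').homologyπ n).hom c' := by
  let F := ModuleCat.restrictScalars (algebraMap B B')
  let K := cotangentComplex A B
  let L := cotangentComplex A' B'
  let φ := cotangentComplex.map A B A' B'
  let S := L.sc n
  let w := ((S.mapCyclesIso F).hom).hom ((HomologicalComplex.cyclesMap φ n).hom c)
  refine ⟨w, ?_, ?_⟩
  · have h1 : (S.mapCyclesIso F).hom ≫ F.map S.iCycles = (S.map F).iCycles :=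
      S.mapCyclesIso_hom_iCycles F
    have h2 := HomologicalComplex.cyclesMap_i φ n
    have h3 := congrArg (fun g => g.hom ((HomologicalComplex.cyclesMap φ n).hom c)) h1
    have h4 := congrArg (fun g => g.hom c) h2
    exact h3.trans h4
  · have h1 := homologyπ_mapHomologyIso F S
    have h2 := HomologicalComplex.homologyπ_naturality φ n
    have h3 := congrArg (fun g => g.hom ((HomologicalComplex.cyclesMap φ n).hom c)) h1
    have h4 := congrArg (fun g => g.hom c) h2
    exact (congrArg (S.mapHomologyIso F).hom.hom h4).trans h3

end Functoriality

end CotangentComplex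

/-! ### Comparison of the cotangent complex with the standard complex -/

namespace CotangentComplex

noncomputable section

section FreeBasis

variable {A K : Type u} [CommRing A] [CommRing K] [Algebra A K]

/-- The elements `1 ⊗ d[p]` of the cotangent space of a free cover. -/
def freeVar (P : Extension.{u} A K) (p : P.Ring) : (free P).CotangentSpace :=
  1 ⊗ₜ KaehlerDifferential.D A (free P).Ring (free.X P p)

/-- The elements `1 ⊗ d[p]` form a basis of the cotangent space of a free cover. -/
def freeBasis (P : Extension.{u} A K) : Module.Basis P.Ring K (free P).CotangentSpace :=
  Module.Basis.baseChange (R := (free P).Ring) K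
    (KaehlerDifferential.mvPolynomialBasis A P.Ring : Module.Basis P.Ring (free P).Ring
      Ω[(free P).Ring⁄A])

theorem freeBasis_apply (P : Extension.{u} A K) (p : P.Ring) : freeBasis P p = freeVar P p := by
  refine (Module.Basis.baseChange_apply (R := (free P).Ring) K _ p).trans ?_
  exact congrArg (fun x => (1 : K) ⊗ₜ[(free P).Ring] x)
    (KaehlerDifferential.mvPolynomialBasis_apply A P.Ring p)

theorem free_induction {P : Extension.{u} A K} {motive : (free P).Ring → Prop}
    (C : ∀ a, motive (algebraMap A (free P).Ring a)) (add : ∀ x y, motive x → motive y → motive (x + y))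
    (mul_X : ∀ x p, motive x → motive (x * free.X P p)) (x : (free P).Ring) : motive x :=
  MvPolynomial.induction_on (R := A) (σ := P.Ring) (motive := motive) x C (fun x y => add x y)
    (fun x p => mul_X x p)

theorem algebraMap_X (P : Extension.{u} A K) (p : P.Ring) :
    algebraMap (free P).Ring K (free.X P p) = algebraMap P.Ring K p :=
  MvPolynomial.aeval_X _ _

theorem one_tmul_D_mul (P : Extension.{u} A K) (x y : P.Ring) :
    ((1 : K) ⊗ₜ KaehlerDifferential.D A P.Ring (x * y) : P.CotangentSpace) =
      algebraMap P.Ring K x • ((1 : K) ⊗ₜ KaehlerDifferential.D A P.Ring y : P.CotangentSpace) +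
      algebraMap P.Ring K y • ((1 : K) ⊗ₜ KaehlerDifferential.D A P.Ring x : P.CotangentSpace) := by
  rw [Derivation.leibniz, TensorProduct.tmul_add, TensorProduct.tmul_smul, TensorProduct.tmul_smul]
  simp only [TensorProduct.smul_tmul', Algebra.smul_def, mul_one]
  rfl

end FreeBasis

namespace OverAlg

variable {A K E : Type u} [CommRing A] [CommRing K] [CommRing E] [Algebra A K] [Algebra A E]

/-- The map `A[P] → A[R]` induced by a map of sets `P → R`. -/
def freeMap (P : Extension.{u} A K) (R : OverAlg A E) (f : P.Ring → R.C) : (free P).Ring →ₐ[A] R.T.C :=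
  (MvPolynomial.rename f : MvPolynomial P.Ring A →ₐ[A] MvPolynomial R.C A)

theorem freeMap_X (P : Extension.{u} A K) (R : OverAlg A E) (f : P.Ring → R.C) (p : P.Ring) :
    freeMap P R f (free.X P p) = R.X (f p) := MvPolynomial.rename_X _ _

theorem freeMap_counit {P : Extension.{u} A K} {R : OverAlg A E} (f : P.Ring →ₐ[A] R.C)
    (x : (free P).Ring) : R.counit.f (freeMap P R f x) = f ((free.counit P).toRingHom x) := by
  induction x using free_induction with
  | C a =>
    rw [AlgHom.commutes, AlgHom.commutes]
    exact ((congrArg f ((free.counit P).toRingHom_algebraMap a)).trans (f.commutes a)).symm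
  | add x y hx hy => simp only [map_add, hx, hy]
  | mul_X x p hx => simp only [map_mul, hx, freeMap_X, counit_X, free.counit_X]

theorem freeMap_map {K' : Type u} [CommRing K'] [Algebra A K'] [Algebra K K']
    [IsScalarTower A K K'] {P : Extension.{u} A K} {Q : Extension.{u} A K'} {R S : OverAlg A E} (f : P.Ring → R.C)
    (g : Q.Ring → S.C) (φ : P.Hom Q) (ψ : R.C → S.C) (h : ∀ x, ψ (f x) = g (φ.toRingHom x))
    (x : (free P).Ring) :
    Tmap ψ (freeMap P R f x) = freeMap Q S g ((free.map φ).toRingHom x) := by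
  induction x using free_induction with
  | C a =>
    rw [AlgHom.commutes, AlgHom.commutes]
    exact ((congrArg _ ((free.map φ).toRingHom_algebraMap a)).trans
      ((freeMap Q S g).commutes a)).symm
  | add x y hx hy => simp only [map_add, hx, hy]
  | mul_X x p hx => simp only [map_mul, hx, freeMap_X, Tmap_X, free.map_X, h]

variable [Algebra K E]

/-- The linear map `1 ⊗ d[p] ↦ [f p]`. -/
def cot (P : Extension.{u} A K) (R : OverAlg A E) (f : P.Ring → R.C) :
    (free P).CotangentSpace →ₗ[K] (R.C →₀ E) :=
  (freeBasis P).constr K (fun p => Finsupp.single (f p) (1 : E))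

theorem cot_freeVar (P : Extension.{u} A K) (R : OverAlg A E) (f : P.Ring → R.C) (p : P.Ring) :
    cot P R f (freeVar P p) = Finsupp.single (f p) 1 := by
  rw [← freeBasis_apply]
  exact (freeBasis P).constr_basis K _ p

theorem cot_bijective {P : Extension.{u} A E} {R : OverAlg A E} {f : P.Ring → R.C}
    (hf : Function.Bijective f) : Function.Bijective (cot P R f) := by
  let e := (freeBasis P).repr ≪≫ₗ Finsupp.domLCongr (Equiv.ofBijective f hf)
  have h : cot P R f = e.toLinearMap := by
    refine (freeBasis P).ext fun p => ?_
    refine Eq.trans ?_ (congrArg (Finsupp.domLCongr (R := E) (M := E) (Equiv.ofBijective f hf))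
      ((freeBasis P).repr_self p)).symm
    rw [freeBasis_apply, cot_freeVar, Finsupp.domLCongr_single]
    rfl
  rw [h]
  exact e.bijective

theorem cot_baseChange_bijective {P : Extension.{u} A K} {R : OverAlg A E} {f : P.Ring → R.C}
    (hf : Function.Bijective f) :
    Function.Bijective (LinearMap.liftBaseChange E (cot P R f)) := by
  let b := (freeBasis P).baseChange E
  let e := b.repr ≪≫ₗ Finsupp.domLCongr (Equiv.ofBijective f hf)
  have h : LinearMap.liftBaseChange E (cot P R f) = e.toLinearMap := by
    refine b.ext fun p => ?_
    refine Eq.trans ?_ (congrArg (Finsupp.domLCongr (R := E) (M := E) (Equiv.ofBijective f hf))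
      (b.repr_self p)).symm
    rw [Module.Basis.baseChange_apply, freeBasis_apply, LinearMap.liftBaseChange_tmul,
      cot_freeVar, one_smul, Finsupp.domLCongr_single]
    rfl
  rw [h]
  exact e.bijective

variable [IsScalarTower A K E]

theorem freeVar_ext {P : Extension.{u} A K} {G : Type u} [AddCommGroup G] [Module K G]
    {f g : (free P).CotangentSpace →ₗ[K] G} (h : ∀ p, f (freeVar P p) = g (freeVar P p)) :
    f = g := (freeBasis P).ext fun p => by rw [freeBasis_apply, h]

theorem π_freeMap {P : Extension.{u} A K} {R : OverAlg A E} {f : P.Ring → R.C}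
    (hf : ∀ x, R.π (f x) = algebraMap K E (algebraMap P.Ring K x)) (x : (free P).Ring) :
    R.T.π (freeMap P R f x) = algebraMap K E (algebraMap (free P).Ring K x) := by
  induction x using free_induction with
  | C a =>
    rw [AlgHom.commutes, AlgHom.commutes, ← IsScalarTower.algebraMap_apply A (free P).Ring K,
      ← IsScalarTower.algebraMap_apply A K E]
  | add x y hx hy => simp only [map_add, hx, hy]
  | mul_X x p hx => simp only [map_mul, hx, freeMap_X, π_X, hf, algebraMap_X]

/-- Both sides are derivations of `A[P]` over `A` that agree on the variables. This is what matches
face `0` of the two complexes. -/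
theorem cot_D {P : Extension.{u} A K} {R : OverAlg A E} {f : P.Ring → R.C}
    (hf : ∀ x, R.π (f x) = algebraMap K E (algebraMap P.Ring K x)) (x : (free P).Ring) :
    cot P R f (1 ⊗ₜ KaehlerDifferential.D A (free P).Ring x) = (dl R).D (freeMap P R f x) := by
  induction x using free_induction with
  | C a =>
    rw [Derivation.map_algebraMap, TensorProduct.tmul_zero, map_zero, AlgHom.commutes,
      Der.D_algebraMap]
  | add x y hx hy => rw [map_add, map_add, map_add, TensorProduct.tmul_add, map_add, hx, hy]
  | mul_X x p hx =>
    rw [one_tmul_D_mul, map_add, map_smul, map_smul, hx, map_mul, Der.leibniz, freeMap_X, dl_X,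
      π_freeMap hf, π_X, hf, algebraMap_X, algebraMap_smul E, algebraMap_smul E]
    exact congrArg (fun z => _ • z + _) (cot_freeVar P R f p)

variable (A K E)

/-- The identification of the iterated polynomial algebras of the standard resolution. -/
def kap : ∀ n, (tower A K n).Ring → (tw (of A K E) n).C
  | 0 => fun x => x
  | n + 1 => freeMap (tower A K n) (tw (of A K E) n) (kap n)

theorem π_kap (n : ℕ) : ∀ x, (tw (of A K E) n).π (kap A K E n x) =
    algebraMap K E (algebraMap (tower A K n).Ring K x) := by
  induction n with
  | zero => exact fun x => rfl
  | succ n ih => exact π_freeMap ih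

theorem kap_bijective (n : ℕ) : Function.Bijective (kap A K E n) := by
  induction n with
  | zero => exact Function.bijective_id
  | succ n ih =>
    exact (MvPolynomial.renameEquiv A (Equiv.ofBijective _ ih)).bijective

theorem exists_kap_algHom (n : ℕ) : ∃ f : (tower A K n).Ring →ₐ[A] (tw (of A K E) n).C,
    ∀ x, f x = kap A K E n x := by
  cases n with
  | zero => exact ⟨AlgHom.id A K, fun x => rfl⟩
  | succ n => exact ⟨freeMap _ _ _, fun x => rfl⟩

theorem kap_counit (n : ℕ) (x : (tower A K (n + 1)).Ring) :
    (tw (of A K E) n).counit.f (kap A K E (n + 1) x) =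
      kap A K E n ((free.counit (tower A K n)).toRingHom x) := by
  obtain ⟨f, hf⟩ := exists_kap_algHom A K E n
  refine Eq.trans ?_ ((freeMap_counit f x).trans (hf _))
  exact congrArg (fun g => (tw (of A K E) n).counit.f (freeMap (tower A K n) (tw (of A K E) n) g x))
    (funext fun x => (hf x).symm)

theorem kap_face (n : ℕ) (i : Fin (n + 1)) : ∀ x : (tower A K (n + 1)).Ring,
    (face (of A K E) n i).f (kap A K E (n + 1) x) =
      kap A K E n ((CotangentComplex.face A K n i).toRingHom x) := by
  induction n with
  | zero => exact kap_counit A K E 0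
  | succ n ih =>
    induction i using Fin.cases with
    | zero => exact kap_counit A K E (n + 1)
    | succ i => exact freeMap_map _ _ _ _ (ih i)

/-- The comparison of the terms of the cotangent complex with free modules. -/
def comp (n : ℕ) : (tower A K (n + 1)).CotangentSpace →ₗ[K] ((tw (of A K E) n).C →₀ E) :=
  cot (tower A K n) (tw (of A K E) n) (kap A K E n)

theorem comp_freeVar (n : ℕ) (p : (tower A K n).Ring) :
    comp A K E n (freeVar (tower A K n) p) = Finsupp.single (kap A K E n p) 1 :=
  cot_freeVar _ _ _ _

theorem comp_D (n : ℕ) (p : (tower A K (n + 1)).Ring) :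
    comp A K E n (1 ⊗ₜ KaehlerDifferential.D A (tower A K (n + 1)).Ring p) =
      (dl (tw (of A K E) n)).D (kap A K E (n + 1) p) :=
  cot_D (π_kap A K E n) p

theorem cotangentSpace_map_freeVar {A' K' : Type u} [CommRing A'] [CommRing K'] [Algebra A' K']
    [Algebra A A'] [Algebra A K'] [Algebra K K'] [IsScalarTower A A' K'] [IsScalarTower A K K']
    {P : Extension.{u} A K} {Q : Extension.{u} A' K'} (φ : (free P).Hom Q) (p : P.Ring) :
    Extension.CotangentSpace.map φ (freeVar P p) =
      1 ⊗ₜ KaehlerDifferential.D A' Q.Ring (φ.toRingHom (free.X P p)) := by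
  refine (Extension.CotangentSpace.map_tmul φ _ _).trans ?_
  rw [map_one]
  rfl

theorem comp_face (n : ℕ) (i : Fin (n + 2)) (x) :
    comp A K E n (Extension.CotangentSpace.map (CotangentComplex.face A K (n + 1) i) x) =
      bface (of A K E) n i (comp A K E (n + 1) x) := by
  have key : comp A K E n ∘ₗ Extension.CotangentSpace.map (CotangentComplex.face A K (n + 1) i) =
      (bface (of A K E) n i).restrictScalars K ∘ₗ comp A K E (n + 1) := by
    refine freeVar_ext fun p => ?_
    refine (congrArg (comp A K E n) (cotangentSpace_map_freeVar A K _ p)).trans ?_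
    refine Eq.trans ?_ (congrArg (bface (of A K E) n i) (comp_freeVar A K E (n + 1) p)).symm
    induction i using Fin.cases with
    | zero =>
      rw [bface_zero_single, one_smul, CotangentComplex.face_zero]
      refine (comp_D A K E n _).trans (congrArg (fun z => (dl (tw (of A K E) n)).D
        (kap A K E (n + 1) z)) (free.counit_X _ p))
    | succ i =>
      rw [bface_succ_single, CotangentComplex.face_succ, kap_face]
      refine Eq.trans ?_ (comp_freeVar A K E n _)
      exact congrArg (fun z => comp A K E n (1 ⊗ₜ KaehlerDifferential.D A (tower A K (n + 1)).Ring z))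
        (free.map_X _ _)
  exact congrArg (fun f => f x) key

theorem comp_differential (n : ℕ) (x) :
    comp A K E n (differential A K n x) = bdiff (of A K E) n (comp A K E (n + 1) x) := by
  simp only [differential, bdiff, LinearMap.sum_apply, LinearMap.smul_apply, map_sum, map_zsmul,
    comp_face]

theorem comp_bijective (n : ℕ) : Function.Bijective (comp A K K n) :=
  cot_bijective (kap_bijective A K K n)

/-- The comparison after base change. -/
def compE (n : ℕ) : E ⊗[K] (tower A K (n + 1)).CotangentSpace →ₗ[E] ((tw (of A K E) n).C →₀ E) :=
  LinearMap.liftBaseChange E (comp A K E n)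

theorem compE_bijective (n : ℕ) : Function.Bijective (compE A K E n) :=
  cot_baseChange_bijective (kap_bijective A K E n)

theorem kap_map (n : ℕ) : ∀ x : (tower A K n).Ring,
    kap A E E n ((tower.map A K A E n).toRingHom x) =
      (twhom (ofHom A K E E) n).f (kap A K E n x) := by
  induction n with
  | zero => exact fun x => rfl
  | succ n ih =>
    exact fun x => (freeMap_map _ _ _ _ (fun x => (ih x).symm) x).symm

theorem comp_termMap (n : ℕ) (x : (tower A K (n + 1)).CotangentSpace) :
    comp A E E n (termMap A K A E n x) = bmap (ofHom A K E E) n (comp A K E n x) := by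
  refine Submodule.span_induction (p := fun x _ => comp A E E n (termMap A K A E n x) =
    bmap (ofHom A K E E) n (comp A K E n x)) ?_ ?_ ?_ ?_ ((freeBasis (tower A K n)).mem_span x)
  · rintro _ ⟨p, rfl⟩
    rw [freeBasis_apply]
    refine (congrArg (comp A E E n) (cotangentSpace_map_freeVar A K
      (tower.map A K A E (n + 1)) p)).trans ?_
    refine Eq.trans ?_ (congrArg (bmap (ofHom A K E E) n) (comp_freeVar A K E n p)).symm
    refine (congrArg (fun z => comp A E E n (1 ⊗ₜ KaehlerDifferential.D A (tower A E (n + 1)).Ring z))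
      (free.map_X _ _)).trans ?_
    refine (comp_freeVar A E E n _).trans ?_
    rw [kap_map]
    exact (lmap_single (twhom (ofHom A K E E) n).f _ _).symm
  · simp only [map_zero]
  · intro x y _ _ hx hy
    simp only [map_add, hx, hy]
  · intro a x _ hx
    refine (congrArg (comp A E E n) (LinearMap.map_smulₛₗ (termMap A K A E n) a x)).trans ?_
    refine ((comp A E E n).map_smul _ _).trans ?_
    rw [hx]
    refine Eq.trans ?_ (congrArg (bmap (ofHom A K E E) n) ((comp A K E n).map_smul a x)).symm
    rw [← algebraMap_smul E a (comp A K E n x), map_smul]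

end OverAlg

end

end CotangentComplex

/-! ### Injectivity for field extensions and vanishing for regular local rings -/

namespace CotangentComplex

noncomputable section

/-- Linear algebra behind injectivity on homology: `Z` and `H` are cycles and homology of `C₂ → C₁`,
and `D₂ → D₁` is the base change of this differential. If a cycle `t` of `E ⊗ C₁` bounds in `D₁`, it
bounds already in `E ⊗ C₁`, and by flatness it is the image of a chain in `E ⊗ Z`. -/
theorem liftBaseChange_injective {K E C₂ C₁ Z H D₂ D₁ H' : Type*} [Field K] [CommRing E]
    [Algebra K E] [AddCommGroup C₂] [Module K C₂] [AddCommGroup C₁] [Module K C₁] [AddCommGroup Z]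
    [Module K Z] [AddCommGroup H] [Module K H] [AddCommGroup D₂] [Module K D₂] [Module E D₂]
    [IsScalarTower K E D₂] [AddCommGroup D₁] [Module K D₁] [Module E D₁] [IsScalarTower K E D₁]
    [AddCommGroup H'] [Module K H'] [Module E H'] [IsScalarTower K E H'] (d : C₂ →ₗ[K] C₁)
    (i : Z →ₗ[K] C₁) (τ : C₂ →ₗ[K] Z) (π : Z →ₗ[K] H) (hi : Function.Injective i)
    (hτ : i ∘ₗ τ = d) (hπ : Function.Surjective π) (hπτ : π ∘ₗ τ = 0) (Φ₂ : C₂ →ₗ[K] D₂)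
    (Φ₁ : C₁ →ₗ[K] D₁) (b : D₂ →ₗ[E] D₁) (hb : ∀ x, b (Φ₂ x) = Φ₁ (d x))
    (h₂ : Function.Surjective (Φ₂.liftBaseChange E)) (h₁ : Function.Injective (Φ₁.liftBaseChange E))
    (θ : H →ₗ[K] H') (h : ∀ t, θ.liftBaseChange E (π.baseChange E t) = 0 →
      ∃ y, b y = Φ₁.liftBaseChange E (i.baseChange E t)) :
    Function.Injective (θ.liftBaseChange E) := by
  refine (injective_iff_map_eq_zero _).mpr fun s hs => ?_
  obtain ⟨t, rfl⟩ : ∃ t, π.baseChange E t = s := LinearMap.lTensor_surjective E hπ s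
  obtain ⟨y, hy⟩ := h t hs
  obtain ⟨w, rfl⟩ := h₂ y
  have hbΦ : b ∘ₗ Φ₂.liftBaseChange E = Φ₁.liftBaseChange E ∘ₗ d.baseChange E := by
    ext x
    simp [hb]
  have hw : i.baseChange E (τ.baseChange E w) = i.baseChange E t := by
    refine h₁ (Eq.trans ?_ hy)
    refine Eq.trans ?_ (congrArg (fun f => f w) hbΦ).symm
    rw [LinearMap.comp_apply, ← hτ, LinearMap.baseChange_comp, LinearMap.comp_apply]
  have hinj : Function.Injective (i.baseChange E) := Module.Flat.lTensor_preserves_injective_linearMap i hi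
  rw [← hinj hw, ← LinearMap.comp_apply, ← LinearMap.baseChange_comp, hπτ, LinearMap.baseChange_zero,
    LinearMap.zero_apply]

open OverAlg

variable (A K E : Type u) [CommRing A] [Field K] [Field E] [Algebra A K] [Algebra K E]
  [Algebra A E] [IsScalarTower A K E]

theorem d_eq (n : ℕ) (x : (tower A K (n + 2)).CotangentSpace) :
    ((cotangentComplex A K).d (n + 1) n).hom x = differential A K n x :=
  congrArg (fun f => f.hom x) (cotangentComplex_d A K n)

/-- The inclusion of the cycles of the cotangent complex. -/
def iCyc (n : ℕ) :
    ((cotangentComplex A K).cycles n : Type u) →ₗ[K] (tower A K (n + 1)).CotangentSpace :=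
  ((cotangentComplex A K).iCycles n).hom

theorem differential_iCyc (n : ℕ) (c : (cotangentComplex A K).cycles (n + 1)) :
    differential A K n (iCyc A K (n + 1) c) = 0 :=
  (d_eq A K n _).symm.trans (d_iCycles _ _ _ c)

theorem exists_iCyc (n : ℕ) (x : (tower A K (n + 2)).CotangentSpace)
    (hx : differential A K n x = 0) : ∃ c, iCyc A K (n + 1) c = x :=
  exists_iCycles (cotangentComplex A K) (n + 1) n (by simp) x ((d_eq A K n x).trans hx)

theorem homologyπ_eq_zero_iff_differential (n : ℕ) (c : (cotangentComplex A K).cycles n) :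
    ((cotangentComplex A K).homologyπ n).hom c = 0 ↔ ∃ y, differential A K n y = iCyc A K n c := by
  refine (homologyπ_eq_zero_iff _ n c).trans (exists_congr fun y => ?_)
  exact iff_of_eq (congrArg (· = iCyc A K n c) (d_eq A K n y))

/-- Represents the image of a class of `E ⊗ H_n(L_{K/A})` by a cycle of `L_{E/A}` whose image in the
standard complex comes from `K`. -/
theorem exists_cycle (n : ℕ) (t : E ⊗[K] ((cotangentComplex A K).cycles n : Type u)) :
    ∃ c : (cotangentComplex A E).cycles n,
      ((cotangentComplex A E).homologyπ n).hom c =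
        extendMap n A K E (((cotangentComplex A K).homologyπ n).hom.baseChange E t) ∧
      comp A E E n (iCyc A E n c) = bmap (ofHom A K E E) n
        (compE A K E n ((iCyc A K n).baseChange E t)) := by
  induction t using TensorProduct.induction_on with
  | zero => exact ⟨0, by simp only [map_zero], by simp only [map_zero]⟩
  | add x y hx hy =>
    obtain ⟨c, h1, h2⟩ := hx
    obtain ⟨c', h1', h2'⟩ := hy
    exact ⟨c + c', by simp only [map_add, h1, h1'], by simp only [map_add, h2, h2']⟩
  | tmul e x =>
    obtain ⟨c, h1, h2⟩ := Hmap_homologyπ A K A E n x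
    refine ⟨e • c, ?_, ?_⟩
    · rw [map_smul, ← h2, LinearMap.baseChange_tmul]
      rfl
    · have h1' : iCyc A E n c = termMap A K A E n (iCyc A K n x) := h1
      rw [map_smul, h1', LinearMap.baseChange_tmul, map_smul, comp_termMap, ← map_smul]
      rfl

/-- For field extensions `K → E`, the maps `E ⊗ H_n(L_{K/A}) → H_n(L_{E/A})`, `n ≥ 1`, are
injective. -/
theorem extendMap_injective (n : ℕ) : Function.Injective (extendMap (n + 1) A K E) := by
  let : Module K (H (n + 1) A E) := Module.compHom _ (algebraMap K E)
  have : IsScalarTower K E (H (n + 1) A E) := IsScalarTower.of_algebraMap_smul fun _ _ => rfl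
  refine liftBaseChange_injective (differential A K (n + 1))
    (iCyc A K (n + 1)) ((cotangentComplex A K).toCycles (n + 2) (n + 1)).hom
    ((cotangentComplex A K).homologyπ (n + 1)).hom (iCycles_injective _ _) ?_
    (homologyπ_surjective _ _)
    (congrArg (fun f => f.hom) ((cotangentComplex A K).toCycles_comp_homologyπ (n + 2) (n + 1)))
    (comp A K E (n + 2)) (comp A K E (n + 1)) (bdiff (of A K E) (n + 1))
    (fun x => (comp_differential A K E (n + 1) x).symm)
    (compE_bijective A K E _).2 (compE_bijective A K E _).1 _ (fun t ht => ?_)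
  · exact (congrArg (fun f => f.hom) ((cotangentComplex A K).toCycles_i (n + 2) (n + 1))).trans
      (congrArg (fun f => f.hom) (cotangentComplex_d A K (n + 1)))
  · obtain ⟨c, h1, h2⟩ := exists_cycle A K E (n + 1) t
    obtain ⟨y, hy⟩ := (homologyπ_eq_zero_iff_differential A E _ c).mp (h1.trans ht)
    refine (field_lci A K E).inj n _ ?_ ⟨comp A E E (n + 2) y, ?_⟩
    · have h0 : bdiff (of A K E) n ∘ₗ compE A K E (n + 1) ∘ₗ (iCyc A K (n + 1)).baseChange E = 0 := by
        refine TensorProduct.AlgebraTensorModule.ext fun e x => ?_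
        refine ((bdiff (of A K E) n).map_smul e (comp A K E (n + 1) (iCyc A K (n + 1) x))).trans ?_
        rw [← comp_differential, differential_iCyc, map_zero, smul_zero]
        rfl
      exact congrArg (fun f => f t) h0
    · refine Eq.trans ?_ h2
      rw [← comp_differential, hy]

theorem exactAt_of_bdiff_exact (n : ℕ) (h : ∀ x, bdiff (of A K K) n x = 0 →
    ∃ y, bdiff (of A K K) (n + 1) y = x) : (cotangentComplex A K).ExactAt (n + 1) := by
  have h' (z : (tower A K (n + 2)).CotangentSpace) (hz : differential A K n z = 0) :
      ∃ y, differential A K (n + 1) y = z := by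
    obtain ⟨y, hy⟩ := h (comp A K K (n + 1) z) (by rw [← comp_differential, hz, map_zero])
    obtain ⟨y, rfl⟩ := (comp_bijective A K (n + 2)).2 y
    refine ⟨y, (comp_bijective A K (n + 1)).1 ?_⟩
    rw [comp_differential, hy]
  refine exactAt_of_exact _ (n + 1) n fun z hz => ?_
  obtain ⟨y, hy⟩ := h' z ((d_eq A K n z).symm.trans hz)
  exact ⟨y, (d_eq A K (n + 1) y).trans hy⟩

/-- With a section, `R` has no homology in positive degrees, so surjectivity from `R` leaves none
for `S` in degrees `≥ 2`. -/
theorem exact_of_lci {R S : OverAlg A E} {g : Hom R S} (hg : g.Lci) (s : Hom R R.T)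
    (hs : ∀ x, R.counit.f (s.f x) = x) (n : ℕ) (y) (hy : bdiff S (n + 1) y = 0) :
    ∃ z, bdiff S (n + 2) z = y := by
  obtain ⟨x, hx, z, hz⟩ := hg.surj n y hy
  obtain ⟨w, rfl⟩ := bdiff_exact_of_section s hs _ x hx
  exact ⟨z + bmap g (n + 3) w, by rw [map_add, hz, ← bmap_bdiff, sub_add_cancel]⟩

theorem exactAt_of_isRegularLocalRing [IsRegularLocalRing A]
    (hsurj : Function.Surjective (algebraMap A K)) (n : ℕ) :
    (cotangentComplex A E).ExactAt (n + 2) := by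
  refine exactAt_of_bdiff_exact A E (n + 1) fun y hy => ?_
  let R : OverAlg A E := of A A E
  let g : Hom R (of A K E) := ofHom A A K E
  have hR : IsRegularLocalRing R.C := inferInstanceAs (IsRegularLocalRing A)
  have hg : g.Lci := regular_lci _ (Field.toIsField K) g hsurj rfl
  -- The initial `A`-algebra `A` has the structure map as a section of `A[A] → A`; this expresses
  -- the triviality of `L_{A/A}`.
  let s : Hom R R.T := ⟨Algebra.ofId A _, fun x => by
    change R.T.π (algebraMap A _ x) = algebraMap A E x
    rw [AlgHom.commutes]⟩
  refine exact_of_lci A E (Hom.Lci.comp (field_lci A K E) hg) s (fun x => ?_) n y hy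
  exact AlgHom.commutes _ _

end

end CotangentComplex

/-! ### Identification of `H_0` and `H_1` with differentials and the conormal kernel -/

namespace CotangentComplex

noncomputable section

/-- The relations `hδ` are those imposed by the boundaries from degree `2`. They make `x ↦ δ[x] -
δ[0]` linear on `J`, and such a map kills `J²` because the target is a `B`-module. -/
theorem exists_cotangent_lift {A B : Type u} [CommRing A] [CommRing B] [Algebra A B]
    {P : Extension.{u} A B} {Q : Type u} [AddCommGroup Q] [Module B Q]
    (δ : (free P).CotangentSpace →ₗ[B] Q) (f g : (free P).Hom P) (s : B → P.Ring)
    (hf : ∀ x, f.toRingHom (free.X P x) = x)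
    (hg : ∀ x, g.toRingHom (free.X P x) = s (algebraMap P.Ring B x))
    (hs : ∀ b, algebraMap P.Ring B (s b) = b)
    (hδ : ∀ q : (free P).Ring, δ (1 ⊗ₜ KaehlerDifferential.D A (free P).Ring q) =
      δ (freeVar P (f.toRingHom q)) - δ (freeVar P (g.toRingHom q))) :
    ∃ φ : P.Cotangent →ₗ[B] Q, ∀ z, φ (f.sub g z) = δ z := by
  -- The relation for `[x] + [y]`. Its error term depends only on the images in `B`, so on `J` it is
  -- eliminated by comparison with `x = y = 0`.
  have hadd (x y : P.Ring) : δ (freeVar P x) + δ (freeVar P y) = δ (freeVar P (x + y)) -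
      δ (freeVar P (s (algebraMap P.Ring B x) + s (algebraMap P.Ring B y))) := by
    have h := hδ (free.X P x + free.X P y)
    rw [map_add, TensorProduct.tmul_add, map_add, map_add, map_add, hf, hf, hg, hg] at h
    exact h
  have hmul (x y : P.Ring) : algebraMap P.Ring B x • δ (freeVar P y) +
      algebraMap P.Ring B y • δ (freeVar P x) = δ (freeVar P (x * y)) -
      δ (freeVar P (s (algebraMap P.Ring B x) * s (algebraMap P.Ring B y))) := by
    have h := hδ (free.X P x * free.X P y)
    rw [one_tmul_D_mul, map_mul, map_mul, map_add, map_smul, map_smul, hf, hf, hg, hg,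
      algebraMap_X, algebraMap_X] at h
    exact h
  have hsb (b : B) : δ (freeVar P (s b)) = 0 := by
    have h := hδ (free.X P (s b))
    rw [hf, hg, hs] at h
    have h' : δ (freeVar P (s b)) = δ (freeVar P (s b)) - δ (freeVar P (s b)) := h
    rwa [sub_self] at h'
  let : Module P.Ring Q := Module.compHom Q (algebraMap P.Ring B)
  have : IsScalarTower P.Ring B Q := IsScalarTower.of_algebraMap_smul fun _ _ => rfl
  let φ : P.ker →ₗ[P.Ring] Q :=
    { toFun := fun x => δ (freeVar P x) - δ (freeVar P 0)
      map_add' := fun x y => by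
        have h := hadd x y
        have h0 := hadd 0 0
        rw [show algebraMap P.Ring B x = 0 from x.2, show algebraMap P.Ring B y = 0 from y.2] at h
        rw [map_zero, add_zero] at h0
        rw [Submodule.coe_add]
        linear_combination (norm := module) h0 - h
      map_smul' := fun p x => by
        have h := hmul p x
        have h0 := hmul p 0
        rw [show algebraMap P.Ring B x = 0 from x.2, zero_smul, add_zero] at h
        rw [map_zero, mul_zero, zero_smul, add_zero] at h0
        change δ (freeVar P (p * x)) - _ = algebraMap P.Ring B p • (_ - _)
        rw [smul_sub, h, h0]
        abel }
  have hφ : (P.ker • ⊤ : Submodule P.Ring P.ker) ≤ LinearMap.ker φ := by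
    refine Submodule.smul_le.mpr fun p hp x _ => ?_
    rw [LinearMap.mem_ker, map_smul, ← algebraMap_smul B p (φ x),
      show algebraMap P.Ring B p = 0 from hp, zero_smul]
  let ψ : P.ker.Cotangent →ₗ[P.Ring] Q := Submodule.liftQ _ φ hφ
  let χ : P.Cotangent →ₗ[B] Q :=
    (ψ ∘ₗ P.cotangentEquivCotangentKer.toLinearMap).extendScalarsOfSurjective P.algebraMap_surjective
  have hχ (x : P.ker) : χ (Extension.Cotangent.mk x) = δ (freeVar P x) - δ (freeVar P 0) := rfl
  refine ⟨χ, fun z => congrArg (fun h => h z) (?_ : χ ∘ₗ f.sub g = δ)⟩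
  refine OverAlg.freeVar_ext fun p => ?_
  rw [LinearMap.comp_apply, freeVar, Extension.Hom.sub_one_tmul, hχ, Extension.Hom.subToKer_apply_coe]
  have h1 : f.toRingHom (free.X P p) - g.toRingHom (free.X P p) = p - s (algebraMap P.Ring B p) :=
    congrArg₂ (· - ·) (hf p) (hg p)
  rw [h1]
  have h := hδ (free.X P p - free.X P (s (algebraMap P.Ring B p)))
  rw [map_sub, TensorProduct.tmul_sub, map_sub, map_sub, map_sub, hf, hf, hg, hg, hs, sub_self] at h
  have h' : δ (freeVar P p) - δ (freeVar P (s (algebraMap P.Ring B p))) = _ := h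
  rw [hsb, sub_zero] at h'
  exact h'.symm

section

variable (A B : Type u) [CommRing A] [CommRing B] [Algebra A B]

theorem face_one_zero_X (x : (tower A B 1).Ring) :
    (face A B 1 0).toRingHom (free.X (tower A B 1) x) = x := free.counit_X _ _

theorem face_one_one_X (x : (tower A B 1).Ring) :
    (face A B 1 1).toRingHom (free.X (tower A B 1) x) =
      free.X (tower A B 0) (algebraMap (tower A B 1).Ring B x) := by
  refine (free.map_X (free.counit (tower A B 0)) x).trans ?_
  exact congrArg (free.X (tower A B 0)) ((free.counit (tower A B 0)).algebraMap_toRingHom x)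

theorem algebraMap_tower_one (b : B) :
    algebraMap (tower A B 1).Ring B (free.X (tower A B 0) b) = b := algebraMap_X (tower A B 0) b

theorem differential_one_freeVar (q : (tower A B 2).Ring) :
    differential A B 1 (freeVar (tower A B 2) q) =
      ((1 ⊗ₜ KaehlerDifferential.D A (free (tower A B 1)).Ring q -
      freeVar (tower A B 1) ((face A B 1 0).toRingHom q) +
      freeVar (tower A B 1) ((face A B 1 1).toRingHom q) : (free (tower A B 1)).CotangentSpace)) := by
  refine (differential_one_D A B (free.X (tower A B 2) q)).trans ?_
  have h0 : (face A B 2 0).toRingHom (free.X (tower A B 2) q) = q := free.counit_X _ _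
  have h1 : (face A B 2 1).toRingHom (free.X (tower A B 2) q) =
    free.X (tower A B 1) ((face A B 1 0).toRingHom q) := free.map_X _ _
  have h2 : (face A B 2 2).toRingHom (free.X (tower A B 2) q) =
    free.X (tower A B 1) ((face A B 1 1).toRingHom q) := free.map_X _ _
  rw [h0, h1, h2]
  rfl

/-- The lifting lemma is applied to the quotient by the image of `differential A B 1`: the boundary
of `1 ⊗ d[q]` is precisely the relation needed for `q`. The quotient map then factors through
`J/J²`. -/
theorem exists_differential_one (z : (tower A B 2).CotangentSpace)
    (hz : (face A B 1 0).sub (face A B 1 1) z = 0) : ∃ y, differential A B 1 y = z := by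
  let N : Submodule B (free (tower A B 1)).CotangentSpace := LinearMap.range (differential A B 1)
  obtain ⟨φ, hφ⟩ := exists_cotangent_lift (P := tower A B 1) (Q := (free (tower A B 1)).CotangentSpace ⧸ N)
    N.mkQ (face A B 1 0) (face A B 1 1) (fun b => free.X (tower A B 0) b) (face_one_zero_X A B)
    (face_one_one_X A B) (algebraMap_tower_one A B) (by
      intro q
      rw [← map_sub N.mkQ, ← sub_eq_zero, ← map_sub N.mkQ]
      refine (Submodule.Quotient.mk_eq_zero N).mpr ⟨freeVar (tower A B 2) q, ?_⟩
      refine (differential_one_freeVar A B q).trans ?_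
      abel)
  exact (Submodule.Quotient.mk_eq_zero N).mp
    ((hφ z).symm.trans ((congrArg φ hz).trans (map_zero φ)))

/-- For `x ∈ J` the chain `d[x] - d[0]` maps to the class of `x`: the second faces of `[x]` and
`[0]` coincide and cancel. -/
theorem sub_surjective : Function.Surjective ((face A B 1 0).sub (face A B 1 1)) := by
  intro y
  obtain ⟨x, rfl⟩ := Extension.Cotangent.mk_surjective y
  refine ⟨freeVar (tower A B 1) x - freeVar (tower A B 1) 0, ?_⟩
  have h (x : (tower A B 1).Ring) : (face A B 1 0).sub (face A B 1 1) (freeVar (tower A B 1) x) =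
    Extension.Cotangent.mk ((face A B 1 0).subToKer (face A B 1 1) (free.X (tower A B 1) x)) :=
    Extension.Hom.sub_one_tmul _ _ _
  refine (map_sub _ _ _).trans ?_
  rw [h, h, ← map_sub]
  refine congrArg _ (Subtype.ext ?_)
  refine (congrArg₂ (· - ·) (congrArg₂ (· - ·) (face_one_zero_X A B _) (face_one_one_X A B _))
    (congrArg₂ (· - ·) (face_one_zero_X A B _) (face_one_one_X A B _))).trans ?_
  rw [show algebraMap (tower A B 1).Ring B x = 0 from x.2, map_zero]
  exact (sub_sub_sub_cancel_right _ _ _).trans (sub_zero _)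

end

end

end CotangentComplex

namespace CotangentComplex

noncomputable section

variable (A K : Type u) [CommRing A] [Field K] [Algebra A K]

theorem toKaehler_homologyπ (c : (cotangentComplex A K).cycles 0) :
    toKaehler A K (((cotangentComplex A K).homologyπ 0).hom c) =
      (tower A K 1).toKaehler (iCyc A K 0 c) :=
  homologyι_desc_π (cotangentComplex A K) 0 1
    (N := ModuleCat.of K Ω[K⁄A]) (ModuleCat.ofHom (tower A K 1).toKaehler) (by simp) _ c

theorem toCotangent_homologyπ (c : (cotangentComplex A K).cycles 1) :
    toCotangent A K (((cotangentComplex A K).homologyπ 1).hom c) =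
      (face A K 1 0).sub (face A K 1 1) (iCyc A K 1 c) :=
  homologyι_desc_π (cotangentComplex A K) 1 2
    (N := ModuleCat.of K (tower A K 1).Cotangent)
    (ModuleCat.ofHom ((face A K 1 0).sub (face A K 1 1))) (by simp) _ c

theorem exists_iCyc_zero (x : (tower A K 1).CotangentSpace) : ∃ c, iCyc A K 0 c = x :=
  exists_iCycles (cotangentComplex A K) 0 0 (by simp) x (by
    rw [HomologicalComplex.shape _ _ _ (by simp)]
    rfl)

theorem differential_zero_apply (x : (tower A K 2).CotangentSpace) :
    differential A K 0 x = (tower A K 1).cotangentComplex ((face A K 1 0).sub (face A K 1 1) x) :=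
  congrArg (fun f => f x) (differential_zero A K)

/-- `H_0(L_{K/A})` is the module of differentials. -/
theorem toKaehler_bijective : Function.Bijective (toKaehler A K) := by
  constructor
  · refine (injective_iff_map_eq_zero _).mpr fun x hx => ?_
    obtain ⟨c, rfl⟩ := homologyπ_surjective _ 0 x
    rw [toKaehler_homologyπ] at hx
    obtain ⟨y, hy⟩ := ((tower A K 1).exact_cotangentComplex_toKaehler _).mp hx
    obtain ⟨z, rfl⟩ := sub_surjective A K y
    exact (homologyπ_eq_zero_iff_differential A K 0 c).mpr
      ⟨z, (differential_zero_apply A K z).trans hy⟩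
  · intro x
    obtain ⟨y, rfl⟩ := (tower A K 1).toKaehler_surjective x
    obtain ⟨c, rfl⟩ := exists_iCyc_zero A K y
    exact ⟨_, toKaehler_homologyπ A K c⟩

/-- The identity of `A[K]`, as a map from the standard presentation of `K` to the degree `0` term of
the standard resolution. -/
def selfToTowerOne (A B : Type u) [CommRing A] [CommRing B] [Algebra A B] :
    (Generators.self A B).toExtension.Hom (tower A B 1) where
  toRingHom := RingHom.id (MvPolynomial B A)
  toRingHom_algebraMap _ := rfl
  algebraMap_toRingHom _ := rfl

/-- The map from `H_1(L_{K/A})` to the kernel of `J/J² → K ⊗ Ω_{P_0/A}`. -/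
def toTowerH1 : H 1 A K →ₗ[K] (tower A K 1).H1Cotangent :=
  LinearMap.codRestrict (LinearMap.ker (tower A K 1).cotangentComplex) (toCotangent A K)
    (cotangentComplex_toCotangent A K)

/-- The degree `1` term modulo boundaries is `J/J²`, and the differential to degree `0` factors
through it. -/
theorem toTowerH1_bijective : Function.Bijective (toTowerH1 A K) := by
  constructor
  · refine (injective_iff_map_eq_zero _).mpr fun x hx => ?_
    obtain ⟨c, rfl⟩ := homologyπ_surjective _ 1 x
    have h : toCotangent A K (((cotangentComplex A K).homologyπ 1).hom c) = 0 :=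
      congrArg Subtype.val hx
    rw [toCotangent_homologyπ] at h
    exact (homologyπ_eq_zero_iff_differential A K 1 c).mpr (exists_differential_one A K _ h)
  · rintro ⟨y, hy⟩
    obtain ⟨z, rfl⟩ := sub_surjective A K y
    obtain ⟨c, rfl⟩ := exists_iCyc A K 0 z ((differential_zero_apply A K z).trans hy)
    exact ⟨_, Subtype.ext (toCotangent_homologyπ A K c)⟩

theorem towerOneToSelf_bijective :
    Function.Bijective (Extension.H1Cotangent.map (towerOneToSelf A K)) :=
  (Extension.H1Cotangent.equiv (towerOneToSelf A K) (selfToTowerOne A K)).bijective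

/-- `H_1(L_{K/A})` is the first homology of the truncated cotangent complex. -/
theorem toH1Cotangent_bijective : Function.Bijective (toH1Cotangent A K) :=
  (towerOneToSelf_bijective A K).comp (toTowerH1_bijective A K)

variable (A' K' : Type u) [CommRing A'] [Field K'] [Algebra A' K'] [Algebra A A'] [Algebra K K']
  [Algebra A K'] [IsScalarTower A A' K'] [IsScalarTower A K K']

theorem sub_termMap (x : (tower A K 2).CotangentSpace) :
    (face A' K' 1 0).sub (face A' K' 1 1) (termMap A K A' K' 1 x) =
      Extension.Cotangent.map (tower.map A K A' K' 1) ((face A K 1 0).sub (face A K 1 1) x) := by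
  have key : ((face A' K' 1 0).sub (face A' K' 1 1)).restrictScalars K ∘ₗ
      (Extension.CotangentSpace.map (tower.map A K A' K' 2)) =
      Extension.Cotangent.map (tower.map A K A' K' 1) ∘ₗ (face A K 1 0).sub (face A K 1 1) := by
    refine OverAlg.freeVar_ext fun p => ?_
    refine (congrArg ((face A' K' 1 0).sub (face A' K' 1 1)) (OverAlg.cotangentSpace_map_freeVar A K
      (tower.map A K A' K' 2) p)).trans ?_
    refine (Extension.Hom.sub_one_tmul _ _ _).trans ?_
    refine Eq.trans ?_ (congrArg (Extension.Cotangent.map (tower.map A K A' K' 1))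
      (Extension.Hom.sub_one_tmul (face A K 1 0) (face A K 1 1) (free.X (tower A K 1) p))).symm
    refine Eq.trans ?_ (Extension.Cotangent.map_mk _ _).symm
    refine congrArg _ (Subtype.ext ?_)
    have h (i : Fin 2) := congrArg (fun f => f.toRingHom (free.X (tower A K 1) p))
      (tower.map_comp_face A K A' K' 1 i)
    refine (congrArg₂ (· - ·) (h 0) (h 1)).symm.trans ?_
    exact (map_sub (tower.map A K A' K' 1).toRingHom _ _).symm
  exact congrArg (fun f => f x) key

theorem toTowerH1_Hmap (x : H 1 A K) :
    toTowerH1 A' K' (Hmap 1 A K A' K' x) =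
      Extension.H1Cotangent.map (tower.map A K A' K' 1) (toTowerH1 A K x) := by
  obtain ⟨c, rfl⟩ := homologyπ_surjective _ 1 x
  obtain ⟨c', h1, h2⟩ := Hmap_homologyπ A K A' K' 1 c
  rw [h2]
  refine Subtype.ext ?_
  refine (toCotangent_homologyπ A' K' c').trans ?_
  refine (congrArg ((face A' K' 1 0).sub (face A' K' 1 1)) h1).trans ?_
  refine (sub_termMap A K A' K' _).trans ?_
  exact congrArg (Extension.Cotangent.map (tower.map A K A' K' 1)) (toCotangent_homologyπ A K c).symm

/-- Naturality of the comparison with the truncated cotangent complex. -/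
theorem toH1Cotangent_Hmap (x : H 1 A K) :
    toH1Cotangent A' K' (Hmap 1 A K A' K' x) =
      H1Cotangent.map A A' K K' (toH1Cotangent A K x) := by
  have h : (Extension.H1Cotangent.map ((towerOneToSelf A' K').comp (tower.map A K A' K' 1))) =
      Extension.H1Cotangent.map ((Generators.defaultHom (Generators.self A K)
        (Generators.self A' K')).toExtensionHom.comp (towerOneToSelf A K)) :=
    Extension.H1Cotangent.map_eq _ _
  refine (congrArg (Extension.H1Cotangent.map (towerOneToSelf A' K'))
    (toTowerH1_Hmap A K A' K' x)).trans ?_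
  refine (Extension.H1Cotangent.map_comp_apply (tower.map A K A' K' 1) (towerOneToSelf A' K')
    (toTowerH1 A K x)).symm.trans ?_
  refine (congrArg (fun f => f (toTowerH1 A K x)) h).trans ?_
  exact Extension.H1Cotangent.map_comp_apply _ _ _

end

end CotangentComplex

/-! ### Perfect fields, the boundary map, and extensions containing `p`-th roots -/

namespace CotangentComplex

section Perfect

universe v

variable (k : Type v) (E : Type u) [Field k] [Field E] [Algebra k E]

/-- A representing polynomial involves finitely many variables, indexed by elements of a finitely
generated subfield `L`. Vanishing of the value and of the partial derivatives at the tautological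
point descends along the injection `L → E`. -/
theorem exists_h1Cotangent_adjoin (x : H1Cotangent k E) :
    ∃ (s : Finset E) (y : H1Cotangent k (IntermediateField.adjoin k (s : Set E))),
      H1Cotangent.map k k (IntermediateField.adjoin k (s : Set E)) E y = x := by
  obtain ⟨x, hx⟩ := x
  obtain ⟨⟨x, hxk⟩, rfl⟩ := Extension.Cotangent.mk_surjective x
  obtain ⟨s, q, hq⟩ := MvPolynomial.exists_finset_rename (show MvPolynomial E k from x)
  let L := IntermediateField.adjoin k (s : Set E)
  let q' : MvPolynomial L k := MvPolynomial.rename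
    (fun x : s => (⟨x.1, IntermediateField.subset_adjoin k _ x.2⟩ : L)) q
  have hq' : MvPolynomial.rename (fun y : L => (y : E)) q' = x := by
    rw [MvPolynomial.rename_rename]
    exact hq.symm
  let f := (Generators.defaultHom (Generators.self k L) (Generators.self k E)).toExtensionHom
  have hf : f.toRingHom q' = x := by
    refine Eq.trans ?_ hq'
    refine congrArg (fun g : MvPolynomial L k →ₐ[k] MvPolynomial E k => g q')
      (MvPolynomial.algHom_ext (f := (Generators.defaultHom (Generators.self k L)
        (Generators.self k E)).toAlgHom) fun i => ?_)
    rw [MvPolynomial.rename_X]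
    exact Generators.Hom.toAlgHom_X _ i
  have hker : (q' : MvPolynomial L k) ∈ (Generators.self k L).toExtension.ker := by
    refine (algebraMap L E).injective ?_
    rw [map_zero]
    refine (f.algebraMap_toRingHom q').symm.trans ?_
    exact (congrArg _ hf).trans hxk
  refine ⟨s, ⟨Extension.Cotangent.mk ⟨q', hker⟩, ?_⟩, ?_⟩
  · rw [LinearMap.mem_ker, Extension.cotangentComplex_mk] at hx ⊢
    refine (Generators.self k L).cotangentSpaceBasis.repr.injective (Finsupp.ext fun i => ?_)
    rw [map_zero]
    have h := congrArg (fun z => (Generators.self k E).cotangentSpaceBasis.repr z i.1) hx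
    have h1 : MvPolynomial.aeval (R := k) (fun y : E => y) (MvPolynomial.pderiv i.1
        (show MvPolynomial E k from x)) = 0 := by
      refine ((Generators.self k E).cotangentSpaceBasis_repr_one_tmul x i.1).symm.trans (h.trans ?_)
      rw [map_zero, Finsupp.zero_apply]
    refine ((Generators.self k L).cotangentSpaceBasis_repr_one_tmul q' i).trans ?_
    refine (algebraMap L E).injective ?_
    rw [Finsupp.zero_apply, map_zero]
    refine Eq.trans ?_ h1
    rw [← hq', MvPolynomial.pderiv_rename Subtype.val_injective, MvPolynomial.aeval_rename]
    exact (MvPolynomial.aeval_algebraMap_apply E (fun y : L => y) _).symm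
  · refine Subtype.ext ?_
    refine (Extension.Cotangent.map_mk f _).trans ?_
    exact congrArg _ (Subtype.ext hf)

/-- Finitely generated extensions of a perfect field are formally smooth, and every class comes from
one of them. -/
theorem subsingleton_h1Cotangent_of_perfectField [PerfectField k] : Subsingleton (H1Cotangent k E) := by
  refine subsingleton_of_forall_eq 0 fun x => ?_
  obtain ⟨s, y, rfl⟩ := exists_h1Cotangent_adjoin k E x
  have : Algebra.EssFiniteType k (IntermediateField.adjoin k (s : Set E)) :=
    IntermediateField.essFiniteType_iff.mpr ⟨s, rfl⟩
  rw [Subsingleton.elim y 0, map_zero]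

end Perfect

theorem h1Cotangent_map_comp_eq_zero (R k F E : Type*) [CommRing R] [CommRing k] [CommRing F]
    [CommRing E] [Algebra R k] [Algebra R F] [Algebra R E] [Algebra k F] [Algebra k E] [Algebra F E]
    [IsScalarTower R k F] [IsScalarTower R k E] [IsScalarTower R F E] [IsScalarTower k F E]
    [Subsingleton (H1Cotangent k E)] (x : H1Cotangent R E) : H1Cotangent.map R F E E x = 0 := by
  have h : H1Cotangent.map R F E E x = H1Cotangent.map k F E E (H1Cotangent.map R k E E x) := by
    let f := (Generators.defaultHom (Generators.self R E) (Generators.self k E)).toExtensionHom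
    let g := (Generators.defaultHom (Generators.self k E) (Generators.self F E)).toExtensionHom
    refine Eq.trans ?_ (Extension.H1Cotangent.map_comp_apply f g x)
    exact congrArg (fun f => f x) (Extension.H1Cotangent.map_eq
      (Generators.defaultHom (Generators.self R E) (Generators.self F E)).toExtensionHom (g.comp f))
  rw [h, Subsingleton.elim (H1Cotangent.map R k E E x) 0, map_zero]

theorem δ_injective_of_subsingleton (R k F E : Type*) [CommRing R] [CommRing k] [CommRing F]
    [CommRing E] [Algebra R k] [Algebra R F] [Algebra R E] [Algebra k F] [Algebra k E] [Algebra F E]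
    [IsScalarTower R k F] [IsScalarTower R k E] [IsScalarTower R F E] [IsScalarTower k F E]
    [Subsingleton (H1Cotangent k E)] : Function.Injective (H1Cotangent.δ R F E) := by
  refine (injective_iff_map_eq_zero _).mpr fun x hx => ?_
  obtain ⟨y, rfl⟩ := (H1Cotangent.exact_map_δ R F E x).mp hx
  exact h1Cotangent_map_comp_eq_zero R k F E y

/-- For a field extension `E/F`, the connecting map `H_1(L_{E/F}) → E ⊗ Ω_F` is injective. -/
theorem δ_int_injective (F E : Type u) [Field F] [Field E] [Algebra F E] :
    Function.Injective (H1Cotangent.δ ℤ F E) := by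
  obtain ⟨p, hp⟩ := CharP.exists F
  have := charP_of_injective_algebraMap (algebraMap F E).injective p
  -- Through the prime field, `ZMod p` or `ℚ`, the map `H_1(L_{E/ℤ}) → H_1(L_{E/F})` is zero, and
  -- its image is the kernel of `δ`.
  rcases CharP.char_is_prime_or_zero F p with hp' | rfl
  · have : Fact p.Prime := ⟨hp'⟩
    let : Algebra (ZMod p) F := ZMod.algebra F p
    let : Algebra (ZMod p) E := ZMod.algebra E p
    have : IsScalarTower (ZMod p) F E := IsScalarTower.of_algebraMap_eq' (Subsingleton.elim _ _)
    have := subsingleton_h1Cotangent_of_perfectField (ZMod p) E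
    exact δ_injective_of_subsingleton ℤ (ZMod p) F E
  · have := CharP.charP_to_charZero F
    have := CharP.charP_to_charZero E
    have := subsingleton_h1Cotangent_of_perfectField ℚ E
    exact δ_injective_of_subsingleton ℤ ℚ F E

section Differentials

variable (R R' S T : Type*) [CommRing R] [CommRing R'] [CommRing S] [CommRing T] [Algebra R R']
  [Algebra R S] [Algebra R' S] [Algebra R T] [Algebra R' T] [Algebra S T] [IsScalarTower R R' S]
  [IsScalarTower R S T] [IsScalarTower R' S T]

theorem lTensor_map_δ (x : H1Cotangent S T) :
    LinearMap.lTensor T (KaehlerDifferential.map R R' S S) (H1Cotangent.δ R S T x) =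
      H1Cotangent.δ R' S T x := by
  obtain ⟨x, hx⟩ := x
  obtain ⟨x, rfl⟩ := Extension.Cotangent.mk_surjective x
  refine (congrArg _ (Generators.H1Cotangent.δ_eq_δAux (Generators.self S T) (Generators.self R S)
    x hx)).trans ?_
  refine Eq.trans ?_ (Generators.H1Cotangent.δ_eq_δAux (Generators.self S T) (Generators.self R' S)
    x hx).symm
  generalize x.1 = q
  induction q using MvPolynomial.induction_on' with
  | monomial n r =>
    refine (congrArg _ (Generators.H1Cotangent.δAux_monomial (R := R) (Generators.self S T) n r)).trans ?_
    refine Eq.trans ?_ (Generators.H1Cotangent.δAux_monomial (R := R') (Generators.self S T) n r).symm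
    rw [LinearMap.lTensor_tmul, KaehlerDifferential.map_D]
    rfl
  | add p q hp hq =>
    refine (congrArg _ (map_add (Generators.H1Cotangent.δAux R (Generators.self S T)) p q)).trans ?_
    refine Eq.trans ?_ (map_add (Generators.H1Cotangent.δAux R' (Generators.self S T)) p q).symm
    rw [map_add, hp, hq]

theorem map_injective_of_mapBaseChange_eq_zero (h : KaehlerDifferential.mapBaseChange R R' S = 0) :
    Function.Injective (KaehlerDifferential.map R R' S S) := by
  refine (injective_iff_map_eq_zero _).mpr fun x hx => ?_
  obtain ⟨y, rfl⟩ := (KaehlerDifferential.exact_mapBaseChange_map R R' S x).mp hx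
  rw [h, LinearMap.zero_apply]

end Differentials

theorem mapBaseChange_eq_zero_of_pow (F E : Type u) [Field F] [Field E] [Algebra F E] (p : ℕ) [CharP F p]
    (h : ∀ x : F, ∃ y : E, y ^ p = algebraMap F E x) :
    KaehlerDifferential.mapBaseChange ℤ F E = 0 := by
  have := charP_of_injective_algebraMap (algebraMap F E).injective p
  have hD (x : F) : KaehlerDifferential.D ℤ E (algebraMap F E x) = 0 := by
    obtain ⟨y, hy⟩ := h x
    rw [← hy, Derivation.leibniz_pow, ← Nat.cast_smul_eq_nsmul E, CharP.cast_eq_zero, zero_smul]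
  refine TensorProduct.AlgebraTensorModule.ext fun e x => ?_
  rw [LinearMap.zero_apply, KaehlerDifferential.mapBaseChange_tmul]
  have hx : KaehlerDifferential.map ℤ ℤ F E x = 0 := by
    have : x ∈ Submodule.span F (Set.range (KaehlerDifferential.D ℤ F)) := by
      rw [KaehlerDifferential.span_range_derivation]
      trivial
    induction this using Submodule.span_induction with
    | mem x hx =>
      obtain ⟨x, rfl⟩ := hx
      rw [KaehlerDifferential.map_D, hD]
    | zero => rw [map_zero]
    | add x y _ _ hx hy => rw [map_add, hx, hy, add_zero]
    | smul a x _ hx => rw [map_smul, hx, smul_zero]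
  rw [hx, smul_zero]

/-- The boundary into `E' ⊗ Ω[E⁄F]` kills the image of `x`. It is the absolute boundary, which is
injective, followed by the map induced by `Ω[E⁄ℤ] → Ω[E⁄F]`; the latter is injective because
differentials from `F` vanish in `Ω[E⁄ℤ]`, `p`-th powers having zero differential. -/
theorem h1Cotangent_map_eq_zero_of_pow (F E E' : Type u) [Field F] [Field E] [Field E']
    [Algebra F E] [Algebra F E'] [Algebra E E'] [IsScalarTower F E E'] (p : ℕ) [CharP F p]
    (h : ∀ x : F, ∃ y : E, y ^ p = algebraMap F E x)
    (x : H1Cotangent F E') : H1Cotangent.map F E E' E' x = 0 := by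
  have h0 : H1Cotangent.δ F E E' (H1Cotangent.map F E E' E' x) = 0 :=
    (H1Cotangent.exact_map_δ F E E' _).mpr ⟨x, rfl⟩
  rw [← lTensor_map_δ ℤ F E E'] at h0
  refine δ_int_injective E E' ?_
  rw [map_zero]
  refine Module.Flat.lTensor_preserves_injective_linearMap (M := E') _
    (map_injective_of_mapBaseChange_eq_zero ℤ F E (mapBaseChange_eq_zero_of_pow F E p h)) ?_
  rw [h0, map_zero]

end CotangentComplex

/-! ### Exact sequences for `A → F → E` and the conormal module -/

namespace CotangentComplex

noncomputable section

section Tower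

variable (A F E : Type u) [CommRing A] [Field F] [Field E] [Algebra A F] [Algebra F E] [Algebra A E]
  [IsScalarTower A F E]

theorem extendMap_tmul (n : ℕ) (e : E) (x : H n A F) :
    extendMap n A F E (e ⊗ₜ[F] x) = e • Hmap n A F A E x := rfl

theorem toH1Cotangent_extendMap (t : E ⊗[F] (H 1 A F : Type u)) :
    toH1Cotangent A E (extendMap 1 A F E t) =
      (H1Cotangent.map A A F E).liftBaseChange E ((toH1Cotangent A F).baseChange E t) := by
  induction t using TensorProduct.induction_on with
  | zero => simp only [map_zero]
  | add x y hx hy => simp only [map_add, hx, hy]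
  | tmul e x =>
    rw [extendMap_tmul, map_smul, toH1Cotangent_Hmap, LinearMap.baseChange_tmul,
      LinearMap.liftBaseChange_tmul]

/-- The Jacobi–Zariski sequence, exact at `H_1(L_{E/A})` because `F → E` is flat, transported along
the comparison with `H1Cotangent`. -/
theorem exists_extendMap_iff (y : H 1 A E) :
    (∃ t, extendMap 1 A F E t = y) ↔ H1Cotangent.map A F E E (toH1Cotangent A E y) = 0 := by
  rw [H1Cotangent.exact_liftBaseChange_map_of_flat A F E]
  constructor
  · rintro ⟨t, rfl⟩
    exact ⟨_, (toH1Cotangent_extendMap A F E t).symm⟩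
  · rintro ⟨s, hs⟩
    obtain ⟨t, rfl⟩ : ∃ t, (toH1Cotangent A F).baseChange E t = s :=
      LinearMap.lTensor_surjective E (toH1Cotangent_bijective A F).2 s
    exact ⟨t, (toH1Cotangent_bijective A E).1 ((toH1Cotangent_extendMap A F E t).trans hs)⟩

theorem toKaehler_Hmap (x : H 0 A E) :
    toKaehler F E (Hmap 0 A E F E x) = KaehlerDifferential.map A F E E (toKaehler A E x) := by
  obtain ⟨c, rfl⟩ := homologyπ_surjective _ 0 x
  obtain ⟨c', h1, h2⟩ := Hmap_homologyπ A E F E 0 c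
  rw [h2, toKaehler_homologyπ, toKaehler_homologyπ]
  refine (congrArg (tower F E 1).toKaehler h1).trans ?_
  have hD (q : (tower A E 1).Ring) : KaehlerDifferential.map A F E E
      (KaehlerDifferential.map A A (tower A E 1).Ring E (KaehlerDifferential.D A _ q)) =
      KaehlerDifferential.D F E (algebraMap (tower A E 1).Ring E q) := by
    rw [KaehlerDifferential.map_D, KaehlerDifferential.map_D]
    rfl
  have key : (tower F E 1).toKaehler ∘ₗ Extension.CotangentSpace.map (tower.map A E F E 1) =
      KaehlerDifferential.map A F E E ∘ₗ (tower A E 1).toKaehler := by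
    refine OverAlg.freeVar_ext fun p => ?_
    refine (congrArg (tower F E 1).toKaehler (OverAlg.cotangentSpace_map_freeVar A E
      (tower.map A E F E 1) p)).trans ?_
    refine (KaehlerDifferential.mapBaseChange_tmul F (tower F E 1).Ring E _ _).trans ?_
    refine Eq.trans ?_ (congrArg (KaehlerDifferential.map A F E E)
      (KaehlerDifferential.mapBaseChange_tmul A (tower A E 1).Ring E _ _)).symm
    rw [one_smul, one_smul, KaehlerDifferential.map_D]
    refine (congrArg _ ((tower.map A E F E 1).algebraMap_toRingHom (free.X (tower A E 0) p))).trans ?_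
    exact (hD _).symm
  exact congrArg (fun f => f (iCyc A E 0 c)) key

theorem zerothMap_bijective (hsurj : Function.Surjective (algebraMap A F)) :
    Function.Bijective (zerothMap A F E) := by
  have h : (zerothMap A F E : H 0 A E → Ω[E⁄F]) =
      KaehlerDifferential.map A F E E ∘ toKaehler A E := funext (toKaehler_Hmap A F E)
  rw [h]
  refine Function.Bijective.comp ⟨?_, KaehlerDifferential.map_surjective A F E⟩
    (toKaehler_bijective A E)
  refine map_injective_of_mapBaseChange_eq_zero A F E ?_
  have := KaehlerDifferential.subsingleton_of_surjective A F hsurj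
  exact Subsingleton.elim _ _

theorem minusBoundary_eq (x : H 1 A E) : minusBoundary A F E x =
    H1Cotangent.δ ℤ F E (H1Cotangent.map A F E E (toH1Cotangent A E x)) :=
  congrArg (H1Cotangent.δ ℤ F E) (toH1Cotangent_Hmap A E F E x)

theorem exact_extendMap_minusBoundary :
    Function.Exact (extendMap 1 A F E) (minusBoundary A F E) := by
  intro y
  rw [minusBoundary_eq]
  refine Iff.trans ?_ (exists_extendMap_iff A F E y).symm
  exact map_eq_zero_iff _ (δ_int_injective F E)

/-- The kernel of `E ⊗ Ω_F → Ω_E` is the image of the boundary on `H_1(L_{E/F})`. Since `Ω[F⁄A] =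
0`, every class of `H_1(L_{E/F})` comes from `H_1(L_{E/A})`. -/
theorem range_minusBoundary (hsurj : Function.Surjective (algebraMap A F)) :
    LinearMap.range (minusBoundary A F E) = LinearMap.ker (differentialsMap F E) := by
  change _ = LinearMap.ker (KaehlerDifferential.mapBaseChange ℤ F E)
  rw [(H1Cotangent.exact_δ_mapBaseChange ℤ F E).linearMap_ker_eq]
  have := KaehlerDifferential.subsingleton_of_surjective A F hsurj
  refine le_antisymm ?_ ?_
  · rintro _ ⟨x, rfl⟩
    exact ⟨_, rfl⟩
  · rintro _ ⟨x, rfl⟩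
    obtain ⟨y, rfl⟩ := (H1Cotangent.exact_map_δ A F E x).mp (Subsingleton.elim _ _)
    obtain ⟨z, rfl⟩ := (toH1Cotangent_bijective A E).2 y
    exact ⟨z, minusBoundary_eq A F E z⟩

theorem minusBoundary_surjective_of_pow (hsurj : Function.Surjective (algebraMap A F)) (p : ℕ)
    [CharP F p] (h : ∀ x : F, ∃ y : E, y ^ p = algebraMap F E x) :
    Function.Surjective (minusBoundary A F E) := by
  rw [← LinearMap.range_eq_top, range_minusBoundary A F E hsurj, LinearMap.ker_eq_top]
  exact mapBaseChange_eq_zero_of_pow F E p h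

theorem extendMap_surjective_of_map_eq_zero
    (h : ∀ x : H1Cotangent A E, H1Cotangent.map A F E E x = 0) :
    Function.Surjective (extendMap 1 A F E) :=
  fun y => (exists_extendMap_iff A F E y).mpr (h _)

end Tower

section Local

variable (A : Type u) [CommRing A] [IsLocalRing A]

theorem residueCotangent_bijective : Function.Bijective (residueCotangent A) := by
  constructor
  · refine (injective_iff_map_eq_zero _).mpr fun x hx => ?_
    obtain ⟨x, rfl⟩ := Extension.Cotangent.mk_surjective x
    have h : (IsLocalRing.maximalIdeal A).toCotangent ⟨x.1, (residueExtension_ker A).le x.2⟩ = 0 := hx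
    rw [Ideal.toCotangent_eq_zero] at h
    refine Extension.Cotangent.ext ?_
    refine (Ideal.toCotangent_eq_zero (residueExtension A).ker x).mpr ?_
    have hk : (residueExtension A).ker ^ 2 = IsLocalRing.maximalIdeal A ^ 2 :=
      congrArg (· ^ 2) (residueExtension_ker A)
    exact hk.ge h
  · intro y
    obtain ⟨x, rfl⟩ := Ideal.toCotangent_surjective _ y
    exact ⟨Extension.Cotangent.mk ⟨x.1, (residueExtension_ker A).ge x.2⟩, rfl⟩

/-- The map from `A` to a polynomial algebra, as a map of extensions. -/
def residueToSelf : (residueExtension A).Hom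
    (Generators.self A (IsLocalRing.ResidueField A)).toExtension where
  toRingHom := (MvPolynomial.C : A →+* MvPolynomial (IsLocalRing.ResidueField A) A)
  toRingHom_algebraMap _ := rfl
  algebraMap_toRingHom x := (IsScalarTower.algebraMap_apply A
    (Generators.self A (IsLocalRing.ResidueField A)).toExtension.Ring
    (IsLocalRing.ResidueField A) x).symm

theorem residueExtension_h1Cotangentι_bijective :
    Function.Bijective (Extension.h1Cotangentι (P := residueExtension A)) := by
  refine ⟨Extension.h1Cotangentι_injective, fun x => ?_⟩
  refine (Extension.exact_hCotangentι_cotangentComplex x).mp ?_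
  have : Subsingleton Ω[(residueExtension A).Ring⁄A] :=
    KaehlerDifferential.subsingleton_of_surjective A A Function.surjective_id
  exact Subsingleton.elim _ _

/-- The presentation `A → F` computes the same `H_1` as the polynomial one. There the conormal
module is `𝔪/𝔪²` and the differential out of it vanishes, because `Ω[A⁄A] = 0`. -/
theorem toConormal_bijective : Function.Bijective (toConormal A) :=
  ((residueCotangent_bijective A).comp (residueExtension_h1Cotangentι_bijective A)).comp
    ((Extension.H1Cotangent.equiv (residueExtension A).defaultHom (residueToSelf A)).bijective.comp
      (toH1Cotangent_bijective A _))

end Local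

theorem exactAt_zero_of_subsingleton (A F E : Type u) [CommRing A] [Field F] [Field E] [Algebra A F]
    [Algebra F E] [Algebra A E] [IsScalarTower A F E]
    (hsurj : Function.Surjective (algebraMap A F)) [Subsingleton Ω[E⁄F]] :
    (cotangentComplex A E).ExactAt 0 := by
  rw [HomologicalComplex.exactAt_iff_isZero_homology]
  have : Subsingleton (H 0 A E) := (zerothMap_bijective A F E hsurj).1.subsingleton
  exact ModuleCat.isZero_of_subsingleton _

end

end CotangentComplex

theorem proposition1p3 (S : AlgebraicGeometry.Scheme.{u}) (s : S) (E : Type u) [Field E]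
    [Algebra (Stalk S s) E] [Algebra (Res S s) E] [IsScalarTower (Stalk S s) (Res S s) E] :
    -- 1. the isomorphism `H_0(L_{E/S}) → Ω_{E/F}`
    Function.Bijective (zerothMap (Stalk S s) (Res S s) E) ∧
    -- 1. the canonical map `H_1(L_{F/S}) → 𝔪/𝔪²` is an isomorphism `e`, and with
    -- `α : E ⊗ 𝔪/𝔪² → H_1(L_{E/S})` the map obtained from `E ⊗ H_1(L_{F/S}) → H_1(L_{E/S})`
    -- via `e`, the sequence
    -- `0 → E ⊗ 𝔪/𝔪² → H_1(L_{E/S}) → Ker(E ⊗ Ω_F → Ω_E) → 0` is exact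
    (∃ (e : H 1 (Stalk S s) (Res S s) ≃ₗ[Res S s] IsLocalRing.CotangentSpace (Stalk S s))
        (α : E ⊗[Res S s] IsLocalRing.CotangentSpace (Stalk S s) →ₗ[E] H 1 (Stalk S s) E),
      e.toLinearMap = toConormal (Stalk S s) ∧
      α = extendMap 1 (Stalk S s) (Res S s) E ∘ₗ e.symm.toLinearMap.baseChange E ∧
      Function.Injective α ∧
      Function.Exact α (minusBoundary (Stalk S s) (Res S s) E) ∧
      LinearMap.range (minusBoundary (Stalk S s) (Res S s) E) =
        LinearMap.ker (differentialsMap (Res S s) E) ∧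
      -- 2. if `F` has characteristic `p > 0` and `E ⊇ F^{1/p}`, then the sequence
      -- `0 → E ⊗ 𝔪/𝔪² → H_1(L_{E/S}) → E ⊗ Ω_F → 0` is exact
      (∀ p : ℕ, p.Prime → CharP (Res S s) p →
        (∀ x : Res S s, ∃ y : E, y ^ p = algebraMap (Res S s) E x) →
        Function.Injective α ∧
        Function.Exact α (minusBoundary (Stalk S s) (Res S s) E) ∧
        Function.Surjective (minusBoundary (Stalk S s) (Res S s) E))) ∧
    -- 3. `E' ⊗_E H_1(L_{E/S}) → H_1(L_{E'/S})` is injective, and bijective if `F` has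
    -- characteristic `0`, or characteristic `p > 0` and `E ⊇ F^{1/p}`
    (∀ (E' : Type u) [Field E'] [Algebra E E'] [Algebra (Stalk S s) E']
        [IsScalarTower (Stalk S s) E E'],
      Function.Injective (extendMap 1 (Stalk S s) E E') ∧
      (CharZero (Res S s) → Function.Bijective (extendMap 1 (Stalk S s) E E')) ∧
      (∀ p : ℕ, p.Prime → CharP (Res S s) p →
        (∀ x : Res S s, ∃ y : E, y ^ p = algebraMap (Res S s) E x) →
        Function.Bijective (extendMap 1 (Stalk S s) E E'))) ∧
    -- 4. if `S` is regular at `s`, then `L_{E/S}` is acyclic outside `[-1, 0]`, and outside `-1`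
    -- if moreover `Ω_{E/F} = 0`
    (IsRegularLocalRing (Stalk S s) →
      (∀ n : ℕ, n ≠ 0 → n ≠ 1 → (pointComplex S s E).ExactAt n) ∧
      (Subsingleton Ω[E⁄Res S s] → ∀ n : ℕ, n ≠ 1 → (pointComplex S s E).ExactAt n)) := by
  have hsurj : Function.Surjective (algebraMap (Stalk S s) (Res S s)) :=
    IsLocalRing.residue_surjective
  refine ⟨zerothMap_bijective _ _ E hsurj, ?_, ?_, ?_⟩
  · let e := LinearEquiv.ofBijective (toConormal (Stalk S s)) (toConormal_bijective (Stalk S s))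
    let e' := e.symm.baseChange (A := E)
    have he' : e'.toLinearMap = e.symm.toLinearMap.baseChange E := rfl
    have hinj : Function.Injective
        (extendMap 1 (Stalk S s) (Res S s) E ∘ₗ e.symm.toLinearMap.baseChange E) := by
      rw [← he']
      exact (extendMap_injective (Stalk S s) (Res S s) E 0).comp e'.injective
    have hex : Function.Exact
        (extendMap 1 (Stalk S s) (Res S s) E ∘ₗ e.symm.toLinearMap.baseChange E)
        (minusBoundary (Stalk S s) (Res S s) E) := by
      rw [← he']
      intro y
      rw [exact_extendMap_minusBoundary (Stalk S s) (Res S s) E y]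
      exact (e'.surjective.range_comp (extendMap 1 (Stalk S s) (Res S s) E) ▸ Iff.rfl)
    refine ⟨e, _, rfl, rfl, hinj, hex, range_minusBoundary _ _ E hsurj, fun p _ _ hp => ?_⟩
    exact ⟨hinj, hex, minusBoundary_surjective_of_pow _ _ E hsurj p hp⟩
  · intro E' _ _ _ _
    have hinj := extendMap_injective (Stalk S s) E E' 0
    refine ⟨hinj, fun _ => ⟨hinj, ?_⟩, fun p _ _ hp => ⟨hinj, ?_⟩⟩
    -- In characteristic zero `E` is perfect, so the obstruction group `H_1(L_{E'/E})` is zero.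
    · have := charZero_of_injective_algebraMap (algebraMap (Res S s) E).injective
      have := subsingleton_h1Cotangent_of_perfectField E E'
      exact extendMap_surjective_of_map_eq_zero _ E E' fun x => Subsingleton.elim _ _
    -- In characteristic `p` the obstruction map to `H_1(L_{E'/E})` factors through `H_1(L_{E'/F})`,
    -- from where it is zero. The `F`-algebra structure on `E'` is not part of the data and is
    -- defined through `E`.
    · let : Algebra (Res S s) E' := ((algebraMap E E').comp (algebraMap (Res S s) E)).toAlgebra
      have : IsScalarTower (Res S s) E E' := IsScalarTower.of_algebraMap_eq' rfl
      have : IsScalarTower (Stalk S s) (Res S s) E' := IsScalarTower.of_algebraMap_eq fun x => by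
        rw [IsScalarTower.algebraMap_apply (Stalk S s) E E',
          IsScalarTower.algebraMap_apply (Stalk S s) (Res S s) E]
        rfl
      refine extendMap_surjective_of_map_eq_zero _ E E' fun x => ?_
      let f := (Generators.defaultHom (Generators.self (Stalk S s) E')
        (Generators.self (Res S s) E')).toExtensionHom
      let g := (Generators.defaultHom (Generators.self (Res S s) E')
        (Generators.self E E')).toExtensionHom
      refine Eq.trans (Eq.trans ?_ (Extension.H1Cotangent.map_comp_apply f g x))
        (h1Cotangent_map_eq_zero_of_pow (Res S s) E E' p hp _)
      exact congrArg (fun f => f x) (Extension.H1Cotangent.map_eq _ (g.comp f))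
  · intro _
    have h (n : ℕ) (h0 : n ≠ 0) (h1 : n ≠ 1) : (pointComplex S s E).ExactAt n := by
      obtain ⟨n, rfl⟩ : ∃ m, n = m + 2 := ⟨n - 2, by lia⟩
      exact exactAt_of_isRegularLocalRing (Stalk S s) (Res S s) E hsurj n
    refine ⟨h, fun _ n h1 => ?_⟩
    by_cases h0 : n = 0
    · subst h0
      exact exactAt_zero_of_subsingleton (Stalk S s) (Res S s) E hsurj
    · exact h n h0 h1
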